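/- Let $N\ge 2$ and $1\le k<N$ be integers. For a $C^2$ function $f:\mathbb R^N\to\mathbb R$ let $\lambda_1(D^2f)\le\dots\le\lambda_N(D^2f)$ be the eigenvalues of its Hessian and put $\mathcal P_k^+f:=\sum_{i=N-k+1}^{N}\lambda_i(D^2f)$, the sum of the $k$ largest ones. For $p>0$ and $u_0:\mathbb R^N\to[0,\infty)$ consider the Cauchy problem $$\partial_t u=\mathcal P_k^+u+u^{1+p}\ \text{ in }(0,T)\times\mathbb R^N,\qquad u(0,\cdot)=u_0. \tag{1}$$ For $0<T\le\infty$, a viscosity solution of (1) on $[0,T)$ is a nonnegative continuous function on $[0,T)\times\mathbb R^N$ which equals $u_0$ at $t=0$ and satisfies the equation in the viscosity sense in $(0,T)\times\mathbb R^N$. It is called a UC solution if moreover it is uniformly continuous on $[0,T']\times\mathbb R^N$ for every finite $T'<T$. A UC solution on $[0,T)$ is called maximal if no UC solution of (1) with the same datum $u_0$ exists on $[0,T')$ for any $T'>T$. **Theorem.** (A) Let $0<p<\frac2k$. For every uniformly continuous, nonnegative, not identically zero $u_0:\mathbb R^N\to\mathbb R$, the solution of (1) blows up in finite time, that is: 1.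 there is a finite $T_0$, depending on $u_0$ (and $N,k,p$), such that every viscosity solution of (1) on $[0,T)$ has $T\le T_0$; in particular there is no global viscosity solution; 2. if $u$ is a maximal UC solution on $[0,T)$, then $T<\infty$ and $\sup_{x\in\mathbb R^N}|u(t,x)|\to\infty$ as $t\uparrow T$; 3. if $u_0$ is bounded, then there are $T\in(0,\infty)$ and a UC solution $u$ of (1) on $[0,T)$ with $\sup_{x\in\mathbb R^N}|u(t,x)|\to\infty$ as $t\uparrow T$. (B) Hence the Fujita exponent of the problem is $\frac2k$: for every $0<p<\frac2k$ and every uniformly continuous, nonnegative, nontrivial $u_0$ there is finite time blow-up in the sense of (A), whereas for every $p>\frac2k$ there is a uniformly continuous, nonnegative, nontrivial $u_0$ for which (1) has a bounded UC solution on $[0,\infty)$. -/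

import Mathlib

open Set Filter Topology

/-- The sum of the `k` largest eigenvalues (counted with multiplicity) of a real symmetric matrix.
`Matrix.IsHermitian.eigenvalues₀` lists the eigenvalues in nonincreasing order, so this is
`λ_{N-k+1}(A) + ⋯ + λ_N(A)` for `λ_1(A) ≤ ⋯ ≤ λ_N(A)`. (Nonsymmetric matrices get the value `0`;
Hessians of `C²` functions are symmetric, see `hessian_isHermitian`.) -/
noncomputable def sumLargestEigenvalues {N : ℕ} (k : ℕ) (A : Matrix (Fin N) (Fin N) ℝ) : ℝ :=
  open Classical in
  if hA : A.IsHermitian then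
    ∑ i : Fin (Fintype.card (Fin N)), if (i : ℕ) < k then hA.eigenvalues₀ i else 0
  else 0

/-- The Hessian matrix of `f` at `x`: the matrix of second partial derivatives. -/
noncomputable def hessian {N : ℕ} (f : EuclideanSpace ℝ (Fin N) → ℝ)
    (x : EuclideanSpace ℝ (Fin N)) : Matrix (Fin N) (Fin N) ℝ :=
  Matrix.of fun i j =>
    fderiv ℝ (fderiv ℝ f) x (EuclideanSpace.single i 1) (EuclideanSpace.single j 1)

theorem hessian_isHermitian {N : ℕ} {f : EuclideanSpace ℝ (Fin N) → ℝ}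
    {x : EuclideanSpace ℝ (Fin N)} (hf : ContDiffAt ℝ 2 f x) : (hessian f x).IsHermitian := by
  have h := hf.isSymmSndFDerivAt (by simp)
  ext i j
  simp only [hessian, Matrix.conjTranspose_apply, Matrix.of_apply, star_trivial]
  exact h.eq _ _

/-- The operator `P_k^+`: the sum of the `k` largest eigenvalues of the Hessian of `f` at `x`. -/
noncomputable def PkPlus {N : ℕ} (k : ℕ) (f : EuclideanSpace ℝ (Fin N) → ℝ)
    (x : EuclideanSpace ℝ (Fin N)) : ℝ :=
  sumLargestEigenvalues k (hessian f x)

/-- `u` is a nonnegative continuous viscosity solution on `[0, T) × ℝ^N`, where `0 < T ≤ ∞`, of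
`∂_t u = P_k^+ u + u^(1+p)` with `u(0, ·) = u₀`. Values of `u` at other times are irrelevant. -/
structure IsViscositySolution {N : ℕ} (k : ℕ) (p : ℝ) (u₀ : EuclideanSpace ℝ (Fin N) → ℝ)
    (T : EReal) (u : ℝ → EuclideanSpace ℝ (Fin N) → ℝ) : Prop where
  pos : 0 < T
  continuousOn : ContinuousOn (Function.uncurry u)
    ({t : ℝ | 0 ≤ t ∧ (t : EReal) < T} ×ˢ (univ : Set (EuclideanSpace ℝ (Fin N))))
  nonneg : ∀ t : ℝ, 0 ≤ t → (t : EReal) < T → ∀ x, 0 ≤ u t x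
  initial : ∀ x, u 0 x = u₀ x
  subsolution : ∀ (t : ℝ) (x : EuclideanSpace ℝ (Fin N)), 0 < t → (t : EReal) < T →
    ∀ φ : ℝ × EuclideanSpace ℝ (Fin N) → ℝ, ContDiffAt ℝ 2 φ (t, x) →
      IsLocalMax (fun z => u z.1 z.2 - φ z) (t, x) →
      deriv (fun s => φ (s, x)) t ≤ PkPlus k (fun y => φ (t, y)) x + u t x ^ (1 + p)
  supersolution : ∀ (t : ℝ) (x : EuclideanSpace ℝ (Fin N)), 0 < t → (t : EReal) < T →
    ∀ φ : ℝ × EuclideanSpace ℝ (Fin N) → ℝ, ContDiffAt ℝ 2 φ (t, x) →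
      IsLocalMin (fun z => u z.1 z.2 - φ z) (t, x) →
      PkPlus k (fun y => φ (t, y)) x + u t x ^ (1 + p) ≤ deriv (fun s => φ (s, x)) t

/-- A viscosity solution that belongs to `UC([0, T'] × ℝ^N)` for every finite `T' < T`, the class
in which the Cauchy problem with uniformly continuous initial data is posed. -/
structure IsUCSolution {N : ℕ} (k : ℕ) (p : ℝ) (u₀ : EuclideanSpace ℝ (Fin N) → ℝ)
    (T : EReal) (u : ℝ → EuclideanSpace ℝ (Fin N) → ℝ) : Prop
    extends IsViscositySolution k p u₀ T u where
  uniformContinuousOn : ∀ T' : ℝ, (T' : EReal) < T →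
    UniformContinuousOn (Function.uncurry u)
      (Icc 0 T' ×ˢ (univ : Set (EuclideanSpace ℝ (Fin N))))

/-- `u` is a solution on `[0, T)` and `T` is the maximal existence time for the datum `u₀`. -/
structure IsMaximalSolution {N : ℕ} (k : ℕ) (p : ℝ) (u₀ : EuclideanSpace ℝ (Fin N) → ℝ)
    (T : EReal) (u : ℝ → EuclideanSpace ℝ (Fin N) → ℝ) : Prop
    extends IsUCSolution k p u₀ T u where
  maximal : ∀ (T' : EReal) (v : ℝ → EuclideanSpace ℝ (Fin N) → ℝ),
    IsUCSolution k p u₀ T' v → T' ≤ T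

/-- `sup_x |u(t, x)| → ∞` as `t ↑ τ`. -/
def SupNormBlowsUpAt {N : ℕ} (u : ℝ → EuclideanSpace ℝ (Fin N) → ℝ) (τ : ℝ) : Prop :=
  Tendsto (fun t => ⨆ x, ‖u t x‖ₑ) (𝓝[<] τ) (𝓝 ⊤)

/-- Finite time blow-up for the datum `u₀`: the existence times of all viscosity solutions starting
from `u₀` have a common finite bound; a solution on the maximal existence interval has its sup norm
tending to infinity at the finite final time; and, when `u₀` is bounded, a solution whose sup norm
tends to infinity at a finite time exists. (For unbounded `u₀` there may be no solution on any
time interval, the blow-up being instantaneous.) -/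
structure BlowsUpInFiniteTime {N : ℕ} (k : ℕ) (p : ℝ) (u₀ : EuclideanSpace ℝ (Fin N) → ℝ) :
    Prop where
  finite_lifespan : ∃ T₀ : ℝ, ∀ (T : EReal) (u : ℝ → EuclideanSpace ℝ (Fin N) → ℝ),
    IsViscositySolution k p u₀ T u → T ≤ (T₀ : EReal)
  maximal_blowsUp : ∀ (T : EReal) (u : ℝ → EuclideanSpace ℝ (Fin N) → ℝ),
    IsMaximalSolution k p u₀ T u → ∃ τ : ℝ, T = (τ : EReal) ∧ SupNormBlowsUpAt u τ
  exists_blowsUp : BddAbove (range u₀) →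
    ∃ (τ : ℝ) (u : ℝ → EuclideanSpace ℝ (Fin N) → ℝ),
      IsUCSolution k p u₀ (τ : EReal) u ∧ SupNormBlowsUpAt u τ

/-- `q` is the Fujita exponent: systematic blow-up for `0 < p < q`, and existence of a nontrivial
(bounded) global solution for every `p > q`. -/
structure IsFujitaExponent (N k : ℕ) (q : ℝ) : Prop where
  blowsUp : ∀ p : ℝ, 0 < p → p < q → ∀ u₀ : EuclideanSpace ℝ (Fin N) → ℝ,
    UniformContinuous u₀ → (∀ x, 0 ≤ u₀ x) → (∃ x, u₀ x ≠ 0) → BlowsUpInFiniteTime k p u₀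
  global : ∀ p : ℝ, 0 < p → q < p → ∃ u₀ : EuclideanSpace ℝ (Fin N) → ℝ,
    UniformContinuous u₀ ∧ (∀ x, 0 ≤ u₀ x) ∧ (∃ x, u₀ x ≠ 0) ∧
    ∃ u : ℝ → EuclideanSpace ℝ (Fin N) → ℝ,
      IsUCSolution k p u₀ ⊤ u ∧ ∃ M : ℝ, ∀ t : ℝ, 0 ≤ t → ∀ x, u t x ≤ M

/-!
The exponent `2 / k` comes from the action of `P_k^+` on a radial function `g (|x|²)` with `g`
convex. The Hessian is a multiple of the identity plus a positive semidefinite matrix of rank one,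
so by Ky Fan's maximum principle `P_k^+` acts as the Laplacian does in dimension `k`
(`topTrace_secondDeriv_radial`). In particular Gaussians with time decay `s^{-k/2}` solve the
equation without reaction.

Blow-up for `p < 2 / k` uses only comparison with smooth functions. While the reaction is ignored, a
solution stays above a small multiple of such a Gaussian, hence above `c t^{-k/2}` in a ball of
squared radius of order `t`. On the other hand `A τ^{-1/p} (1 - |x|² / (4 k τ))`, with `τ` the time
left, is a subsolution where it is nonnegative, so a solution above `A t^{-1/p}` in such a ball
cannot live longer than about `2 t` (`exists_lifespan_le`). As `k / 2 < 1 / p`, the first bound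
exceeds the second for large `t`, and this bounds the lifespan in terms of the datum
(`exists_lifespan_bound`). Both functions (the Gaussian after subtraction of a tiny constant) are
positive in a bounded set only and solutions are nonnegative, so no growth condition enters.

Existence comes from an explicit monotone scheme, in which a random walk steps along an orthonormal
`k`-frame that is chosen to maximize the expectation. For a truncated reaction the scheme is
equicontinuous uniformly in the time step, and a limit along an ultrafilter is a viscosity solution
(`exists_tame_solution`). Truncation is removed by a priori bounds, which gives a solution for a
time that depends on the supremum of the datum only.

Such solutions are glued in time. This, as well as the comparison arguments at the first time of
contact, rests on the fact that a subsolution satisfies the viscosity inequality also for test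
functions touching it only in the past (`deriv_le_of_isLocalMaxOn_past`). Consequently a solution
whose sup norm does not tend to infinity at a finite time can be continued beyond that time. Maximal
solutions therefore blow up, and for bounded data a solution that blows up is found by repeated
continuation. No uniqueness is needed.

For `p > 2 / k`, the function `ε s^{-1/p} exp(-|x|² / (4 s))` with `s = t + 1` is a global
supersolution if `ε^p = k / 2 - 1 / p`. The solution of the truncated equation stays below it and so
solves the original equation.
-/

/-! ### `P_k^+` as a supremum of traces, and its values on radial functions -/

/-- A sum of nonincreasing `l i` with weights in `[0, 1]` of total mass `k` is largest when the mass
sits on the first `k` indices. -/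
theorem sum_mul_le_sum_first {m k : ℕ} (hkm : k ≤ m) {l w : Fin m → ℝ} (hl : Antitone l)
    (h0 : ∀ i, 0 ≤ w i) (h1 : ∀ i, w i ≤ 1) (hw : ∑ i, w i = k) :
    ∑ i, l i * w i ≤ ∑ i : Fin m, if (i : ℕ) < k then l i else 0 := by
  rcases Nat.eq_zero_or_pos k with rfl | hk
  · have hz : ∀ i, w i = 0 := by
      intro i
      have := (Finset.sum_eq_zero_iff_of_nonneg (fun i _ => h0 i)).1 (by simpa using hw)
      exact this i (Finset.mem_univ i)
    simp [hz]
  · set c := l ⟨k - 1, by omega⟩ with hc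
    have hcard : ∑ i : Fin m, (if (i : ℕ) < k then (1 : ℝ) else 0) = k := by
      rw [Fin.sum_univ_eq_sum_range (fun i => if i < k then (1 : ℝ) else 0), ← Finset.sum_filter]
      have : (Finset.range m).filter (fun i => i < k) = Finset.range k := by
        ext i; simp; omega
      simp [this]
    -- termwise, both factors have the same sign, since `c` separates the first `k` values of `l`
    have key : 0 ≤ ∑ i : Fin m, (l i - c) * ((if (i : ℕ) < k then (1 : ℝ) else 0) - w i) := by
      refine Finset.sum_nonneg fun i _ => ?_
      split_ifs with hi
      · refine mul_nonneg (sub_nonneg.2 (hl ?_)) (sub_nonneg.2 (h1 i))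
        rw [Fin.le_def]; simp; omega
      · refine mul_nonneg_of_nonpos_of_nonpos (sub_nonpos.2 (hl ?_)) (by linarith [h0 i])
        rw [Fin.le_def]; simp; omega
    have expand : ∑ i : Fin m, (l i - c) * ((if (i : ℕ) < k then (1 : ℝ) else 0) - w i)
        = (∑ i : Fin m, if (i : ℕ) < k then l i else 0) - ∑ i, l i * w i
          - c * (∑ i : Fin m, (if (i : ℕ) < k then (1 : ℝ) else 0)) + c * ∑ i, w i := by
      rw [Finset.mul_sum, Finset.mul_sum, ← Finset.sum_sub_distrib, ← Finset.sum_sub_distrib,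
        ← Finset.sum_add_distrib]
      refine Finset.sum_congr rfl fun i _ => ?_
      split_ifs <;> ring
    rw [expand, hcard, hw] at key
    linarith

/-- Ky Fan's maximum principle. -/
theorem isGreatest_sumLargestEigenvalues {N k : ℕ} (hkN : k ≤ N) {A : Matrix (Fin N) (Fin N) ℝ}
    (hA : A.IsHermitian) :
    IsGreatest {s : ℝ | ∃ ξ : Fin k → EuclideanSpace ℝ (Fin N), Orthonormal ℝ ξ ∧
      s = ∑ i, inner ℝ (ξ i) (Matrix.toEuclideanLin A (ξ i))} (sumLargestEigenvalues k A) := by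
  set e : Fin (Fintype.card (Fin N)) ≃ Fin N := Fintype.equivOfCardEq (Fintype.card_fin _) with he
  set v : Fin (Fintype.card (Fin N)) → EuclideanSpace ℝ (Fin N) :=
    fun j => hA.eigenvectorBasis (e j) with hv
  have hAv : ∀ j, Matrix.toEuclideanLin A (v j) = hA.eigenvalues₀ j • v j := by
    intro j
    have := hA.mulVec_eigenvectorBasis (e j)
    have h2 : hA.eigenvalues (e j) = hA.eigenvalues₀ j := by
      simp [Matrix.IsHermitian.eigenvalues, he]
    rw [h2] at this
    ext i
    simpa [hv, Matrix.toEuclideanLin] using congrFun this i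
  have hov : Orthonormal ℝ v := hA.eigenvectorBasis.orthonormal.comp e e.injective
  have hcard : k ≤ Fintype.card (Fin N) := by simpa using hkN
  have hval : sumLargestEigenvalues k A = ∑ i : Fin (Fintype.card (Fin N)),
      if (i : ℕ) < k then hA.eigenvalues₀ i else 0 := by
    rw [sumLargestEigenvalues, dif_pos hA]
  constructor
  · refine ⟨fun i => v (Fin.castLE hcard i), hov.comp _ (Fin.castLE_injective hcard), ?_⟩
    rw [hval]
    have h1 : ∀ i : Fin k, inner ℝ (v (Fin.castLE hcard i))
        (Matrix.toEuclideanLin A (v (Fin.castLE hcard i)))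
        = hA.eigenvalues₀ (Fin.castLE hcard i) := by
      intro i
      rw [hAv, inner_smul_right, real_inner_self_eq_norm_sq, hov.1]; simp
    simp only [h1]
    rw [← Finset.sum_filter]
    symm
    refine Finset.sum_bij (fun i _ => Fin.castLE hcard i) ?_ ?_ ?_ ?_
    · intro a _; simp
    · intro a _ b _ h; exact Fin.castLE_injective hcard h
    · intro b hb; simp at hb; exact ⟨⟨b, hb⟩, by simp, by ext; simp⟩
    · intro a _; rfl
  · rintro s ⟨ξ, hξ, rfl⟩
    rw [hval]
    have hsum : ∀ x y : EuclideanSpace ℝ (Fin N),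
        inner ℝ x y = ∑ j, inner ℝ x (v j) * inner ℝ (v j) y := by
      intro x y
      rw [← hA.eigenvectorBasis.sum_inner_mul_inner x y]
      exact (Equiv.sum_comp e (fun j => inner ℝ x (hA.eigenvectorBasis j) *
        inner ℝ (hA.eigenvectorBasis j) y)).symm
    have hsymm : ∀ x y : EuclideanSpace ℝ (Fin N), inner ℝ (Matrix.toEuclideanLin A x) y
        = inner ℝ x (Matrix.toEuclideanLin A y) :=
      Matrix.isSymmetric_toEuclideanLin_iff.2 hA
    have h1 : ∀ i, inner ℝ (ξ i) (Matrix.toEuclideanLin A (ξ i))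
        = ∑ j, hA.eigenvalues₀ j * inner ℝ (ξ i) (v j) ^ 2 := by
      intro i
      rw [hsum]
      refine Finset.sum_congr rfl fun j _ => ?_
      rw [← hsymm, hAv, inner_smul_left, real_inner_comm (ξ i) (v j)]
      simp; ring
    simp only [h1]
    rw [Finset.sum_comm]
    simp only [← Finset.mul_sum]
    refine sum_mul_le_sum_first hcard hA.eigenvalues₀_antitone ?_ ?_ ?_
    · intro i; positivity
    · intro j
      have := hξ.sum_inner_products_le (v j) (s := Finset.univ)
      rw [hov.1] at this
      simpa using this
    · rw [Finset.sum_comm]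
      have : ∀ i, ∑ j, inner ℝ (ξ i) (v j) ^ 2 = (1 : ℝ) := by
        intro i
        have h := hsum (ξ i) (ξ i)
        rw [real_inner_self_eq_norm_sq, hξ.1] at h
        rw [one_pow] at h
        rw [h]
        exact Finset.sum_congr rfl fun j _ => by rw [real_inner_comm (ξ i) (v j), sq]
      simp [this]

/-- The second derivative of `f` at `x`, as a bilinear form. -/
noncomputable def secondDeriv {N : ℕ} (f : EuclideanSpace ℝ (Fin N) → ℝ)
    (x : EuclideanSpace ℝ (Fin N)) :
    EuclideanSpace ℝ (Fin N) →L[ℝ] EuclideanSpace ℝ (Fin N) →L[ℝ] ℝ :=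
  fderiv ℝ (fderiv ℝ f) x

/-- The inner product, as a bilinear form. -/
noncomputable def innerForm (N : ℕ) :
    EuclideanSpace ℝ (Fin N) →L[ℝ] EuclideanSpace ℝ (Fin N) →L[ℝ] ℝ :=
  innerSL ℝ

@[simp] theorem innerForm_apply {N : ℕ} (v w : EuclideanSpace ℝ (Fin N)) :
    innerForm N v w = inner ℝ v w := innerSL_apply_apply ℝ v w

/-- The supremum of the traces of the bilinear form `B` on `k`-dimensional subspaces, written with
orthonormal families of length `k`. -/
noncomputable def topTrace {N : ℕ} (k : ℕ)
    (B : EuclideanSpace ℝ (Fin N) →L[ℝ] EuclideanSpace ℝ (Fin N) →L[ℝ] ℝ) : ℝ :=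
  sSup {s : ℝ | ∃ ξ : Fin k → EuclideanSpace ℝ (Fin N), Orthonormal ℝ ξ ∧ s = ∑ i, B (ξ i) (ξ i)}

section topTrace

variable {N k : ℕ} (B : EuclideanSpace ℝ (Fin N) →L[ℝ] EuclideanSpace ℝ (Fin N) →L[ℝ] ℝ)

theorem exists_orthonormal_fin (hkN : k ≤ N) :
    ∃ ξ : Fin k → EuclideanSpace ℝ (Fin N), Orthonormal ℝ ξ :=
  ⟨_, (EuclideanSpace.basisFun (Fin N) ℝ).orthonormal.comp _ (Fin.castLE_injective hkN)⟩

theorem topTrace_set_bddAbove : BddAbove {s : ℝ | ∃ ξ : Fin k → EuclideanSpace ℝ (Fin N),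
    Orthonormal ℝ ξ ∧ s = ∑ i, B (ξ i) (ξ i)} := by
  refine ⟨∑ _i : Fin k, ‖B‖, ?_⟩
  rintro s ⟨ξ, hξ, rfl⟩
  refine Finset.sum_le_sum fun i _ => ?_
  have := B.le_opNorm₂ (ξ i) (ξ i)
  rw [hξ.1] at this
  simpa using (le_abs_self _).trans this

theorem le_topTrace {ξ : Fin k → EuclideanSpace ℝ (Fin N)} (hξ : Orthonormal ℝ ξ) :
    ∑ i, B (ξ i) (ξ i) ≤ topTrace k B :=
  le_csSup (topTrace_set_bddAbove B) ⟨ξ, hξ, rfl⟩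

theorem topTrace_le (hkN : k ≤ N) {c : ℝ}
    (h : ∀ ξ : Fin k → EuclideanSpace ℝ (Fin N), Orthonormal ℝ ξ → ∑ i, B (ξ i) (ξ i) ≤ c) :
    topTrace k B ≤ c := by
  obtain ⟨ξ, hξ⟩ := exists_orthonormal_fin hkN
  refine csSup_le ⟨_, ξ, hξ, rfl⟩ ?_
  rintro s ⟨ξ, hξ, rfl⟩
  exact h ξ hξ

theorem sum_add_smul_innerForm {ξ : Fin k → EuclideanSpace ℝ (Fin N)} (hξ : Orthonormal ℝ ξ)
    (c : ℝ) :
    ∑ i, (B + c • innerForm N) (ξ i) (ξ i) = ∑ i, B (ξ i) (ξ i) + c * k := by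
  simp [Finset.sum_add_distrib, hξ.1, mul_comm]

theorem topTrace_add_smul_le (hkN : k ≤ N) (c : ℝ) :
    topTrace k (B + c • innerForm N) ≤ topTrace k B + c * k := by
  refine topTrace_le _ hkN fun ξ hξ => ?_
  rw [sum_add_smul_innerForm B hξ]
  linarith [le_topTrace B hξ]

end topTrace

theorem PkPlus_eq_topTrace {N k : ℕ} (hkN : k ≤ N) {f : EuclideanSpace ℝ (Fin N) → ℝ}
    {x : EuclideanSpace ℝ (Fin N)} (hf : ContDiffAt ℝ 2 f x) :
    PkPlus k f x = topTrace k (secondDeriv f x) := by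
  have h := (isGreatest_sumLargestEigenvalues hkN (hessian_isHermitian hf)).csSup_eq
  rw [PkPlus, ← h, topTrace]
  have key : ∀ v : EuclideanSpace ℝ (Fin N),
      inner ℝ v (Matrix.toEuclideanLin (hessian f x) v) = secondDeriv f x v v := by
    intro v
    have hv : v = ∑ i, v i • EuclideanSpace.single i (1 : ℝ) := by
      ext j; simp [Finset.sum_apply, Pi.single_apply]
    have h2 : secondDeriv f x v v = ∑ i, ∑ j, v i * (v j * hessian f x i j) := by
      conv_lhs => rw [hv]
      simp only [map_sum, map_smul, FunLike.coe_sum, Finset.sum_apply, FunLike.coe_smul,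
        Pi.smul_apply, smul_eq_mul, Finset.mul_sum, hessian, Matrix.of_apply, secondDeriv]
      rw [Finset.sum_comm]
      refine Finset.sum_congr rfl fun i _ => Finset.sum_congr rfl fun j _ => by ring
    rw [h2, PiLp.inner_apply]
    refine Finset.sum_congr rfl fun i _ => ?_
    simp only [Matrix.toEuclideanLin, Matrix.toLpLin_apply, Matrix.mulVec, dotProduct]
    simp [Finset.mul_sum, mul_comm, mul_left_comm]
  simp only [key]

theorem hasFDerivAt_norm_sub_sq {N : ℕ} (x₀ y : EuclideanSpace ℝ (Fin N)) :
    HasFDerivAt (fun y => ‖y - x₀‖ ^ 2) ((2 : ℝ) • innerForm N (y - x₀)) y := by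
  refine ((hasFDerivAt_id y).sub_const x₀).norm_sq.congr_fderiv ?_
  ext v
  simp [innerSL_apply_apply, two_mul]

theorem fderiv_radial {N : ℕ} {g g' : ℝ → ℝ} (hg : ∀ q, HasDerivAt g (g' q) q)
    (x₀ : EuclideanSpace ℝ (Fin N)) : fderiv ℝ (fun y => g (‖y - x₀‖ ^ 2))
      = fun y => (2 * g' (‖y - x₀‖ ^ 2)) • innerForm N (y - x₀) := by
  funext y
  rw [mul_comm, mul_smul]
  exact ((hg _).comp_hasFDerivAt y (hasFDerivAt_norm_sub_sq x₀ y)).fderiv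

/-- The second derivative of a radial function. -/
theorem secondDeriv_radial {N : ℕ} {g g' g'' : ℝ → ℝ} (hg : ∀ q, HasDerivAt g (g' q) q)
    (hg' : ∀ q, HasDerivAt g' (g'' q) q) (x₀ x v w : EuclideanSpace ℝ (Fin N)) :
    secondDeriv (fun y => g (‖y - x₀‖ ^ 2)) x v w
      = 4 * g'' (‖x - x₀‖ ^ 2) * (inner ℝ (x - x₀) v * inner ℝ (x - x₀) w)
        + 2 * g' (‖x - x₀‖ ^ 2) * inner ℝ v w := by
  have h2 : HasFDerivAt (fun y => innerForm N (y - x₀)) (innerForm N) x := by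
    simpa [Function.comp_def] using
      (innerForm N).hasFDerivAt.comp x ((hasFDerivAt_id x).sub_const x₀)
  have h3 : HasFDerivAt (fun y => 2 * g' (‖y - x₀‖ ^ 2))
      ((4 * g'' (‖x - x₀‖ ^ 2)) • innerForm N (x - x₀)) x := by
    refine (((hg' _).comp_hasFDerivAt x (hasFDerivAt_norm_sub_sq x₀ x)).const_mul 2).congr_fderiv ?_
    rw [smul_smul, smul_smul]
    congr 1
    ring
  rw [secondDeriv, fderiv_radial hg, (h3.fun_smul h2).fderiv]
  simp only [add_apply, smul_apply,
    ContinuousLinearMap.smulRight_apply, innerForm_apply, smul_eq_mul]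
  ring

theorem sum_inner_sq_le {N k : ℕ} {ξ : Fin k → EuclideanSpace ℝ (Fin N)} (hξ : Orthonormal ℝ ξ)
    (y : EuclideanSpace ℝ (Fin N)) : ∑ i, inner ℝ y (ξ i) ^ 2 ≤ ‖y‖ ^ 2 := by
  have := hξ.sum_inner_products_le y (s := Finset.univ)
  simpa [real_inner_comm] using this

/-- A frame of length `k ≥ 1` whose span contains `y`: its first vector is `y / ‖y‖`. -/
theorem exists_orthonormal_sum_inner_sq {N k : ℕ} (hk : 1 ≤ k) (hkN : k ≤ N)
    (y : EuclideanSpace ℝ (Fin N)) :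
    ∃ ξ : Fin k → EuclideanSpace ℝ (Fin N), Orthonormal ℝ ξ ∧
      ∑ i, inner ℝ y (ξ i) ^ 2 = ‖y‖ ^ 2 := by
  rcases eq_or_ne y 0 with rfl | hy
  · obtain ⟨ξ, hξ⟩ := exists_orthonormal_fin (N := N) hkN
    exact ⟨ξ, hξ, by simp⟩
  have hy' : ‖y‖ ≠ 0 := norm_ne_zero_iff.2 hy
  let i₀ : Fin N := ⟨0, by omega⟩
  obtain ⟨b, hb⟩ := Orthonormal.exists_orthonormalBasis_extension_of_card_eq (𝕜 := ℝ)
    (E := EuclideanSpace ℝ (Fin N)) (ι := Fin N) (by simp) (v := fun _ => ‖y‖⁻¹ • y) (s := {i₀})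
    (by
      constructor
      · intro i; simp [norm_smul, hy']
      · intro i j hij; exact absurd (Subsingleton.elim i j) hij)
  have hb0 : b i₀ = ‖y‖⁻¹ • y := hb i₀ rfl
  have hξ : Orthonormal ℝ (fun i : Fin k => b (Fin.castLE hkN i)) :=
    b.orthonormal.comp _ (Fin.castLE_injective hkN)
  refine ⟨_, hξ, le_antisymm ?_ ?_⟩
  · exact sum_inner_sq_le hξ y
  · have h1 : inner ℝ y (b i₀) ^ 2 = ‖y‖ ^ 2 := by
      rw [hb0, inner_smul_right, real_inner_self_eq_norm_sq]; field_simp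
    have hj : Fin.castLE hkN ⟨0, hk⟩ = i₀ := rfl
    have h2 := Finset.single_le_sum (f := fun i : Fin k => inner ℝ y (b (Fin.castLE hkN i)) ^ 2)
      (fun i _ => sq_nonneg _) (Finset.mem_univ (⟨0, hk⟩ : Fin k))
    simp only [hj, h1] at h2
    exact h2

/-- On a radial function that is a convex function of the squared radius, `P_k^+` is the Laplacian
of dimension `k`, not `N`; this is where the exponent `2 / k` comes from. -/
theorem topTrace_secondDeriv_radial {N k : ℕ} (hk : 1 ≤ k) (hkN : k ≤ N) {g g' g'' : ℝ → ℝ}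
    (hg : ∀ q, HasDerivAt g (g' q) q) (hg' : ∀ q, HasDerivAt g' (g'' q) q)
    (x₀ x : EuclideanSpace ℝ (Fin N)) (h0 : 0 ≤ g'' (‖x - x₀‖ ^ 2)) :
    topTrace k (secondDeriv (fun y => g (‖y - x₀‖ ^ 2)) x)
      = 2 * k * g' (‖x - x₀‖ ^ 2) + 4 * g'' (‖x - x₀‖ ^ 2) * ‖x - x₀‖ ^ 2 := by
  have hval : ∀ ξ : Fin k → EuclideanSpace ℝ (Fin N), Orthonormal ℝ ξ →
      ∑ i, secondDeriv (fun y => g (‖y - x₀‖ ^ 2)) x (ξ i) (ξ i) = 2 * k * g' (‖x - x₀‖ ^ 2)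
        + 4 * g'' (‖x - x₀‖ ^ 2) * ∑ i, inner ℝ (x - x₀) (ξ i) ^ 2 := by
    intro ξ hξ
    simp only [secondDeriv_radial hg hg', real_inner_self_eq_norm_sq, hξ.1, Finset.sum_add_distrib,
      Finset.mul_sum]
    rw [add_comm]
    simp only [Finset.sum_const, Finset.card_univ, Fintype.card_fin, nsmul_eq_mul, sq]
    ring
  refine le_antisymm (topTrace_le _ hkN fun ξ hξ => ?_) ?_
  · rw [hval ξ hξ]
    have h2 := sum_inner_sq_le hξ (x - x₀)
    have := mul_le_mul_of_nonneg_left h2 (by linarith : 0 ≤ 4 * g'' (‖x - x₀‖ ^ 2))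
    linarith
  · obtain ⟨ξ, hξ, hs⟩ := exists_orthonormal_sum_inner_sq hk hkN (x - x₀)
    have := (hval ξ hξ).symm.le.trans (le_topTrace _ hξ)
    rwa [hs] at this

/-! ### Parabolic Taylor expansion -/

/-- Second-order Taylor expansion with Peano remainder. -/
theorem eventually_taylor_two {V : Type*} [NormedAddCommGroup V] [NormedSpace ℝ V] {φ : V → ℝ}
    {z₀ : V} (hφ : ContDiffAt ℝ 2 φ z₀) {κ : ℝ} (hκ : 0 < κ) :
    ∀ᶠ z in 𝓝 z₀, |φ z - (φ z₀ + fderiv ℝ φ z₀ (z - z₀)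
      + fderiv ℝ (fderiv ℝ φ) z₀ (z - z₀) (z - z₀) / 2)| ≤ κ * ‖z - z₀‖ ^ 2 := by
  set B := fderiv ℝ (fderiv ℝ φ) z₀ with hB
  have hsymm : ∀ v w, B v w = B w v := fun v w =>
    (hφ.isSymmSndFDerivAt (by simp)).eq v w
  have h1 : HasFDerivAt (fderiv ℝ φ) B z₀ :=
    ((hφ.fderiv_right (m := 1) (by norm_num)).differentiableAt (by norm_num)).hasFDerivAt
  have h2 : ∀ᶠ z in 𝓝 z₀, ‖fderiv ℝ φ z - fderiv ℝ φ z₀ - B (z - z₀)‖ ≤ κ * ‖z - z₀‖ :=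
    h1.isLittleO.def hκ
  have h3 : ∀ᶠ z in 𝓝 z₀, DifferentiableAt ℝ φ z := by
    filter_upwards [hφ.eventually (by simp)] with z hz using hz.differentiableAt (by norm_num)
  obtain ⟨r, hr, hball⟩ := Metric.eventually_nhds_iff_ball.1 (h2.and h3)
  filter_upwards [Metric.ball_mem_nhds z₀ hr] with z hz
  set g : V → ℝ := fun z => φ z - (φ z₀ + fderiv ℝ φ z₀ (z - z₀) + B (z - z₀) (z - z₀) / 2) with hg
  have hsub : Metric.closedBall z₀ ‖z - z₀‖ ⊆ Metric.ball z₀ r := by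
    refine Metric.closedBall_subset_ball ?_
    simpa [dist_eq_norm] using hz
  have hder : ∀ y ∈ Metric.closedBall z₀ ‖z - z₀‖, HasFDerivWithinAt g
      (fderiv ℝ φ y - fderiv ℝ φ z₀ - B (y - z₀)) (Metric.closedBall z₀ ‖z - z₀‖) y := by
    intro y hy
    have hy3 := (hball y (hsub hy)).2.hasFDerivAt
    have hid : HasFDerivAt (fun y : V => y - z₀) (ContinuousLinearMap.id ℝ V) y :=
      (hasFDerivAt_id y).sub_const z₀
    have hBy : HasFDerivAt (fun y => B (y - z₀)) B y := by
      simpa [Function.comp_def] using B.hasFDerivAt.comp y hid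
    have hly : HasFDerivAt (fun y => fderiv ℝ φ z₀ (y - z₀)) (fderiv ℝ φ z₀) y := by
      simpa [Function.comp_def] using (fderiv ℝ φ z₀).hasFDerivAt.comp y hid
    have hq := hBy.clm_apply hid
    have := hy3.sub (((hly.const_add (φ z₀))).add (hq.mul_const (1 / 2 : ℝ)))
    refine (this.congr_fderiv ?_).hasFDerivWithinAt.congr_of_eventuallyEq ?_ ?_
    · ext v
      simp only [sub_apply, add_apply, smul_apply, ContinuousLinearMap.comp_apply,
        ContinuousLinearMap.flip_apply, ContinuousLinearMap.id_apply, smul_eq_mul]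
      rw [hsymm v (y - z₀)]
      ring
    · refine Eventually.of_forall fun w => ?_
      simp [hg]; ring
    · simp [hg]; ring
  have := (convex_closedBall z₀ ‖z - z₀‖).norm_image_sub_le_of_norm_hasFDerivWithin_le
    (C := κ * ‖z - z₀‖) hder (fun y hy => ((hball y (hsub hy)).1).trans (by
      have : ‖y - z₀‖ ≤ ‖z - z₀‖ := by simpa [dist_eq_norm] using hy
      gcongr)) (Metric.mem_closedBall_self (norm_nonneg _)) (by simp [dist_eq_norm] : z ∈ _)
  have hg0 : g z₀ = 0 := by simp [hg]
  rw [hg0, sub_zero, Real.norm_eq_abs] at this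
  calc _ ≤ κ * ‖z - z₀‖ * ‖z - z₀‖ := this
    _ = _ := by ring

theorem deriv_time_slice {N : ℕ} {φ : ℝ × EuclideanSpace ℝ (Fin N) → ℝ} {t : ℝ}
    {x : EuclideanSpace ℝ (Fin N)} (hφ : DifferentiableAt ℝ φ (t, x)) :
    deriv (fun s => φ (s, x)) t = fderiv ℝ φ (t, x) (1, 0) :=
  (hφ.hasFDerivAt.comp_hasDerivAt t ((hasDerivAt_id t).prodMk (hasDerivAt_const t x))).deriv

theorem fderiv_space_slice {N : ℕ} {φ : ℝ × EuclideanSpace ℝ (Fin N) → ℝ} {t : ℝ}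
    {x : EuclideanSpace ℝ (Fin N)} (hφ : DifferentiableAt ℝ φ (t, x)) :
    fderiv ℝ (fun y => φ (t, y)) x
      = (fderiv ℝ φ (t, x)).comp (ContinuousLinearMap.inr ℝ ℝ (EuclideanSpace ℝ (Fin N))) :=
  (hφ.hasFDerivAt.comp x (hasFDerivAt_prodMk_right t x)).fderiv

theorem secondDeriv_space_slice {N : ℕ} {φ : ℝ × EuclideanSpace ℝ (Fin N) → ℝ} {t : ℝ}
    {x : EuclideanSpace ℝ (Fin N)} (hφ : ContDiffAt ℝ 2 φ (t, x)) (v w : EuclideanSpace ℝ (Fin N)) :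
    secondDeriv (fun y => φ (t, y)) x v w = fderiv ℝ (fderiv ℝ φ) (t, x) (0, v) (0, w) := by
  have h1 : HasFDerivAt (fderiv ℝ φ) (fderiv ℝ (fderiv ℝ φ) (t, x)) (t, x) :=
    ((hφ.fderiv_right (m := 1) (by norm_num)).differentiableAt (by norm_num)).hasFDerivAt
  have h2 := h1.comp x (hasFDerivAt_prodMk_right t x)
  have h3 : fderiv ℝ (fun y => φ (t, y)) =ᶠ[𝓝 x] fun y => (fderiv ℝ φ (t, y)).comp
      (ContinuousLinearMap.inr ℝ ℝ (EuclideanSpace ℝ (Fin N))) := by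
    have hc : Tendsto (fun y : EuclideanSpace ℝ (Fin N) => (t, y)) (𝓝 x) (𝓝 (t, x)) :=
      (Continuous.prodMk_right t).tendsto x
    filter_upwards [hc.eventually (hφ.eventually (by simp))] with y hy
    exact fderiv_space_slice (hy.differentiableAt (by norm_num))
  have h4 := (h2.clm_comp (hasFDerivAt_const
    (ContinuousLinearMap.inr ℝ ℝ (EuclideanSpace ℝ (Fin N))) x))
  rw [secondDeriv, h3.fderiv_eq]
  have h5 := h4.fderiv
  simp only [Function.comp_def] at h5
  rw [h5]
  simp

/-- Second-order Taylor expansion of a function of time and space in which the mixed and the pure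
time derivatives of second order are absorbed into the remainder. -/
theorem eventually_parabolic_taylor {N : ℕ} {φ : ℝ × EuclideanSpace ℝ (Fin N) → ℝ} {t : ℝ}
    {x : EuclideanSpace ℝ (Fin N)} (hφ : ContDiffAt ℝ 2 φ (t, x)) {κ : ℝ} (hκ : 0 < κ) :
    ∃ C : ℝ, ∀ᶠ z in 𝓝 (t, x), |φ z - (φ (t, x) + deriv (fun s => φ (s, x)) t * (z.1 - t)
      + fderiv ℝ (fun y => φ (t, y)) x (z.2 - x)
      + secondDeriv (fun y => φ (t, y)) x (z.2 - x) (z.2 - x) / 2)|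
        ≤ κ * ‖z.2 - x‖ ^ 2 + C * (z.1 - t) ^ 2 := by
  set B := fderiv ℝ (fderiv ℝ φ) (t, x) with hB
  have hd : DifferentiableAt ℝ φ (t, x) := hφ.differentiableAt (by norm_num)
  have hsymm : ∀ v w, B v w = B w v := fun v w => (hφ.isSymmSndFDerivAt (by simp)).eq v w
  refine ⟨κ / 2 + ‖B‖ / 2 + ‖B‖ ^ 2 / (2 * κ), ?_⟩
  filter_upwards [eventually_taylor_two hφ (half_pos hκ)] with z hz
  set s := z.1 - t with hs
  set y := z.2 - x with hy
  have hzz : z - (t, x) = (s, 0) + (0, y) := by ext <;> simp [hs, hy]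
  have hs0 : ((s, 0) : ℝ × EuclideanSpace ℝ (Fin N)) = s • (1, 0) := by simp
  have hnorm : ‖z - (t, x)‖ ^ 2 ≤ s ^ 2 + ‖y‖ ^ 2 := by
    have : ‖z - (t, x)‖ = max |s| ‖y‖ := rfl
    rw [this]
    rcases max_cases |s| ‖y‖ with ⟨h, _⟩ | ⟨h, _⟩ <;> rw [h]
    · rw [sq_abs]; nlinarith [sq_nonneg ‖y‖]
    · nlinarith [sq_nonneg s]
  have e1 : fderiv ℝ φ (t, x) (z - (t, x)) = deriv (fun s => φ (s, x)) t * s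
      + fderiv ℝ (fun y => φ (t, y)) x y := by
    rw [hzz, map_add, hs0, map_smul, deriv_time_slice hd, fderiv_space_slice hd]
    simp [mul_comm]
  have e2 : B (z - (t, x)) (z - (t, x)) = B (s, 0) (s, 0) + 2 * B (s, 0) (0, y)
      + secondDeriv (fun y => φ (t, y)) x y y := by
    rw [hzz, secondDeriv_space_slice hφ]
    simp only [map_add, add_apply]
    rw [hsymm (0, y) (s, 0)]
    ring
  have ns : ‖((s, 0) : ℝ × EuclideanSpace ℝ (Fin N))‖ = |s| := by simp [Prod.norm_def]
  have ny : ‖((0, y) : ℝ × EuclideanSpace ℝ (Fin N))‖ = ‖y‖ := by simp [Prod.norm_def]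
  have b1 : |B (s, 0) (s, 0)| ≤ ‖B‖ * s ^ 2 := by
    have := B.le_opNorm₂ (s, 0) (s, 0)
    rw [ns, Real.norm_eq_abs] at this
    calc _ ≤ _ := this
      _ = ‖B‖ * |s| ^ 2 := by ring
      _ = _ := by rw [sq_abs]
  have b2 : |B (s, 0) (0, y)| ≤ κ / 2 * ‖y‖ ^ 2 + ‖B‖ ^ 2 / (2 * κ) * s ^ 2 := by
    have := B.le_opNorm₂ (s, 0) (0, y)
    rw [ns, ny, Real.norm_eq_abs] at this
    refine this.trans ?_
    have h : 0 ≤ (κ * ‖y‖ - ‖B‖ * |s|) ^ 2 / (2 * κ) := by positivity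
    have h' : (κ * ‖y‖ - ‖B‖ * |s|) ^ 2 / (2 * κ)
        = κ / 2 * ‖y‖ ^ 2 + ‖B‖ ^ 2 / (2 * κ) * |s| ^ 2 - ‖B‖ * |s| * ‖y‖ := by
      field_simp; ring
    rw [sq_abs] at h'
    linarith
  rw [e1, e2] at hz
  have h4 := hz.trans (mul_le_mul_of_nonneg_left hnorm (half_pos hκ).le)
  rw [abs_le] at h4 b1 b2 ⊢
  constructor <;> nlinarith [h4.1, h4.2, b1.1, b1.2, b2.1, b2.2]

/-! ### Viscosity subsolutions and test functions that touch in the past -/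

/-- `u` is a viscosity subsolution of `∂_t u = F(u, D²u)` at the point `(t, x)`. -/
def IsSubsolutionAt {N : ℕ}
    (F : ℝ → (EuclideanSpace ℝ (Fin N) →L[ℝ] EuclideanSpace ℝ (Fin N) →L[ℝ] ℝ) → ℝ)
    (u : ℝ → EuclideanSpace ℝ (Fin N) → ℝ) (t : ℝ) (x : EuclideanSpace ℝ (Fin N)) : Prop :=
  ∀ φ : ℝ × EuclideanSpace ℝ (Fin N) → ℝ, ContDiffAt ℝ 2 φ (t, x) →
    IsLocalMax (fun z => u z.1 z.2 - φ z) (t, x) →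
    deriv (fun s => φ (s, x)) t ≤ F (u t x) (secondDeriv (fun y => φ (t, y)) x)

/-- The regularity of the right-hand side `F(u, D²u)` that is needed below: continuity in the value
of the solution and a one-sided bound under the addition of a multiple of the identity to the
Hessian. -/
structure IsAdmissible {N : ℕ}
    (F : ℝ → (EuclideanSpace ℝ (Fin N) →L[ℝ] EuclideanSpace ℝ (Fin N) →L[ℝ] ℝ) → ℝ) : Prop where
  continuous : ∀ B, Continuous fun r => F r B
  shift : ∃ c : ℝ, 0 ≤ c ∧ ∀ r B κ, 0 ≤ κ → F r (B + κ • innerForm N) ≤ F r B + c * κ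

/-- The quadratic test function `a s + C s² + ℓ y + B(y, y) / 2`. -/
noncomputable def parabolicQuad {N : ℕ} (a C : ℝ) (ℓ : EuclideanSpace ℝ (Fin N) →L[ℝ] ℝ)
    (B : EuclideanSpace ℝ (Fin N) →L[ℝ] EuclideanSpace ℝ (Fin N) →L[ℝ] ℝ) (s : ℝ)
    (y : EuclideanSpace ℝ (Fin N)) : ℝ :=
  a * s + C * s ^ 2 + ℓ y + B y y / 2

section

variable {N : ℕ} {F : ℝ → (EuclideanSpace ℝ (Fin N) →L[ℝ] EuclideanSpace ℝ (Fin N) →L[ℝ] ℝ) → ℝ}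
  {u : ℝ → EuclideanSpace ℝ (Fin N) → ℝ} {t₀ : ℝ} {x₀ : EuclideanSpace ℝ (Fin N)}

/-- A smooth function touching `u` from above can be replaced by a quadratic one that touches
strictly, at the price of a small multiple of the identity in the Hessian. -/
theorem eventually_le_parabolicQuad {S : Set (ℝ × EuclideanSpace ℝ (Fin N))}
    {φ : ℝ × EuclideanSpace ℝ (Fin N) → ℝ} (hφ : ContDiffAt ℝ 2 φ (t₀, x₀))
    (hmax : IsLocalMaxOn (fun z => u z.1 z.2 - φ z) S (t₀, x₀)) {κ : ℝ} (hκ : 0 < κ) :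
    ∃ C : ℝ, ∀ᶠ z in 𝓝[S] (t₀, x₀), u z.1 z.2 ≤ u t₀ x₀
      + parabolicQuad (deriv (fun s => φ (s, x₀)) t₀) C (fderiv ℝ (fun y => φ (t₀, y)) x₀)
        (secondDeriv (fun y => φ (t₀, y)) x₀ + κ • innerForm N) (z.1 - t₀) (z.2 - x₀)
      - κ / 4 * ((z.1 - t₀) ^ 2 + ‖z.2 - x₀‖ ^ 2) := by
  obtain ⟨C, hC⟩ := eventually_parabolic_taylor hφ (show 0 < κ / 4 by positivity)
  refine ⟨C + κ / 4, ?_⟩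
  filter_upwards [hmax, nhdsWithin_le_nhds hC] with z h1 h2
  have h3 := (abs_le.1 h2).2
  simp only [parabolicQuad, add_apply, smul_apply, innerForm_apply, real_inner_self_eq_norm_sq,
    smul_eq_mul]
  nlinarith

theorem secondDeriv_parabolicQuad (a C : ℝ) (ℓ : EuclideanSpace ℝ (Fin N) →L[ℝ] ℝ)
    {B : EuclideanSpace ℝ (Fin N) →L[ℝ] EuclideanSpace ℝ (Fin N) →L[ℝ] ℝ}
    (hB : ∀ v w, B v w = B w v) (s c : ℝ) (x : EuclideanSpace ℝ (Fin N)) :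
    secondDeriv (fun y => parabolicQuad a C ℓ B s (y - x₀) + c) x = B := by
  have hid : ∀ y, HasFDerivAt (fun y : EuclideanSpace ℝ (Fin N) => y - x₀)
      (ContinuousLinearMap.id ℝ (EuclideanSpace ℝ (Fin N))) y :=
    fun y => (hasFDerivAt_id y).sub_const x₀
  have hBy : ∀ y, HasFDerivAt (fun y => B (y - x₀)) B y := by
    intro y
    simpa [Function.comp_def] using B.hasFDerivAt.comp y (hid y)
  have h1 : fderiv ℝ (fun y => parabolicQuad a C ℓ B s (y - x₀) + c) = fun y => ℓ + B (y - x₀) := by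
    funext y
    have hly : HasFDerivAt (fun y => ℓ (y - x₀)) ℓ y := by
      simpa [Function.comp_def] using ℓ.hasFDerivAt.comp y (hid y)
    have h := ((hly.const_add (a * s + C * s ^ 2)).add
      (((hBy y).clm_apply (hid y)).mul_const (1 / 2 : ℝ))).add_const c
    refine ((h.congr_fderiv ?_).congr_of_eventuallyEq ?_).fderiv
    · ext v
      simp only [add_apply, smul_apply, ContinuousLinearMap.comp_apply,
        ContinuousLinearMap.flip_apply, ContinuousLinearMap.id_apply, smul_eq_mul]
      rw [hB v (y - x₀)]
      ring
    · refine Eventually.of_forall fun w => ?_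
      simp [parabolicQuad]; ring
  rw [secondDeriv, h1]
  exact ((hBy x).const_add ℓ).fderiv

theorem contDiff_parabolicQuad (a C : ℝ) (ℓ : EuclideanSpace ℝ (Fin N) →L[ℝ] ℝ)
    (B : EuclideanSpace ℝ (Fin N) →L[ℝ] EuclideanSpace ℝ (Fin N) →L[ℝ] ℝ) :
    ContDiff ℝ 2 fun z : ℝ × EuclideanSpace ℝ (Fin N) =>
      parabolicQuad a C ℓ B (z.1 - t₀) (z.2 - x₀) := by
  unfold parabolicQuad
  fun_prop

theorem continuous_parabolicQuad (a C : ℝ) (ℓ : EuclideanSpace ℝ (Fin N) →L[ℝ] ℝ)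
    (B : EuclideanSpace ℝ (Fin N) →L[ℝ] EuclideanSpace ℝ (Fin N) →L[ℝ] ℝ) :
    Continuous fun z : ℝ × EuclideanSpace ℝ (Fin N) =>
      parabolicQuad a C ℓ B (z.1 - t₀) (z.2 - x₀) :=
  (contDiff_parabolicQuad a C ℓ B).continuous

/-- The viscosity inequality for a quadratic that touches `u` strictly from above only in the past
of the point of contact. The penalization `ε / (t₀ - t)` moves the contact to an earlier time. -/
theorem le_of_quadratic_touch_past (hF : IsAdmissible F)
    (hcont : ∀ᶠ z in 𝓝[{z : ℝ × EuclideanSpace ℝ (Fin N) | z.1 ≤ t₀}] (t₀, x₀),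
      ContinuousWithinAt (Function.uncurry u) {z | z.1 ≤ t₀} z)
    (hsub : ∀ᶠ z in 𝓝[{z : ℝ × EuclideanSpace ℝ (Fin N) | z.1 ≤ t₀}] (t₀, x₀),
      z.1 < t₀ → IsSubsolutionAt F u z.1 z.2)
    {a C κ : ℝ} {ℓ : EuclideanSpace ℝ (Fin N) →L[ℝ] ℝ}
    {B : EuclideanSpace ℝ (Fin N) →L[ℝ] EuclideanSpace ℝ (Fin N) →L[ℝ] ℝ}
    (hB : ∀ v w, B v w = B w v) (hκ : 0 < κ)
    (hquad : ∀ᶠ z in 𝓝[{z : ℝ × EuclideanSpace ℝ (Fin N) | z.1 ≤ t₀}] (t₀, x₀),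
      u z.1 z.2 ≤ u t₀ x₀ + parabolicQuad a C ℓ B (z.1 - t₀) (z.2 - x₀)
        - κ * ((z.1 - t₀) ^ 2 + ‖z.2 - x₀‖ ^ 2)) :
    a ≤ F (u t₀ x₀) B := by
  by_contra! hlt
  set S : Set (ℝ × EuclideanSpace ℝ (Fin N)) := {z | z.1 ≤ t₀} with hS
  obtain ⟨θ, hθ, hθ2⟩ : ∃ θ : ℝ, 0 < θ ∧ F (u t₀ x₀) B + θ < a - θ :=
    ⟨(a - F (u t₀ x₀) B) / 3, by linarith, by linarith⟩
  have hz₀ : (t₀, x₀) ∈ S := le_refl t₀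
  have hc0 : ContinuousWithinAt (Function.uncurry u) S (t₀, x₀) := hcont.self_of_nhdsWithin hz₀
  have hFev : ∀ᶠ z in 𝓝[S] (t₀, x₀), F (u z.1 z.2) B < F (u t₀ x₀) B + θ := by
    have : Tendsto (fun z => F (Function.uncurry u z) B) (𝓝[S] (t₀, x₀))
        (𝓝 (F (u t₀ x₀) B)) := ((hF.continuous B).tendsto _).comp hc0
    exact this.eventually (gt_mem_nhds (by linarith))
  obtain ⟨r₁, hr₁, hr₁ball⟩ := Metric.eventually_nhds_iff_ball.1
    (eventually_nhdsWithin_iff.1 (hcont.and (hsub.and (hquad.and hFev))))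
  obtain ⟨r, hr, hrr, hCr⟩ : ∃ r : ℝ, 0 < r ∧ r < r₁ ∧ 2 * |C| * r ≤ θ := by
    refine ⟨min (r₁ / 2) (θ / (2 * |C| + 1)), by positivity, ?_, ?_⟩
    · exact (min_le_left _ _).trans_lt (by linarith)
    · calc 2 * |C| * min (r₁ / 2) (θ / (2 * |C| + 1)) ≤ (2 * |C| + 1) * (θ / (2 * |C| + 1)) := by
            gcongr
            · linarith
            · exact min_le_right _ _
        _ = θ := by field_simp
  set K := Metric.closedBall (t₀, x₀) r ∩ S with hK
  have hKall := fun z (hz : z ∈ K) => hr₁ball z (Metric.closedBall_subset_ball hrr hz.1) hz.2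
  set G : ℝ × EuclideanSpace ℝ (Fin N) → ℝ :=
    fun z => u z.1 z.2 - parabolicQuad a C ℓ B (z.1 - t₀) (z.2 - x₀) with hG
  have hG0 : G (t₀, x₀) = u t₀ x₀ := by simp [hG, parabolicQuad]
  have hGS : ContinuousWithinAt G S (t₀, x₀) :=
    hc0.sub (continuous_parabolicQuad a C ℓ B).continuousWithinAt
  have hδ : 0 < κ * r ^ 2 / 4 := by positivity
  -- a slightly earlier time at which `G` is still almost as large as at the contact point
  obtain ⟨η, hη, hηr, hGη⟩ : ∃ η : ℝ, 0 < η ∧ η < r ∧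
      u t₀ x₀ - κ * r ^ 2 / 4 < G (t₀ - η, x₀) := by
    have hpath : Tendsto (fun η : ℝ => (t₀ - η, x₀)) (𝓝[>] 0) (𝓝[S] (t₀, x₀)) := by
      refine tendsto_nhdsWithin_iff.2 ⟨?_, ?_⟩
      · have : Tendsto (fun η : ℝ => (t₀ - η, x₀)) (𝓝 0) (𝓝 (t₀ - 0, x₀)) :=
          (Continuous.prodMk (by fun_prop) (by fun_prop)).tendsto _
        rw [sub_zero] at this
        exact this.mono_left nhdsWithin_le_nhds
      · filter_upwards [self_mem_nhdsWithin] with η hη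
        have : (0 : ℝ) < η := hη
        simp [hS, this.le]
    have h1 : ∀ᶠ η in 𝓝[>] (0 : ℝ), u t₀ x₀ - κ * r ^ 2 / 4 < G (t₀ - η, x₀) := by
      have := (hGS.tendsto.comp hpath)
      rw [hG0] at this
      exact this.eventually (lt_mem_nhds (by linarith))
    have h2 : ∀ᶠ η in 𝓝[>] (0 : ℝ), η < r := by
      filter_upwards [Ioo_mem_nhdsGT hr] with η hη using hη.2
    obtain ⟨η, h1, h2, h3⟩ := (h1.and (h2.and self_mem_nhdsWithin)).exists
    exact ⟨η, h3, h2, h1⟩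
  -- the penalization equals `κ r² / 4` at time `t₀ - η` and `κ r²` at time `t₀ - σ`, so that the
  -- maximum below is attained at a time before `t₀ - σ`
  set ε := η * (κ * r ^ 2 / 4) with hε
  have hεpos : 0 < ε := by positivity
  set σ := η / 4 with hσ
  set K' := K ∩ {z | z.1 ≤ t₀ - σ} with hK'
  have hK'c : IsCompact K' := by
    refine ((isCompact_closedBall _ _).inter_right ?_).inter_right ?_
    · exact isClosed_le continuous_fst continuous_const
    · exact isClosed_le continuous_fst continuous_const
  set H : ℝ × EuclideanSpace ℝ (Fin N) → ℝ := fun z => G z - ε / (t₀ - z.1) with hH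
  have hHc : ContinuousOn H K' := by
    intro z hz
    have hz1 : z.1 ≤ t₀ - σ := hz.2
    have h1 : ContinuousWithinAt (Function.uncurry u) K' z :=
      (hKall z hz.1).1.mono (fun w hw => hw.1.2)
    have h2 : ContinuousWithinAt (fun z : ℝ × EuclideanSpace ℝ (Fin N) => ε / (t₀ - z.1)) K' z := by
      refine ContinuousAt.continuousWithinAt (ContinuousAt.div (by fun_prop) (by fun_prop) ?_)
      have : 0 < σ := by positivity
      linarith
    exact (h1.sub (continuous_parabolicQuad a C ℓ B).continuousWithinAt).sub h2
  have hmem : (t₀ - η, x₀) ∈ K' := by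
    refine ⟨⟨?_, ?_⟩, ?_⟩
    · simp [Prod.dist_eq, abs_of_pos hη, hηr.le, hr.le]
    · simp [hS, hη.le]
    · simp [hσ]; linarith
  obtain ⟨z, hzK, hzmax⟩ := hK'c.exists_isMaxOn ⟨_, hmem⟩ hHc
  have hHη : u t₀ x₀ - κ * r ^ 2 / 2 < H (t₀ - η, x₀) := by
    have : ε / (t₀ - (t₀ - η)) = κ * r ^ 2 / 4 := by
      rw [hε, sub_sub_cancel, mul_div_cancel_left₀ _ hη.ne']
    simp only [hH]
    rw [this]
    linarith
  have hHz : u t₀ x₀ - κ * r ^ 2 / 2 < H z := hHη.trans_le (hzmax hmem)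
  obtain ⟨-, hzsub, hzquad, hzF⟩ := hKall z hzK.1
  have hzσ : z.1 ≤ t₀ - σ := hzK.2
  have hσpos : 0 < σ := by positivity
  have htz : 0 < t₀ - z.1 := by linarith
  have hGz : G z ≤ u t₀ x₀ - κ * ((z.1 - t₀) ^ 2 + ‖z.2 - x₀‖ ^ 2) := by
    simp only [hG]; linarith
  have hsq : 0 ≤ κ * ((z.1 - t₀) ^ 2 + ‖z.2 - x₀‖ ^ 2) := by positivity
  have hεz : 0 < ε / (t₀ - z.1) := by positivity
  have hzlt : z.1 < t₀ - σ := by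
    refine lt_of_le_of_ne hzσ fun h => ?_
    have h1 : ε / (t₀ - z.1) = κ * r ^ 2 := by
      rw [h, sub_sub_cancel, hε, hσ]; field_simp
    have : H z = G z - κ * r ^ 2 := by simp only [hH]; rw [h1]
    linarith [mul_nonneg hκ.le (sq_nonneg r)]
  have hzr : (z.1 - t₀) ^ 2 + ‖z.2 - x₀‖ ^ 2 < r ^ 2 := by
    have : κ * ((z.1 - t₀) ^ 2 + ‖z.2 - x₀‖ ^ 2) < κ * r ^ 2 := by
      simp only [hH] at hHz
      linarith [mul_nonneg hκ.le (sq_nonneg r)]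
    exact lt_of_mul_lt_mul_left this hκ.le
  have hzball : z ∈ Metric.ball (t₀, x₀) r := by
    rw [Metric.mem_ball, Prod.dist_eq, max_lt_iff, Real.dist_eq, dist_eq_norm]
    constructor
    · refine abs_lt_of_sq_lt_sq ?_ hr.le
      linarith [sq_nonneg ‖z.2 - x₀‖]
    · refine lt_of_pow_lt_pow_left₀ 2 hr.le ?_
      linarith [sq_nonneg (z.1 - t₀)]
  -- the test function at the new contact point
  set φ : ℝ × EuclideanSpace ℝ (Fin N) → ℝ :=
    fun w => parabolicQuad a C ℓ B (w.1 - t₀) (w.2 - x₀) + ε / (t₀ - w.1) with hφ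
  have hφc : ContDiffAt ℝ 2 φ (z.1, z.2) := by
    refine (contDiff_parabolicQuad a C ℓ B).contDiffAt.add (ContDiffAt.div ?_ ?_ ?_)
    · fun_prop
    · fun_prop
    · exact htz.ne'
  have hloc : IsLocalMax (fun w => u w.1 w.2 - φ w) (z.1, z.2) := by
    have h1 : ∀ᶠ w in 𝓝 z, w ∈ Metric.ball (t₀, x₀) r := Metric.isOpen_ball.mem_nhds hzball
    have h2 : ∀ᶠ w in 𝓝 z, w.1 < t₀ - σ :=
      (isOpen_lt continuous_fst continuous_const).mem_nhds hzlt
    filter_upwards [h1, h2] with w hw1 hw2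
    have hwK : w ∈ K' := ⟨⟨Metric.ball_subset_closedBall hw1, by simp [hS]; linarith⟩, hw2.le⟩
    have := hzmax hwK
    simp only [hH, hG, mem_ofPred_eq] at this
    simp only [hφ]
    linarith
  have hmain := hzsub (by linarith) φ hφc hloc
  have hD : secondDeriv (fun y => φ (z.1, y)) z.2 = B :=
    secondDeriv_parabolicQuad (x₀ := x₀) a C ℓ hB (z.1 - t₀) (ε / (t₀ - z.1)) z.2
  have hdt : deriv (fun s => φ (s, z.2)) z.1
      = a + 2 * C * (z.1 - t₀) + ε / (t₀ - z.1) ^ 2 := by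
    have h1 : HasDerivAt (fun s : ℝ => s - t₀) 1 z.1 := (hasDerivAt_id z.1).sub_const t₀
    have h2 : HasDerivAt (fun s : ℝ => t₀ - s) (-1) z.1 := (hasDerivAt_id z.1).const_sub t₀
    have h3 := (((h1.const_mul a).add ((h1.pow 2).const_mul C)).add_const
      (ℓ (z.2 - x₀))).add_const (B (z.2 - x₀) (z.2 - x₀) / 2)
    have h4 := h3.add ((h2.inv htz.ne').const_mul ε)
    refine Eq.trans (HasDerivAt.deriv (h4.congr_of_eventuallyEq ?_)) ?_
    · refine Eventually.of_forall fun s => ?_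
      simp [hφ, parabolicQuad, div_eq_mul_inv]
    · simp; ring
  -- the penalization only increases the time derivative
  rw [hD, hdt] at hmain
  have h5 : 0 < ε / (t₀ - z.1) ^ 2 := by positivity
  have h6 : -θ ≤ 2 * C * (z.1 - t₀) := by
    have h7 : |z.1 - t₀| ≤ r := by
      refine abs_le_of_sq_le_sq ?_ hr.le
      linarith [sq_nonneg ‖z.2 - x₀‖]
    have h8 : |2 * C * (z.1 - t₀)| ≤ θ := by
      rw [abs_mul, abs_mul, abs_two]
      exact (mul_le_mul_of_nonneg_left h7 (by positivity)).trans hCr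
    exact (abs_le.1 h8).1
  linarith

theorem symm_secondDeriv_add {φ : ℝ × EuclideanSpace ℝ (Fin N) → ℝ}
    (hφ : ContDiffAt ℝ 2 φ (t₀, x₀)) (κ : ℝ) (v w : EuclideanSpace ℝ (Fin N)) :
    (secondDeriv (fun y => φ (t₀, y)) x₀ + κ • innerForm N) v w
      = (secondDeriv (fun y => φ (t₀, y)) x₀ + κ • innerForm N) w v := by
  simp only [add_apply, smul_apply, innerForm_apply, smul_eq_mul]
  rw [secondDeriv_space_slice hφ, secondDeriv_space_slice hφ, real_inner_comm,
    (hφ.isSymmSndFDerivAt (by simp)).eq]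

/-- Perturbations of the Hessian by small multiples of the identity can be removed in the limit. -/
theorem IsAdmissible.le_of_forall_shift (hF : IsAdmissible F) {a r : ℝ}
    {B : EuclideanSpace ℝ (Fin N) →L[ℝ] EuclideanSpace ℝ (Fin N) →L[ℝ] ℝ}
    (h : ∀ κ : ℝ, 0 < κ → a ≤ F r (B + κ • innerForm N)) : a ≤ F r B := by
  obtain ⟨c, hc, hs⟩ := hF.shift
  refine le_of_forall_pos_le_add fun ε hε => ?_
  have hκ : 0 < ε / (c + 1) := by positivity
  refine ((h _ hκ).trans (hs r B _ hκ.le)).trans ?_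
  have : c * (ε / (c + 1)) ≤ (c + 1) * (ε / (c + 1)) := by gcongr; linarith
  have h2 : (c + 1) * (ε / (c + 1)) = ε := by field_simp
  linarith

/-- A subsolution satisfies the viscosity inequality also for test functions that touch it from
above only in the past of the point of contact. -/
theorem deriv_le_of_isLocalMaxOn_past (hF : IsAdmissible F)
    (hcont : ∀ᶠ z in 𝓝[{z : ℝ × EuclideanSpace ℝ (Fin N) | z.1 ≤ t₀}] (t₀, x₀),
      ContinuousWithinAt (Function.uncurry u) {z | z.1 ≤ t₀} z)
    (hsub : ∀ᶠ z in 𝓝[{z : ℝ × EuclideanSpace ℝ (Fin N) | z.1 ≤ t₀}] (t₀, x₀),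
      z.1 < t₀ → IsSubsolutionAt F u z.1 z.2)
    {φ : ℝ × EuclideanSpace ℝ (Fin N) → ℝ} (hφ : ContDiffAt ℝ 2 φ (t₀, x₀))
    (hmax : IsLocalMaxOn (fun z => u z.1 z.2 - φ z) {z | z.1 ≤ t₀} (t₀, x₀)) :
    deriv (fun s => φ (s, x₀)) t₀ ≤ F (u t₀ x₀) (secondDeriv (fun y => φ (t₀, y)) x₀) := by
  refine hF.le_of_forall_shift fun κ hκ => ?_
  obtain ⟨C, hC⟩ := eventually_le_parabolicQuad hφ hmax hκ
  exact le_of_quadratic_touch_past hF hcont hsub (symm_secondDeriv_add hφ κ)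
    (show 0 < κ / 4 by positivity) hC

/-- It suffices to test with quadratics that touch strictly. -/
theorem isSubsolutionAt_of_quadratic (hF : IsAdmissible F)
    (h : ∀ (a C κ : ℝ) (ℓ : EuclideanSpace ℝ (Fin N) →L[ℝ] ℝ)
      (B : EuclideanSpace ℝ (Fin N) →L[ℝ] EuclideanSpace ℝ (Fin N) →L[ℝ] ℝ), 0 < κ →
      (∀ᶠ z in 𝓝 (t₀, x₀), u z.1 z.2 ≤ u t₀ x₀ + parabolicQuad a C ℓ B (z.1 - t₀) (z.2 - x₀)
        - κ * ((z.1 - t₀) ^ 2 + ‖z.2 - x₀‖ ^ 2)) → a ≤ F (u t₀ x₀) B) :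
    IsSubsolutionAt F u t₀ x₀ := by
  intro φ hφ hmax
  refine hF.le_of_forall_shift fun κ hκ => ?_
  obtain ⟨C, hC⟩ := eventually_le_parabolicQuad (S := univ) hφ
    (isLocalMaxOn_univ_iff.2 hmax) hκ
  rw [nhdsWithin_univ] at hC
  exact h _ C (κ / 4) _ _ (by positivity) hC

end

/-! ### Comparison with smooth strict supersolutions -/

/-- The right-hand side `P_k^+ + f` of the equation. -/
noncomputable def subOp {N : ℕ} (k : ℕ) (f : ℝ → ℝ) (r : ℝ)
    (B : EuclideanSpace ℝ (Fin N) →L[ℝ] EuclideanSpace ℝ (Fin N) →L[ℝ] ℝ) : ℝ :=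
  topTrace k B + f r

/-- The right-hand side of the equation solved by `-u` when `u` solves `∂_t u = P_k^+ u + f(u)`.
Supersolutions `u` of the latter correspond to subsolutions `-u` of the former. -/
noncomputable def superOp {N : ℕ} (k : ℕ) (f : ℝ → ℝ) (r : ℝ)
    (B : EuclideanSpace ℝ (Fin N) →L[ℝ] EuclideanSpace ℝ (Fin N) →L[ℝ] ℝ) : ℝ :=
  -topTrace k (-B) - f (-r)

section

variable {N k : ℕ} {f : ℝ → ℝ}

theorem isAdmissible_subOp (hkN : k ≤ N) (hf : Continuous f) :
    IsAdmissible (N := N) (subOp k f) where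
  continuous B := by unfold subOp; fun_prop
  shift := ⟨k, by positivity, fun r B κ _ => by
    have := topTrace_add_smul_le B hkN κ
    simp only [subOp]; linarith⟩

theorem isAdmissible_superOp (hkN : k ≤ N) (hf : Continuous f) :
    IsAdmissible (N := N) (superOp k f) where
  continuous B := by unfold superOp; fun_prop
  shift := ⟨k, by positivity, fun r B κ _ => by
    have := topTrace_add_smul_le (-(B + κ • innerForm N)) hkN κ
    have h : -(B + κ • innerForm N) + κ • innerForm N = -B := by abel
    rw [h] at this
    simp only [superOp]; linarith⟩

theorem contDiffAt_space_slice {φ : ℝ × EuclideanSpace ℝ (Fin N) → ℝ} {t : ℝ}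
    {x : EuclideanSpace ℝ (Fin N)} (hφ : ContDiffAt ℝ 2 φ (t, x)) :
    ContDiffAt ℝ 2 (fun y => φ (t, y)) x :=
  ContDiffAt.comp x hφ (contDiffAt_const.prodMk contDiffAt_id)

theorem secondDeriv_neg (g : EuclideanSpace ℝ (Fin N) → ℝ) (x : EuclideanSpace ℝ (Fin N)) :
    secondDeriv (fun y => -g y) x = -secondDeriv g x := by
  have : fderiv ℝ (fun y => -g y) = fun y => -fderiv ℝ g y := by
    funext y; exact fderiv_fun_neg
  rw [secondDeriv, this]
  exact fderiv_fun_neg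

theorem isSubsolutionAt_subOp_iff (hkN : k ≤ N) {u : ℝ → EuclideanSpace ℝ (Fin N) → ℝ} {t : ℝ}
    {x : EuclideanSpace ℝ (Fin N)} : IsSubsolutionAt (subOp k f) u t x ↔
      ∀ φ : ℝ × EuclideanSpace ℝ (Fin N) → ℝ, ContDiffAt ℝ 2 φ (t, x) →
        IsLocalMax (fun z => u z.1 z.2 - φ z) (t, x) →
        deriv (fun s => φ (s, x)) t ≤ PkPlus k (fun y => φ (t, y)) x + f (u t x) := by
  refine forall₂_congr fun φ hφ => ?_
  rw [subOp, PkPlus_eq_topTrace hkN (contDiffAt_space_slice hφ)]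

theorem isSubsolutionAt_superOp_iff (hkN : k ≤ N) {u : ℝ → EuclideanSpace ℝ (Fin N) → ℝ} {t : ℝ}
    {x : EuclideanSpace ℝ (Fin N)} : IsSubsolutionAt (superOp k f) (fun t x => -u t x) t x ↔
      ∀ φ : ℝ × EuclideanSpace ℝ (Fin N) → ℝ, ContDiffAt ℝ 2 φ (t, x) →
        IsLocalMin (fun z => u z.1 z.2 - φ z) (t, x) →
        PkPlus k (fun y => φ (t, y)) x + f (u t x) ≤ deriv (fun s => φ (s, x)) t := by
  constructor
  · intro h φ hφ hmin
    have h1 := h (fun z => -φ z) hφ.neg (by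
      refine (hmin.neg).congr (Eventually.of_forall fun z => ?_)
      simp; ring)
    rw [deriv.fun_neg, secondDeriv_neg, superOp, neg_neg,
      neg_neg (secondDeriv (fun y => φ (t, y)) x),
      ← PkPlus_eq_topTrace hkN (contDiffAt_space_slice hφ)] at h1
    linarith
  · intro h φ hφ hmax
    have h1 := h (fun z => -φ z) hφ.neg (by
      refine (hmax.neg).congr (Eventually.of_forall fun z => ?_)
      simp; ring)
    rw [deriv.fun_neg, PkPlus_eq_topTrace hkN (contDiffAt_space_slice hφ.neg),
      secondDeriv_neg] at h1
    rw [superOp, neg_neg]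
    linarith

end

section

variable {N : ℕ} {F : ℝ → (EuclideanSpace ℝ (Fin N) →L[ℝ] EuclideanSpace ℝ (Fin N) →L[ℝ] ℝ) → ℝ}
  {v : ℝ → EuclideanSpace ℝ (Fin N) → ℝ}

theorem eventually_continuousWithinAt_past {a t : ℝ} (hat : a < t) (x : EuclideanSpace ℝ (Fin N))
    (hv : ContinuousOn (Function.uncurry v) (Icc a t ×ˢ univ)) :
    ∀ᶠ z in 𝓝[{z : ℝ × EuclideanSpace ℝ (Fin N) | z.1 ≤ t}] (t, x),
      ContinuousWithinAt (Function.uncurry v) {z | z.1 ≤ t} z := by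
  have hopen : IsOpen {z : ℝ × EuclideanSpace ℝ (Fin N) | a < z.1} :=
    isOpen_lt continuous_const continuous_fst
  filter_upwards [nhdsWithin_le_nhds (hopen.mem_nhds (show a < (t, x).1 from hat)),
    self_mem_nhdsWithin] with z hz1 hz2
  refine (hv z ⟨⟨le_of_lt hz1, hz2⟩, mem_univ _⟩).mono_of_mem_nhdsWithin ?_
  filter_upwards [nhdsWithin_le_nhds (hopen.mem_nhds hz1), self_mem_nhdsWithin] with w hw1 hw2
  exact ⟨⟨le_of_lt hw1, hw2⟩, mem_univ _⟩

/-- Comparison of a viscosity subsolution with a smooth strict supersolution `φ`. Strictness is only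
needed where the graphs touch, and contact can only take place in a bounded set. -/
theorem lt_of_strict_supersolution (hF : IsAdmissible F) {a b : ℝ}
    (hv : ContinuousOn (Function.uncurry v) (Icc a b ×ˢ univ))
    (hsub : ∀ t ∈ Ioo a b, ∀ x, IsSubsolutionAt F v t x)
    {φ : ℝ × EuclideanSpace ℝ (Fin N) → ℝ} (hφc : ContinuousOn φ (Icc a b ×ˢ univ))
    (hφ : ∀ t ∈ Ioc a b, ∀ x, ContDiffAt ℝ 2 φ (t, x))
    (h0 : ∀ x, v a x < φ (a, x))
    (hR : ∃ R, ∀ t ∈ Icc a b, ∀ x, φ (t, x) ≤ v t x → ‖x‖ ≤ R)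
    (hstrict : ∀ t ∈ Ioc a b, ∀ x, φ (t, x) = v t x →
      F (v t x) (secondDeriv (fun y => φ (t, y)) x) < deriv (fun s => φ (s, x)) t) :
    ∀ t ∈ Icc a b, ∀ x, v t x < φ (t, x) := by
  by_contra! hcon
  obtain ⟨t₁, ht₁, x₁, hx₁⟩ := hcon
  obtain ⟨R, hR⟩ := hR
  set D : Set (ℝ × EuclideanSpace ℝ (Fin N)) := Icc a b ×ˢ Metric.closedBall 0 R with hD
  have hDc : IsCompact D := isCompact_Icc.prod (isCompact_closedBall _ _)
  have hDsub : D ⊆ Icc a b ×ˢ univ := prod_mono le_rfl (subset_univ _)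
  set g : ℝ × EuclideanSpace ℝ (Fin N) → ℝ := fun z => φ z - v z.1 z.2 with hg
  have hgc : ContinuousOn g (Icc a b ×ˢ univ) := hφc.sub hv
  -- the set of points where the order is violated is compact, so there is a first one
  have hK : IsCompact (D ∩ g ⁻¹' Iic 0) :=
    hDc.of_isClosed_subset
      ((hgc.mono hDsub).preimage_isClosed_of_isClosed hDc.isClosed isClosed_Iic)
      inter_subset_left
  have hmem : ∀ t ∈ Icc a b, ∀ x, φ (t, x) ≤ v t x → (t, x) ∈ D ∩ g ⁻¹' Iic 0 := by
    intro t ht x hx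
    refine ⟨⟨ht, ?_⟩, ?_⟩
    · simpa using hR t ht x hx
    · simpa [hg] using hx
  obtain ⟨⟨t, x⟩, hz, hzmin⟩ :=
    hK.exists_isMinOn ⟨_, hmem t₁ ht₁ x₁ hx₁⟩ continuous_fst.continuousOn
  have ht : t ∈ Icc a b := hz.1.1
  have hle : φ (t, x) ≤ v t x := by simpa [hg] using hz.2
  have hbefore : ∀ s ∈ Icc a b, s < t → ∀ y, v s y < φ (s, y) := by
    intro s hs hst y
    by_contra! h
    have := hzmin (hmem s hs y h)
    simp at this
    linarith
  have hat : a < t := by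
    refine lt_of_le_of_ne ht.1 ?_
    rintro rfl
    exact absurd (h0 x) (not_lt.2 hle)
  have hpast : ∀ y, v t y ≤ φ (t, y) := by
    intro y
    have hc : ContinuousWithinAt (fun s => g (s, y)) (Icc a b) t :=
      (hgc (t, y) ⟨ht, mem_univ _⟩).comp (t := Icc a b ×ˢ univ) (f := fun s : ℝ => (s, y))
        (by fun_prop) (fun s hs => ⟨hs, mem_univ _⟩)
    have hc2 : Tendsto (fun s => g (s, y)) (𝓝[Ioo a t] t) (𝓝 (g (t, y))) :=
      hc.mono (fun s hs => ⟨hs.1.le, hs.2.le.trans ht.2⟩)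
    have : (𝓝[Ioo a t] t).NeBot := by
      rw [← mem_closure_iff_nhdsWithin_neBot, closure_Ioo hat.ne]
      exact ⟨hat.le, le_rfl⟩
    have := ge_of_tendsto hc2 (b := 0) (by
      filter_upwards [self_mem_nhdsWithin] with s hs
      have := hbefore s ⟨hs.1.le, hs.2.le.trans ht.2⟩ hs.2 y
      simp only [hg]; linarith)
    simp only [hg] at this; linarith
  have heq : φ (t, x) = v t x := le_antisymm hle (hpast x)
  have hvt : ContinuousOn (Function.uncurry v) (Icc a t ×ˢ univ) :=
    hv.mono (prod_mono (Icc_subset_Icc_right ht.2) le_rfl)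
  have hpos : ∀ᶠ z in 𝓝[{z : ℝ × EuclideanSpace ℝ (Fin N) | z.1 ≤ t}] (t, x), a < z.1 :=
    nhdsWithin_le_nhds ((isOpen_lt continuous_const continuous_fst).mem_nhds hat)
  have hmain := deriv_le_of_isLocalMaxOn_past hF (eventually_continuousWithinAt_past hat x hvt)
    (by
      filter_upwards [hpos] with z hz1 hz2
      exact hsub z.1 ⟨hz1, hz2.trans_le ht.2⟩ z.2) (hφ t ⟨hat, ht.2⟩ x) (by
      filter_upwards [hpos, self_mem_nhdsWithin] with z hz1 hz2
      have : v z.1 z.2 ≤ φ z := by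
        rcases (show z.1 ≤ t from hz2).eq_or_lt with h | h
        · have := hpast z.2
          rwa [← h] at this
        · exact (hbefore z.1 ⟨hz1.le, hz2.trans ht.2⟩ h z.2).le
      simp only [heq]
      linarith)
  exact absurd (hstrict t ⟨hat, ht.2⟩ x heq) (not_lt.2 hmain)

end

/-! ### Gaussians and bounds for the lifespan -/

section gaussian

variable {N k : ℕ}

/-- The profile `s^{-γ} exp(-q / (4 s))`, with `q` the squared distance to the centre; for
`γ = k / 2` it is, up to a constant, the heat kernel in dimension `k`. -/
noncomputable def gaussProfile (γ s q : ℝ) : ℝ := s ^ (-γ) * Real.exp (-q / (4 * s))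

theorem gaussProfile_pos {γ s : ℝ} (hs : 0 < s) (q : ℝ) : 0 < gaussProfile γ s q := by
  unfold gaussProfile; positivity

theorem hasDerivAt_gaussProfile_time (γ q : ℝ) {s : ℝ} (hs : 0 < s) :
    HasDerivAt (fun s => gaussProfile γ s q)
      (gaussProfile γ s q * (-γ / s + q / (4 * s ^ 2))) s := by
  have h1 : HasDerivAt (fun s : ℝ => s ^ (-γ)) (-γ * s ^ (-γ - 1)) s :=
    Real.hasDerivAt_rpow_const (Or.inl hs.ne')
  have h2 : HasDerivAt (fun s : ℝ => -q / (4 * s)) (q / (4 * s ^ 2)) s := by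
    have := (((hasDerivAt_id s).const_mul 4).inv (by simpa using hs.ne')).const_mul (-q)
    refine (this.congr_deriv ?_).congr_of_eventuallyEq (Eventually.of_forall fun y => ?_)
    · simp; field_simp
    · simp [div_eq_mul_inv]
  refine (h1.mul h2.exp).congr_deriv ?_
  rw [Real.rpow_sub_one hs.ne', gaussProfile]
  field_simp

/-- `P_k^+` of a Gaussian plus a convex paraboloid with the same centre. -/
theorem topTrace_secondDeriv_gauss (hk : 1 ≤ k) (hkN : k ≤ N) {γ s M η d : ℝ} (hs : 0 < s)
    (hM : 0 ≤ M) (x₀ x : EuclideanSpace ℝ (Fin N)) :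
    topTrace k (secondDeriv
        (fun y => M * gaussProfile γ s (‖y - x₀‖ ^ 2) + η * ‖y - x₀‖ ^ 2 + d) x)
      = M * gaussProfile γ s (‖x - x₀‖ ^ 2) * (-(k / 2 : ℝ) / s + ‖x - x₀‖ ^ 2 / (4 * s ^ 2))
        + 2 * k * η := by
  have he : ∀ q, HasDerivAt (fun q => gaussProfile γ s q)
      (gaussProfile γ s q * (-1 / (4 * s))) q := by
    intro q
    have h := (((hasDerivAt_id q).neg.div_const (4 * s)).exp.const_mul (s ^ (-γ)))
    refine h.congr_deriv ?_
    simp [gaussProfile]; ring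
  have hg : ∀ q, HasDerivAt (fun q => M * gaussProfile γ s q + η * q + d)
      (M * (gaussProfile γ s q * (-1 / (4 * s))) + η) q := by
    intro q
    simpa using (((he q).const_mul M).add ((hasDerivAt_id q).const_mul η)).add_const d
  have hg' : ∀ q, HasDerivAt (fun q => M * (gaussProfile γ s q * (-1 / (4 * s))) + η)
      (M * (gaussProfile γ s q * (-1 / (4 * s)) * (-1 / (4 * s)))) q := by
    intro q
    exact (((he q).mul_const _).const_mul M).add_const η
  rw [topTrace_secondDeriv_radial hk hkN hg hg' x₀ x]
  · field_simp
    ring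
  · have := gaussProfile_pos (γ := γ) hs (‖x - x₀‖ ^ 2)
    have h2 : (-1 / (4 * s)) * (-1 / (4 * s)) = (1 / (4 * s)) ^ 2 := by ring
    rw [mul_assoc (gaussProfile γ s _), h2]
    positivity

theorem contDiffAt_gaussProfile (γ : ℝ) (x₀ : EuclideanSpace ℝ (Fin N)) {t t₀ : ℝ}
    (ht : 0 < t + t₀) (x : EuclideanSpace ℝ (Fin N)) :
    ContDiffAt ℝ 2 (fun z : ℝ × EuclideanSpace ℝ (Fin N) =>
      gaussProfile γ (z.1 + t₀) (‖z.2 - x₀‖ ^ 2)) (t, x) := by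
  unfold gaussProfile
  have h1 : ContDiffAt ℝ 2 (fun z : ℝ × EuclideanSpace ℝ (Fin N) => z.1 + t₀) (t, x) := by fun_prop
  have h2 : ContDiffAt ℝ 2 (fun z : ℝ × EuclideanSpace ℝ (Fin N) => ‖z.2 - x₀‖ ^ 2) (t, x) :=
    ContDiffAt.norm_sq ℝ (by fun_prop)
  refine (h1.rpow_const_of_ne ht.ne').mul (ContDiffAt.exp ?_)
  exact h2.neg.div (contDiffAt_const.mul h1) (by simpa using ht.ne')

end gaussian

section lifespan

variable {N k : ℕ} {p : ℝ} {u₀ : EuclideanSpace ℝ (Fin N) → ℝ} {T : EReal}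
  {u : ℝ → EuclideanSpace ℝ (Fin N) → ℝ}

/-- Comparison from below with a smooth strict subsolution `w` that is positive only in a bounded
set. No growth condition on the solution is needed, since it is nonnegative. -/
theorem IsViscositySolution.lt_of_strict_subsolution (hu : IsViscositySolution k p u₀ T u)
    (hkN : k ≤ N) (hp : 0 < p) {a b : ℝ} (ha : 0 ≤ a) (hb : (b : EReal) < T)
    {w : ℝ × EuclideanSpace ℝ (Fin N) → ℝ}
    (hw : ∀ t ∈ Icc a b, ∀ x, ContDiffAt ℝ 2 w (t, x))
    (h0 : ∀ x, w (a, x) < u a x)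
    (hR : ∃ R, ∀ t ∈ Icc a b, ∀ x, 0 ≤ w (t, x) → ‖x‖ ≤ R)
    (hstrict : ∀ t ∈ Ioc a b, ∀ x, 0 ≤ w (t, x) → deriv (fun s => w (s, x)) t
      < topTrace k (secondDeriv (fun y => w (t, y)) x) + w (t, x) ^ (1 + p)) :
    ∀ t ∈ Icc a b, ∀ x, w (t, x) < u t x := by
  have hf : Continuous fun r : ℝ => r ^ (1 + p) := Real.continuous_rpow_const (by linarith)
  have hbT : ∀ t ≤ b, (t : EReal) < T := fun t ht => (EReal.coe_le_coe_iff.2 ht).trans_lt hb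
  have hsub : Icc a b ×ˢ (univ : Set (EuclideanSpace ℝ (Fin N)))
      ⊆ {t : ℝ | 0 ≤ t ∧ (t : EReal) < T} ×ˢ univ :=
    prod_mono (fun t ht => ⟨ha.trans ht.1, hbT t ht.2⟩) le_rfl
  have key := lt_of_strict_supersolution (v := fun t x => -u t x) (φ := fun z => -w z)
    (isAdmissible_superOp (N := N) hkN hf) (a := a) (b := b) (hu.continuousOn.mono hsub).neg
    (fun t ht x => (isSubsolutionAt_superOp_iff hkN).2
      (hu.supersolution t x (ha.trans_lt ht.1) (hbT t ht.2.le)))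
    (fun z hz => (hw z.1 hz.1 z.2).continuousAt.continuousWithinAt.neg)
    (fun t ht x => (hw t ⟨ht.1.le, ht.2⟩ x).neg)
    (fun x => neg_lt_neg (h0 x))
    (by
      obtain ⟨R, hR⟩ := hR
      refine ⟨R, fun t ht x hx => hR t ht x ?_⟩
      have := hu.nonneg t (ha.trans ht.1) (hbT t ht.2) x
      linarith)
    (by
      intro t ht x hx
      have hx' : w (t, x) = u t x := by linarith
      have hn := hu.nonneg t (ha.trans ht.1.le) (hbT t ht.2) x
      have := hstrict t ht x (hx'.symm ▸ hn)
      rw [superOp, secondDeriv_neg, neg_neg (secondDeriv (fun y => w (t, y)) x), deriv.fun_neg,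
        neg_neg, ← hx']
      linarith)
  intro t ht x
  exact neg_lt_neg_iff.1 (key t ht x)

/-- The scalar inequality that makes `A τ^{-1/p} σ` with `σ = 1 - |x - x₀|² / (4 k τ)` a strict
subsolution where it is nonnegative. For small `σ` the left-hand side is below `-1/2` already; for
other `σ` the reaction wins if `A` is large. -/
theorem exists_blowup_height (hp : 0 < p) :
    ∃ A : ℝ, 0 < A ∧ ∀ σ : ℝ, 0 ≤ σ → 1 / p * σ - (1 - σ) < -(1 / 2) + A ^ p * σ ^ (1 + p) := by
  -- at `σ₀` the left-hand side equals `-1/2`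
  set σ₀ : ℝ := 1 / (2 * (1 + 1 / p)) with hσ₀
  have hq : 0 < 1 / p := by positivity
  have hσ₀pos : 0 < σ₀ := by positivity
  set Z : ℝ := (1 + 1 / p) / σ₀ ^ p with hZ
  have hZpos : 0 < Z := by positivity
  refine ⟨Z ^ (1 / p), by positivity, fun σ hσ => ?_⟩
  have hA : (Z ^ (1 / p)) ^ p = Z := by
    rw [← Real.rpow_mul hZpos.le, one_div_mul_cancel hp.ne', Real.rpow_one]
  rw [hA]
  rcases lt_or_ge σ σ₀ with h | h
  · have h1 : (1 + 1 / p) * σ < (1 + 1 / p) * σ₀ := by gcongr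
    have h2 : (1 + 1 / p) * σ₀ = 1 / 2 := by rw [hσ₀]; field_simp
    have h3 : 0 ≤ Z * σ ^ (1 + p) := by positivity
    linarith
  · have hσpos : 0 < σ := hσ₀pos.trans_le h
    have h1 : σ₀ ^ p ≤ σ ^ p := by gcongr
    have h2 : Z * σ₀ ^ p = 1 + 1 / p := by rw [hZ]; field_simp
    have h3 : Z * σ ^ (1 + p) = Z * σ ^ p * σ := by
      rw [add_comm, Real.rpow_add_one hσpos.ne']; ring
    have h4 : (1 + 1 / p) * σ ≤ Z * σ ^ p * σ := by
      rw [← h2]; gcongr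
    rw [h3]
    linarith

/-- A solution that exceeds `A T₁^{-1/p}` on the ball of squared radius `4 k T₁` blows up within
time `T₁`: it stays above the subsolution `A τ^{-1/p} (1 - |x - x₀|² / (4 k τ))`, where `τ` is the
time left. -/
theorem exists_lifespan_le (hk : 1 ≤ k) (hkN : k ≤ N) (hp : 0 < p) :
    ∃ A : ℝ, 0 < A ∧ ∀ (u₀ : EuclideanSpace ℝ (Fin N) → ℝ) (T : EReal)
      (u : ℝ → EuclideanSpace ℝ (Fin N) → ℝ), IsViscositySolution k p u₀ T u →
      ∀ (t₁ T₁ : ℝ) (x₀ : EuclideanSpace ℝ (Fin N)), 0 ≤ t₁ → 0 < T₁ →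
        (∀ x, ‖x - x₀‖ ^ 2 ≤ 4 * k * T₁ → A * T₁ ^ (-(1 / p)) < u t₁ x) →
        T ≤ ((t₁ + T₁ : ℝ) : EReal) := by
  obtain ⟨A, hA, hAσ⟩ := exists_blowup_height hp
  refine ⟨A, hA, fun u₀ T u hu t₁ T₁ x₀ ht₁ hT₁ hbig => ?_⟩
  by_contra! hT
  have hk0 : (0 : ℝ) < k := by exact_mod_cast hk
  set w : ℝ × EuclideanSpace ℝ (Fin N) → ℝ := fun z => A * (t₁ + T₁ - z.1) ^ (-(1 / p))
    * (1 - ‖z.2 - x₀‖ ^ 2 / (4 * k * (t₁ + T₁ - z.1))) with hw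
  have hlow : ∀ b, t₁ ≤ b → b < t₁ + T₁ → w (b, x₀) < u b x₀ := by
    intro b hb1 hb2
    refine hu.lt_of_strict_subsolution hkN hp (a := t₁) (b := b) (w := w) ht₁
      ((EReal.coe_lt_coe_iff.2 hb2).trans hT) ?_ ?_ ?_ ?_ b ⟨hb1, le_rfl⟩ x₀
    · intro t ht x
      have hτ : t₁ + T₁ - t ≠ 0 := by linarith [ht.2]
      have h1 : ContDiffAt ℝ 2 (fun z : ℝ × EuclideanSpace ℝ (Fin N) => t₁ + T₁ - z.1) (t, x) := by
        fun_prop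
      have h2 : ContDiffAt ℝ 2 (fun z : ℝ × EuclideanSpace ℝ (Fin N) => ‖z.2 - x₀‖ ^ 2) (t, x) :=
        ContDiffAt.norm_sq ℝ (by fun_prop)
      refine (contDiffAt_const.mul (h1.rpow_const_of_ne hτ)).mul (contDiffAt_const.sub
        (h2.div (contDiffAt_const.mul h1) ?_))
      have : (4 * k : ℝ) ≠ 0 := by positivity
      exact mul_ne_zero this hτ
    · intro x
      simp only [hw, add_sub_cancel_left]
      have hpos : 0 < A * T₁ ^ (-(1 / p)) := by positivity
      have hden : 0 < 4 * k * T₁ := by positivity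
      rcases le_or_gt (‖x - x₀‖ ^ 2) (4 * k * T₁) with h | h
      · have h1 : 0 ≤ ‖x - x₀‖ ^ 2 / (4 * k * T₁) := by positivity
        have := hbig x h
        nlinarith
      · have h1 : 1 < ‖x - x₀‖ ^ 2 / (4 * k * T₁) := (one_lt_div hden).2 h
        have h2 := hu.nonneg t₁ ht₁ ((EReal.coe_lt_coe_iff.2 (by linarith)).trans hT) x
        nlinarith
    · refine ⟨4 * k * T₁ + 1 + ‖x₀‖, fun t ht x hx => ?_⟩
      have hτ : 0 < t₁ + T₁ - t := by linarith [ht.2]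
      have h1 : 0 ≤ 1 - ‖x - x₀‖ ^ 2 / (4 * k * (t₁ + T₁ - t)) := by
        simp only [hw] at hx
        exact nonneg_of_mul_nonneg_right hx (by positivity)
      have h2 : ‖x - x₀‖ ^ 2 ≤ 4 * k * (t₁ + T₁ - t) :=
        (div_le_one (by positivity)).1 (by linarith)
      have h3 : 4 * k * (t₁ + T₁ - t) ≤ 4 * k * T₁ := by gcongr; linarith [ht.1]
      have h4 : ‖x‖ ≤ ‖x - x₀‖ + ‖x₀‖ := by simpa using norm_add_le (x - x₀) x₀
      nlinarith [sq_nonneg (‖x - x₀‖ - 1)]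
    · intro t ht x hx
      have hτ : 0 < t₁ + T₁ - t := by linarith [ht.2]
      set τ := t₁ + T₁ - t with hτdef
      set q := ‖x - x₀‖ ^ 2 with hq
      set σ := 1 - q / (4 * k * τ) with hσ
      have hσ0 : 0 ≤ σ := by
        simp only [hw, ← hτdef] at hx
        exact nonneg_of_mul_nonneg_right hx (by positivity)
      have hwv : w (t, x) = A * τ ^ (-(1 / p)) * σ := rfl
      have hD : topTrace k (secondDeriv (fun y => w (t, y)) x)
          = -(A * τ ^ (-(1 / p)) / τ) * (1 / 2) := by
        have hg : ∀ q, HasDerivAt (fun q : ℝ => A * τ ^ (-(1 / p)) * (1 - q / (4 * k * τ)))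
            (-(A * τ ^ (-(1 / p)) / (4 * k * τ))) q := by
          intro q
          refine ((((hasDerivAt_id q).div_const (4 * k * τ)).const_sub 1).const_mul
            (A * τ ^ (-(1 / p)))).congr_deriv ?_
          ring
        have := topTrace_secondDeriv_radial hk hkN (g'' := fun _ => 0) hg
          (fun q => hasDerivAt_const q _) x₀ x le_rfl
        simp only [hw]
        rw [← hτdef, this]
        field_simp
        ring
      have hdt : deriv (fun s => w (s, x)) t
          = A * τ ^ (-(1 / p)) / τ * (1 / p * σ - (1 - σ)) := by
        have h1 : HasDerivAt (fun s : ℝ => t₁ + T₁ - s) (-1) t := (hasDerivAt_id t).const_sub _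
        have h2 := h1.rpow_const (p := -(1 / p)) (Or.inl hτ.ne')
        have h3 := ((h1.const_mul (4 * k : ℝ)).inv (by positivity)).const_mul q
        have h4 := (h2.const_mul A).mul (h3.const_sub 1)
        have h5 : HasDerivAt (fun s => w (s, x)) _ t :=
          h4.congr_of_eventuallyEq (Eventually.of_forall fun s => by
            simp [hw, hq, div_eq_mul_inv])
        rw [h5.deriv]
        simp only [Pi.inv_apply, ← hτdef]
        rw [Real.rpow_sub_one hτ.ne', hσ]
        field_simp
        ring
      have hpow : w (t, x) ^ (1 + p) = A * τ ^ (-(1 / p)) / τ * (A ^ p * σ ^ (1 + p)) := by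
        have h1 : (τ ^ (-(1 / p))) ^ (1 + p) = τ ^ (-(1 / p)) / τ := by
          rw [← Real.rpow_mul hτ.le, ← Real.rpow_sub_one hτ.ne']
          congr 1
          field_simp
          ring
        rw [hwv, Real.mul_rpow (by positivity) hσ0, Real.mul_rpow hA.le (by positivity), h1,
          Real.rpow_add hA, Real.rpow_one]
        ring
      rw [hdt, hD, hpow]
      have hc : 0 < A * τ ^ (-(1 / p)) / τ := by positivity
      have := mul_lt_mul_of_pos_left (hAσ σ hσ0) hc
      linarith
  -- the lower bound at the centre is unbounded, while `u` is continuous up to time `t₁ + T₁`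
  have hcont : ContinuousOn (fun t => u t x₀) (Icc t₁ (t₁ + T₁)) :=
    hu.continuousOn.comp (f := fun t : ℝ => (t, x₀)) (by fun_prop) fun t ht =>
      ⟨⟨ht₁.trans ht.1, (EReal.coe_le_coe_iff.2 ht.2).trans_lt hT⟩, mem_univ _⟩
  obtain ⟨M, hM⟩ := (isCompact_Icc.image_of_continuousOn hcont).bddAbove
  set M' := max M 1 with hM'
  have hM'pos : 0 < M' / A := div_pos (lt_max_of_lt_right one_pos) hA
  set τ := min T₁ ((M' / A) ^ (-p)) with hτ
  have hτpos : 0 < τ := lt_min hT₁ (by positivity)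
  have h1 := hlow (t₁ + T₁ - τ) (by linarith [min_le_left T₁ ((M' / A) ^ (-p))]) (by linarith)
  have h2 : u (t₁ + T₁ - τ) x₀ ≤ M :=
    hM ⟨_, ⟨by linarith [min_le_left T₁ ((M' / A) ^ (-p))], by linarith⟩, rfl⟩
  have h3 : M' / A ≤ τ ^ (-(1 / p)) := by
    calc M' / A = ((M' / A) ^ (-p)) ^ (-(1 / p)) := by
          rw [← Real.rpow_mul hM'pos.le]
          have : -p * -(1 / p) = 1 := by field_simp
          rw [this, Real.rpow_one]
      _ ≤ τ ^ (-(1 / p)) := by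
          refine Real.rpow_le_rpow_of_nonpos hτpos (min_le_right _ _) ?_
          have : 0 < 1 / p := by positivity
          linarith
  have h4 : w (t₁ + T₁ - τ, x₀) = A * τ ^ (-(1 / p)) := by simp [hw]
  rw [div_le_iff₀ hA] at h3
  rw [h4] at h1
  linarith [le_max_left M 1]

/-- The choice of parameters in the lower bound by Gaussians: `t₀` is the variance parameter at time
`0` and `T₁` the one at the time when the blow-up criterion is to apply. Since `k / 2 < 1 / p`, some
`T₁`, a power of `1 / t₀`, makes the first term on the right twice the left-hand side. This term is
then a power of `t₀`, which for small `t₀` dominates the exponentially small second term. This is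
the only place where the exponent has to be subcritical. -/
theorem exists_gaussian_parameters (hk : 1 ≤ k) (hp : 0 < p) (hpk : p < 2 / (k : ℝ)) {A c r : ℝ}
    (hA : 0 < A) (hc : 0 < c) (hr : 0 < r) :
    ∃ t₀ T₁ : ℝ, 0 < t₀ ∧ t₀ < T₁ ∧ A * T₁ ^ (-(1 / p))
      < c * (t₀ / T₁) ^ (k / 2 : ℝ) * Real.exp (-k) - 4 * c * Real.exp (-(r ^ 2) / (4 * t₀)) := by
  have hk0 : (0 : ℝ) < k := by exact_mod_cast hk
  have hβ : 0 < 1 / p - k / 2 := by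
    rw [lt_div_iff₀ hk0] at hpk
    have : (k / 2 : ℝ) < 1 / p := by rw [lt_div_iff₀ hp]; linarith
    linarith
  set β := 1 / p - k / 2 with hβdef
  set K : ℝ := 2 * A * Real.exp k / c with hK
  have hKpos : 0 < K := by positivity
  set γ : ℝ := k / 2 + k / 2 * (k / 2 / β) with hγ
  set m : ℝ := K ^ (-(k / 2 / β)) / (8 * Real.exp k) with hm
  have hmpos : 0 < m := by positivity
  have e1 := (tendsto_rpow_mul_exp_neg_mul_atTop_nhds_zero γ (r ^ 2 / 4)
    (by positivity)).eventually (gt_mem_nhds hmpos)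
  have e2 := ((tendsto_rpow_atTop (show (0 : ℝ) < k / 2 by positivity)).const_mul_atTop
    hKpos).eventually_ge_atTop 1
  -- `y` is `1 / t₀`
  obtain ⟨y, h1, h2, hy⟩ := (e1.and (e2.and (eventually_gt_atTop (1 : ℝ)))).exists
  have hy0 : 0 < y := by linarith
  have hX : 0 < K * y ^ (k / 2 : ℝ) := by positivity
  set T₁ := (K * y ^ (k / 2 : ℝ)) ^ (1 / β) with hT₁
  have hT₁1 : 1 ≤ T₁ := Real.one_le_rpow h2 (by positivity)
  have hT₁0 : 0 < T₁ := by linarith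
  have hinv : y⁻¹ < 1 := inv_lt_one_of_one_lt₀ hy
  refine ⟨y⁻¹, T₁, by positivity, by linarith, ?_⟩
  have hexp : Real.exp (-(r ^ 2) / (4 * y⁻¹)) = Real.exp (-(r ^ 2 / 4) * y) := by
    congr 1; field_simp
  have hTβ : T₁ ^ (-β) = (K * y ^ (k / 2 : ℝ))⁻¹ := by
    rw [hT₁, ← Real.rpow_mul hX.le]
    have : 1 / β * -β = -1 := by field_simp
    rw [this, Real.rpow_neg_one]
  have hTk : T₁ ^ (-(k / 2 : ℝ)) = K ^ (-(k / 2 / β)) * y ^ (-(k / 2 * (k / 2 / β))) := by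
    rw [hT₁, ← Real.rpow_mul hX.le, Real.mul_rpow hKpos.le (by positivity), ← Real.rpow_mul hy0.le]
    congr 2 <;> field_simp
  have hsplit : T₁ ^ (-(1 / p)) = T₁ ^ (-(k / 2 : ℝ)) * T₁ ^ (-β) := by
    rw [← Real.rpow_add hT₁0]; congr 1; rw [hβdef]; ring
  have hratio : (y⁻¹ / T₁) ^ (k / 2 : ℝ) = y ^ (-(k / 2 : ℝ)) * T₁ ^ (-(k / 2 : ℝ)) := by
    rw [div_eq_mul_inv, Real.mul_rpow (by positivity) (by positivity), Real.inv_rpow hy0.le,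
      Real.inv_rpow hT₁0.le, Real.rpow_neg hy0.le, Real.rpow_neg hT₁0.le]
  set R := (y⁻¹ / T₁) ^ (k / 2 : ℝ) with hRdef
  have hek : Real.exp (k : ℝ) * Real.exp (-(k : ℝ)) = 1 := by rw [← Real.exp_add]; simp
  -- the left-hand side is half of the first term on the right-hand side
  have hleft : A * T₁ ^ (-(1 / p)) = c * R * Real.exp (-k) / 2 := by
    rw [hsplit, hTβ, hratio, hK, Real.rpow_neg hy0.le, Real.exp_neg]
    field_simp
  have hRm : R = 8 * Real.exp k * m * y ^ (-γ) := by
    rw [hratio, hTk, hm, hγ, neg_add, Real.rpow_add hy0]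
    field_simp
  have hyγ : y ^ γ * y ^ (-γ) = 1 := by rw [← Real.rpow_add hy0]; simp
  have hsmall : Real.exp (-(r ^ 2 / 4) * y) < m * y ^ (-γ) := by
    have := mul_lt_mul_of_pos_right h1 (Real.rpow_pos_of_pos hy0 (-γ))
    calc Real.exp (-(r ^ 2 / 4) * y) = y ^ γ * y ^ (-γ) * Real.exp (-(r ^ 2 / 4) * y) := by
          rw [hyγ, one_mul]
      _ = y ^ γ * Real.exp (-(r ^ 2 / 4) * y) * y ^ (-γ) := by ring
      _ < _ := this
  have hbig : c * R * Real.exp (-k) = 8 * c * (m * y ^ (-γ)) := by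
    rw [hRm]
    calc _ = 8 * c * (m * y ^ (-γ)) * (Real.exp k * Real.exp (-k)) := by ring
      _ = _ := by rw [hek, mul_one]
  rw [hleft, hexp, hbig]
  have := mul_lt_mul_of_pos_left hsmall hc
  linarith

/-- The lifespans of all solutions with a given nontrivial datum have a common finite bound. A
Gaussian with small initial variance, minus a tiny constant, bounds the solution from below until
the criterion of `exists_lifespan_le` applies. -/
theorem exists_lifespan_bound (hk : 1 ≤ k) (hkN : k ≤ N) (hp : 0 < p) (hpk : p < 2 / (k : ℝ))
    (hcont : Continuous u₀) (hnn : ∀ x, 0 ≤ u₀ x) (hne : ∃ x, u₀ x ≠ 0) :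
    ∃ T₀ : ℝ, ∀ (T : EReal) (u : ℝ → EuclideanSpace ℝ (Fin N) → ℝ),
      IsViscositySolution k p u₀ T u → T ≤ (T₀ : EReal) := by
  obtain ⟨x₀, hx₀⟩ := hne
  have hpos : 0 < u₀ x₀ := lt_of_le_of_ne (hnn x₀) (Ne.symm hx₀)
  set c := u₀ x₀ / 2 with hc
  have hcpos : 0 < c := by positivity
  obtain ⟨r, hr, hball⟩ : ∃ r > 0, ∀ x, ‖x - x₀‖ < r → c < u₀ x := by
    have h := hcont.continuousAt.eventually (lt_mem_nhds (show c < u₀ x₀ by linarith))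
    obtain ⟨r, hr, h⟩ := Metric.eventually_nhds_iff.1 h
    exact ⟨r, hr, fun x hx => h (by rwa [dist_eq_norm])⟩
  obtain ⟨A, hA, hlife⟩ := exists_lifespan_le (N := N) hk hkN hp
  obtain ⟨t₀, T₁, ht₀, htT, hpar⟩ := exists_gaussian_parameters hk hp hpk hA hcpos hr
  have hT₁ : 0 < T₁ := ht₀.trans htT
  set t₁ := T₁ - t₀ with ht₁
  have ht₁pos : 0 < t₁ := by linarith
  refine ⟨t₁ + T₁, fun T u hu => ?_⟩
  rcases le_or_gt T (t₁ : EReal) with hT | hT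
  · exact hT.trans (EReal.coe_le_coe_iff.2 (by linarith))
  refine hlife u₀ T u hu t₁ T₁ x₀ ht₁pos.le hT₁ fun x hx => ?_
  set δ := 2 * c * Real.exp (-(r ^ 2) / (4 * t₀)) with hδ
  have hδpos : 0 < δ := by positivity
  set M := c * t₀ ^ (k / 2 : ℝ) with hM
  have hMpos : 0 < M := by positivity
  -- subtracting `δ` makes the Gaussian negative where the datum may vanish; the slope `δ / t₁`
  -- gives strictness
  set w : ℝ × EuclideanSpace ℝ (Fin N) → ℝ := fun z =>
    M * gaussProfile (k / 2) (z.1 + t₀) (‖z.2 - x₀‖ ^ 2) + -(δ * (1 + z.1 / t₁)) with hw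
  have hMle : ∀ t, 0 ≤ t → M * (t + t₀) ^ (-(k / 2 : ℝ)) ≤ c := by
    intro t ht
    have h1 : (t + t₀) ^ (-(k / 2 : ℝ)) ≤ t₀ ^ (-(k / 2 : ℝ)) :=
      Real.rpow_le_rpow_of_nonpos ht₀ (by linarith) (neg_nonpos.2 (by positivity))
    calc M * (t + t₀) ^ (-(k / 2 : ℝ)) ≤ M * t₀ ^ (-(k / 2 : ℝ)) := by gcongr
      _ = c * (t₀ ^ (k / 2 : ℝ) * t₀ ^ (-(k / 2 : ℝ))) := by rw [hM]; ring
      _ = c := by rw [← Real.rpow_add ht₀]; simp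
  have hwle : ∀ t, 0 ≤ t → ∀ x, w (t, x)
      ≤ c * Real.exp (-‖x - x₀‖ ^ 2 / (4 * (t + t₀))) - δ := by
    intro t ht x
    have h1 := mul_le_mul_of_nonneg_right (hMle t ht)
      (Real.exp_pos (-‖x - x₀‖ ^ 2 / (4 * (t + t₀)))).le
    have h2 : 0 ≤ δ * (t / t₁) := by positivity
    simp only [hw, gaussProfile]
    linarith
  have hlow : w (t₁, x) < u t₁ x := by
    refine hu.lt_of_strict_subsolution hkN hp (a := 0) (b := t₁) (w := w) le_rfl hT ?_ ?_ ?_ ?_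
      t₁ ⟨ht₁pos.le, le_rfl⟩ x
    · intro t ht x
      exact (contDiffAt_const.mul (contDiffAt_gaussProfile _ x₀ (by linarith [ht.1]) x)).add
        (by fun_prop)
    · intro x
      refine (hwle 0 le_rfl x).trans_lt ?_
      rw [hu.initial, zero_add]
      rcases lt_or_ge ‖x - x₀‖ r with h | h
      · have h1 : Real.exp (-‖x - x₀‖ ^ 2 / (4 * t₀)) ≤ 1 := by
          refine Real.exp_le_one_iff.2 (div_nonpos_of_nonpos_of_nonneg ?_ (by positivity))
          exact neg_nonpos.2 (by positivity)
        have := hball x h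
        nlinarith
      · have h1 : Real.exp (-‖x - x₀‖ ^ 2 / (4 * t₀)) ≤ Real.exp (-(r ^ 2) / (4 * t₀)) := by
          gcongr
        have := hnn x
        have h3 := mul_le_mul_of_nonneg_left h1 hcpos.le
        have h4 : 0 < c * Real.exp (-(r ^ 2) / (4 * t₀)) := by positivity
        linarith
    · refine ⟨4 * T₁ * (c / δ) + 1 + ‖x₀‖, fun t ht x hx => ?_⟩
      have hs : 0 < t + t₀ := by linarith [ht.1]
      set q := ‖x - x₀‖ ^ 2 with hq
      have h1 := hx.trans (hwle t ht.1 x)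
      have h2 : q / (4 * (t + t₀)) ≤ c / δ := by
        rw [le_div_iff₀ hδpos]
        set Z := q / (4 * (t + t₀)) with hZ
        have e : Real.exp (-‖x - x₀‖ ^ 2 / (4 * (t + t₀))) = (Real.exp Z)⁻¹ := by
          rw [← Real.exp_neg, neg_div]
        rw [e] at h1
        have h3 : δ * Real.exp Z ≤ c := by
          have : δ ≤ c * (Real.exp Z)⁻¹ := by linarith
          calc δ * Real.exp Z ≤ c * (Real.exp Z)⁻¹ * Real.exp Z := by gcongr
            _ = c := by rw [mul_assoc, inv_mul_cancel₀ (Real.exp_pos Z).ne', mul_one]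
        have h4 : Z ≤ Real.exp Z := by linarith [Real.add_one_le_exp Z]
        calc Z * δ ≤ Real.exp Z * δ := by gcongr
          _ ≤ c := by linarith
      have h5 : q ≤ 4 * T₁ * (c / δ) := by
        rw [div_le_iff₀ (by positivity)] at h2
        refine h2.trans ?_
        rw [mul_comm]
        have : t + t₀ ≤ T₁ := by linarith [ht.2]
        gcongr
      have h6 : ‖x‖ ≤ ‖x - x₀‖ + ‖x₀‖ := by simpa using norm_add_le (x - x₀) x₀
      nlinarith [sq_nonneg (‖x - x₀‖ - 1)]
    · intro t ht x hx
      have hs : 0 < t + t₀ := by linarith [ht.1]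
      have hD : topTrace k (secondDeriv (fun y => w (t, y)) x)
          = M * gaussProfile (k / 2) (t + t₀) (‖x - x₀‖ ^ 2)
            * (-(k / 2 : ℝ) / (t + t₀) + ‖x - x₀‖ ^ 2 / (4 * (t + t₀) ^ 2)) := by
        have := topTrace_secondDeriv_gauss hk hkN (γ := k / 2) (η := 0)
          (d := -(δ * (1 + t / t₁))) hs hMpos.le x₀ x
        simpa using this
      have hdt : deriv (fun s => w (s, x)) t = M * (gaussProfile (k / 2) (t + t₀) (‖x - x₀‖ ^ 2)
          * (-(k / 2 : ℝ) / (t + t₀) + ‖x - x₀‖ ^ 2 / (4 * (t + t₀) ^ 2))) + -(δ * (1 / t₁)) := by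
        have h1 := (hasDerivAt_gaussProfile_time (k / 2) (‖x - x₀‖ ^ 2) hs).comp_add_const t t₀
        have h2 := ((((hasDerivAt_id t).div_const t₁).const_add 1).const_mul δ).neg
        exact ((h1.const_mul M).add h2).deriv
      have h1 : 0 < δ * (1 / t₁) := by positivity
      have h2 : 0 ≤ w (t, x) ^ (1 + p) := Real.rpow_nonneg hx _
      rw [hD, hdt]
      linarith
  refine lt_of_lt_of_le (hpar.trans_le ?_) hlow.le
  have hsum : t₁ + t₀ = T₁ := by rw [ht₁]; ring
  have h1 : M * T₁ ^ (-(k / 2 : ℝ)) = c * (t₀ / T₁) ^ (k / 2 : ℝ) := by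
    rw [hM, Real.div_rpow ht₀.le hT₁.le, Real.rpow_neg hT₁.le]
    ring
  have h2 : Real.exp (-k) ≤ Real.exp (-‖x - x₀‖ ^ 2 / (4 * T₁)) := by
    refine Real.exp_le_exp.2 ?_
    rw [le_div_iff₀ (by positivity)]
    linarith
  have h3 : w (t₁, x) = c * (t₀ / T₁) ^ (k / 2 : ℝ) * Real.exp (-‖x - x₀‖ ^ 2 / (4 * T₁))
      - 2 * δ := by
    simp only [hw, gaussProfile]
    rw [hsum, div_self ht₁pos.ne', ← mul_assoc, h1]
    ring
  rw [h3]
  have h4 : 0 ≤ c * (t₀ / T₁) ^ (k / 2 : ℝ) := by positivity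
  have h5 := mul_le_mul_of_nonneg_left h2 h4
  rw [hδ]
  linarith

end lifespan

/-! ### The monotone scheme -/

/-- Reaction terms for which the scheme is globally defined and stable: nondecreasing, Lipschitz
with constant `L`, with values in `[0, M]`. -/
structure IsTameReaction (f : ℝ → ℝ) (L M : ℝ) : Prop where
  mono : Monotone f
  lip : ∀ a b, |f a - f b| ≤ L * |a - b|
  nonneg : ∀ a, 0 ≤ f a
  le : ∀ a, f a ≤ M

theorem IsTameReaction.lip_nonneg {f : ℝ → ℝ} {L M : ℝ} (hf : IsTameReaction f L M) : 0 ≤ L := by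
  have := (abs_nonneg _).trans (hf.lip 1 0)
  simpa using this

theorem IsTameReaction.bound_nonneg {f : ℝ → ℝ} {L M : ℝ} (hf : IsTameReaction f L M) : 0 ≤ M :=
  (hf.nonneg 0).trans (hf.le 0)

theorem IsTameReaction.continuous {f : ℝ → ℝ} {L M : ℝ} (hf : IsTameReaction f L M) :
    Continuous f :=
  (LipschitzWith.of_dist_le_mul (K := ⟨L, hf.lip_nonneg⟩) fun a b => by
    rw [Real.dist_eq, Real.dist_eq]
    exact hf.lip a b).continuous

section scheme

variable {N k : ℕ}

/-- The average of `g` over the `2k` points at distance `a` from `x` along the axes `ξ`. -/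
noncomputable def frameAvg (a : ℝ) (g : EuclideanSpace ℝ (Fin N) → ℝ)
    (ξ : Fin k → EuclideanSpace ℝ (Fin N)) (x : EuclideanSpace ℝ (Fin N)) : ℝ :=
  (∑ i, (g (x + a • ξ i) + g (x - a • ξ i))) / (2 * k)

/-- One step of the monotone scheme: a controller chooses the orthonormal frame of a random walk
with `2k` neighbours so as to maximize the expectation, and the reaction term is treated by an
explicit Euler step. The step length `√(2kh)` makes the average consistent with `h P_k^+`. -/
noncomputable def schemeStep (k : ℕ) (f : ℝ → ℝ) (h : ℝ) (g : EuclideanSpace ℝ (Fin N) → ℝ)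
    (x : EuclideanSpace ℝ (Fin N)) : ℝ :=
  (⨆ ξ : {ξ : Fin k → EuclideanSpace ℝ (Fin N) // Orthonormal ℝ ξ},
    frameAvg (√(2 * k * h)) g ξ.1 x) + h * f (g x)

/-- The discrete solution at the times `0, h, 2h, …`. -/
noncomputable def scheme (k : ℕ) (f : ℝ → ℝ) (h : ℝ) (u₀ : EuclideanSpace ℝ (Fin N) → ℝ) :
    ℕ → EuclideanSpace ℝ (Fin N) → ℝ
  | 0 => u₀
  | n + 1 => schemeStep k f h (scheme k f h u₀ n)

/-- Monotonicity of the average, in a form that also covers translations and additive constants. -/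
theorem frameAvg_mono (hk : 1 ≤ k) {a : ℝ} {g₁ g₂ : EuclideanSpace ℝ (Fin N) → ℝ}
    {ξ : Fin k → EuclideanSpace ℝ (Fin N)} {x₁ x₂ : EuclideanSpace ℝ (Fin N)} {c : ℝ}
    (hp : ∀ i, g₁ (x₁ + a • ξ i) ≤ g₂ (x₂ + a • ξ i) + c)
    (hm : ∀ i, g₁ (x₁ - a • ξ i) ≤ g₂ (x₂ - a • ξ i) + c) :
    frameAvg a g₁ ξ x₁ ≤ frameAvg a g₂ ξ x₂ + c := by
  have hk0 : (0 : ℝ) < k := by exact_mod_cast hk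
  have h : ∑ i, (g₁ (x₁ + a • ξ i) + g₁ (x₁ - a • ξ i))
      ≤ ∑ i, ((g₂ (x₂ + a • ξ i) + g₂ (x₂ - a • ξ i)) + 2 * c) :=
    Finset.sum_le_sum fun i _ => by linarith [hp i, hm i]
  rw [Finset.sum_add_distrib (g := fun _ => 2 * c), Finset.sum_const, Finset.card_univ,
    Fintype.card_fin, nsmul_eq_mul] at h
  unfold frameAvg
  rw [div_add' _ _ _ (by positivity)]
  gcongr
  linarith

theorem frameAvg_le (hk : 1 ≤ k) {a c : ℝ} {g : EuclideanSpace ℝ (Fin N) → ℝ}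
    (hg : ∀ x, g x ≤ c) (ξ : Fin k → EuclideanSpace ℝ (Fin N)) (x : EuclideanSpace ℝ (Fin N)) :
    frameAvg a g ξ x ≤ c := by
  have := frameAvg_mono hk (a := a) (g₁ := g) (g₂ := fun _ => 0) (ξ := ξ) (x₁ := x) (x₂ := x)
    (c := c) (fun i => by simpa using hg _) (fun i => by simpa using hg _)
  simpa [frameAvg] using this

/-- Consistency of the scheme is exact on quadratics: averaging adds `h` times the trace on the
frame. -/
theorem frameAvg_parabolicQuad (hk : 1 ≤ k) {h : ℝ} (hh : 0 ≤ h) (a C : ℝ)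
    (ℓ : EuclideanSpace ℝ (Fin N) →L[ℝ] ℝ)
    (B : EuclideanSpace ℝ (Fin N) →L[ℝ] EuclideanSpace ℝ (Fin N) →L[ℝ] ℝ) (s : ℝ)
    (x₀ x : EuclideanSpace ℝ (Fin N)) (ξ : Fin k → EuclideanSpace ℝ (Fin N)) :
    frameAvg (√(2 * k * h)) (fun y => parabolicQuad a C ℓ B s (y - x₀)) ξ x
      = parabolicQuad a C ℓ B s (x - x₀) + h * ∑ i, B (ξ i) (ξ i) := by
  have hk0 : (0 : ℝ) < k := by exact_mod_cast hk
  set δ := √(2 * k * h) with hδ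
  have hδ2 : δ * δ = 2 * k * h := Real.mul_self_sqrt (by positivity)
  have hterm : ∀ i, parabolicQuad a C ℓ B s (x + δ • ξ i - x₀)
      + parabolicQuad a C ℓ B s (x - δ • ξ i - x₀)
      = 2 * parabolicQuad a C ℓ B s (x - x₀) + 2 * k * h * B (ξ i) (ξ i) := by
    intro i
    have e1 : x + δ • ξ i - x₀ = (x - x₀) + δ • ξ i := by abel
    have e2 : x - δ • ξ i - x₀ = (x - x₀) - δ • ξ i := by abel
    rw [e1, e2, ← hδ2]
    simp only [parabolicQuad, map_add, map_sub, map_smul, add_apply, sub_apply, smul_apply,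
      smul_eq_mul]
    ring
  unfold frameAvg
  rw [Finset.sum_congr rfl fun i _ => hterm i, Finset.sum_add_distrib, ← Finset.mul_sum,
    ← Finset.mul_sum, Finset.sum_const, Finset.card_univ, Fintype.card_fin, nsmul_eq_mul]
  field_simp

theorem nonempty_frames (hkN : k ≤ N) :
    Nonempty {ξ : Fin k → EuclideanSpace ℝ (Fin N) // Orthonormal ℝ ξ} :=
  let ⟨ξ, hξ⟩ := exists_orthonormal_fin hkN
  ⟨⟨ξ, hξ⟩⟩

theorem schemeStep_le (hkN : k ≤ N) {f : ℝ → ℝ} {h c : ℝ} {g : EuclideanSpace ℝ (Fin N) → ℝ}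
    {x : EuclideanSpace ℝ (Fin N)}
    (hc : ∀ ξ : Fin k → EuclideanSpace ℝ (Fin N), Orthonormal ℝ ξ →
      frameAvg (√(2 * k * h)) g ξ x ≤ c) : schemeStep k f h g x ≤ c + h * f (g x) := by
  have := nonempty_frames hkN
  unfold schemeStep
  gcongr
  exact ciSup_le fun ξ => hc ξ.1 ξ.2

theorem le_schemeStep (hk : 1 ≤ k) {f : ℝ → ℝ} {h : ℝ} {g : EuclideanSpace ℝ (Fin N) → ℝ}
    (hg : ∃ c, ∀ x, g x ≤ c) (x : EuclideanSpace ℝ (Fin N))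
    {ξ : Fin k → EuclideanSpace ℝ (Fin N)} (hξ : Orthonormal ℝ ξ) :
    frameAvg (√(2 * k * h)) g ξ x + h * f (g x) ≤ schemeStep k f h g x := by
  obtain ⟨c, hc⟩ := hg
  unfold schemeStep
  gcongr
  refine le_ciSup (f := fun ξ : {ξ : Fin k → EuclideanSpace ℝ (Fin N) // Orthonormal ℝ ξ} =>
    frameAvg (√(2 * k * h)) g ξ.1 x) ⟨c, ?_⟩ ⟨ξ, hξ⟩
  rintro _ ⟨ξ, rfl⟩
  exact frameAvg_le hk hc _ _

variable {f : ℝ → ℝ} {L M b h : ℝ} {u₀ : EuclideanSpace ℝ (Fin N) → ℝ}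

theorem scheme_bounds (hk : 1 ≤ k) (hkN : k ≤ N) (hf : IsTameReaction f L M) (hh : 0 ≤ h)
    (h0 : ∀ x, 0 ≤ u₀ x) (hb : ∀ x, u₀ x ≤ b) (n : ℕ) :
    ∀ x, 0 ≤ scheme k f h u₀ n x ∧ scheme k f h u₀ n x ≤ b + n * h * M := by
  induction n with
  | zero => intro x; simpa [scheme] using ⟨h0 x, hb x⟩
  | succ n ih =>
    intro x
    have hM := hf.bound_nonneg
    constructor
    · obtain ⟨ξ, hξ⟩ := exists_orthonormal_fin (N := N) hkN
      refine le_trans ?_ (le_schemeStep hk ⟨_, fun x => (ih x).2⟩ x hξ)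
      have : 0 ≤ frameAvg (√(2 * k * h)) (scheme k f h u₀ n) ξ x := by
        refine div_nonneg (Finset.sum_nonneg fun i _ => ?_) (by positivity)
        exact add_nonneg (ih _).1 (ih _).1
      have := mul_nonneg hh (hf.nonneg (scheme k f h u₀ n x))
      linarith
    · refine (schemeStep_le hkN fun ξ _ => frameAvg_le hk (fun x => (ih x).2) ξ x).trans ?_
      have := mul_le_mul_of_nonneg_left (hf.le (scheme k f h u₀ n x)) hh
      push_cast
      linarith

/-- The scheme is monotone and invariant under translations, so that a modulus of continuity of the
datum is propagated with a factor that is bounded on bounded time intervals. -/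
theorem scheme_shift (hk : 1 ≤ k) (hkN : k ≤ N) (hf : IsTameReaction f L M) (hh : 0 ≤ h)
    (h0 : ∀ x, 0 ≤ u₀ x) (hb : ∀ x, u₀ x ≤ b) {v : EuclideanSpace ℝ (Fin N)} {ω : ℝ} (hω : 0 ≤ ω)
    (hv : ∀ x, u₀ (x + v) ≤ u₀ x + ω) (n : ℕ) :
    ∀ x, scheme k f h u₀ n (x + v) ≤ scheme k f h u₀ n x + (1 + h * L) ^ n * ω := by
  induction n with
  | zero => intro x; simpa [scheme] using hv x
  | succ n ih =>
    intro x
    have hL := hf.lip_nonneg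
    set g := scheme k f h u₀ n with hg
    set W := (1 + h * L) ^ n * ω with hW
    have hW0 : 0 ≤ W := by positivity
    have hbd : ∃ c, ∀ x, g x ≤ c := ⟨_, fun x => (scheme_bounds hk hkN hf hh h0 hb n x).2⟩
    have hfr : f (g (x + v)) ≤ f (g x) + L * W := by
      have h1 := hf.mono (ih x)
      have h2 := (abs_le.1 (hf.lip (g x + W) (g x))).2
      rw [add_sub_cancel_left, abs_of_nonneg hW0] at h2
      linarith
    have h1 : schemeStep k f h g (x + v)
        ≤ (schemeStep k f h g x - h * f (g x) + W) + h * f (g (x + v)) := by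
      refine schemeStep_le hkN fun ξ hξ => ?_
      have h2 := le_schemeStep (f := f) (h := h) hk hbd x hξ
      have h3 : frameAvg (√(2 * k * h)) g ξ (x + v) ≤ frameAvg (√(2 * k * h)) g ξ x + W := by
        refine frameAvg_mono hk (fun i => ?_) (fun i => ?_)
        · rw [add_right_comm]; exact ih _
        · rw [add_sub_right_comm]; exact ih _
      linarith
    have h2 := mul_le_mul_of_nonneg_left hfr hh
    have h3 : (1 + h * L) ^ (n + 1) * ω = W + h * (L * W) := by rw [hW]; ring
    rw [h3]
    simp only [scheme]
    linarith

/-- A paraboloid above the scheme at one time level stays above it if it is raised at constant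
speed. -/
theorem scheme_le_quadratic (hk : 1 ≤ k) (hkN : k ≤ N) (hf : IsTameReaction f L M) (hh : 0 ≤ h)
    {m C : ℝ} {x₀ : EuclideanSpace ℝ (Fin N)} {n : ℕ}
    (hn : ∀ y, scheme k f h u₀ n y ≤ m + C * ‖y - x₀‖ ^ 2) (j : ℕ) :
    ∀ y, scheme k f h u₀ (n + j) y ≤ m + C * ‖y - x₀‖ ^ 2 + j * h * (2 * k * C + M) := by
  induction j with
  | zero => intro y; simpa using hn y
  | succ j ih =>
    intro y
    rw [← add_assoc, scheme]
    have hq := fun ξ => frameAvg_parabolicQuad (N := N) hk hh 0 0 0 ((2 * C) • innerForm N) 0 x₀ y ξ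
    refine (schemeStep_le (c := m + C * ‖y - x₀‖ ^ 2 + j * h * (2 * k * C + M) + 2 * k * C * h) hkN
      fun ξ hξ => ?_).trans ?_
    · have hq' := hq ξ
      have hP : ∀ y : EuclideanSpace ℝ (Fin N),
          parabolicQuad 0 0 0 ((2 * C) • innerForm N) 0 y = C * ‖y‖ ^ 2 := by
        intro y; simp [parabolicQuad]; ring
      simp only [hP] at hq'
      have hsum : ∑ i, ((2 * C) • innerForm N) (ξ i) (ξ i) = 2 * C * k := by
        simp [hξ.1, mul_comm]
      rw [hsum] at hq'
      refine (frameAvg_mono (g₂ := fun y => C * ‖y - x₀‖ ^ 2) (x₂ := y)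
        (c := m + j * h * (2 * k * C + M)) hk (fun i => ?_) (fun i => ?_)).trans (le_of_eq ?_)
      · linarith [ih (y + √(2 * k * h) • ξ i)]
      · linarith [ih (y - √(2 * k * h) • ξ i)]
      · rw [hq']; ring
    · have := mul_le_mul_of_nonneg_left (hf.le (scheme k f h u₀ (n + j) y)) hh
      push_cast
      linarith

theorem le_scheme_quadratic (hk : 1 ≤ k) (hkN : k ≤ N) (hf : IsTameReaction f L M) (hh : 0 ≤ h)
    (h0 : ∀ x, 0 ≤ u₀ x) (hb : ∀ x, u₀ x ≤ b)
    {m C : ℝ} {x₀ : EuclideanSpace ℝ (Fin N)} {n : ℕ}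
    (hn : ∀ y, m - C * ‖y - x₀‖ ^ 2 ≤ scheme k f h u₀ n y) (j : ℕ) :
    ∀ y, m - C * ‖y - x₀‖ ^ 2 - j * h * (2 * k * C) ≤ scheme k f h u₀ (n + j) y := by
  induction j with
  | zero => intro y; simpa using hn y
  | succ j ih =>
    intro y
    rw [← add_assoc, scheme]
    obtain ⟨ξ, hξ⟩ := exists_orthonormal_fin (N := N) hkN
    refine le_trans ?_ (le_schemeStep hk
      ⟨_, fun x => (scheme_bounds hk hkN hf hh h0 hb (n + j) x).2⟩ y hξ)
    have hq' := frameAvg_parabolicQuad (N := N) hk hh 0 0 0 ((-2 * C) • innerForm N) 0 x₀ y ξ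
    have hP : ∀ y : EuclideanSpace ℝ (Fin N),
        parabolicQuad 0 0 0 ((-2 * C) • innerForm N) 0 y = -(C * ‖y‖ ^ 2) := by
      intro y; simp [parabolicQuad]; ring
    simp only [hP] at hq'
    have hsum : ∑ i, ((-2 * C) • innerForm N) (ξ i) (ξ i) = -2 * C * k := by
      simp [hξ.1, mul_comm]
    rw [hsum] at hq'
    have h1 := frameAvg_mono (a := √(2 * k * h)) (g₁ := fun y => -(C * ‖y - x₀‖ ^ 2))
      (g₂ := scheme k f h u₀ (n + j)) (x₁ := y) (x₂ := y) (ξ := ξ)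
      (c := -(m - j * h * (2 * k * C))) hk
      (fun i => by linarith [ih (y + √(2 * k * h) • ξ i)])
      (fun i => by linarith [ih (y - √(2 * k * h) • ξ i)])
    have h2 := mul_nonneg hh (hf.nonneg (scheme k f h u₀ (n + j) y))
    rw [hq'] at h1
    push_cast
    linarith

theorem one_add_mul_pow_le_exp (hh : 0 ≤ h) (hL : 0 ≤ L) {n : ℕ} {T : ℝ} (hn : n * h ≤ T) :
    (1 + h * L) ^ n ≤ Real.exp (L * T) := by
  calc (1 + h * L) ^ n ≤ Real.exp (h * L) ^ n := by
        gcongr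
        linarith [Real.add_one_le_exp (h * L)]
    _ = Real.exp (L * (n * h)) := by rw [← Real.exp_nat_mul]; congr 1; ring
    _ ≤ _ := by gcongr

theorem exists_scheme_space_modulus (hk : 1 ≤ k) (hkN : k ≤ N) (hf : IsTameReaction f L M)
    (huc : UniformContinuous u₀) (h0 : ∀ x, 0 ≤ u₀ x) (hb : ∀ x, u₀ x ≤ b) (T : ℝ) {ε : ℝ}
    (hε : 0 < ε) :
    ∃ d > 0, ∀ h, 0 ≤ h → ∀ n : ℕ, n * h ≤ T → ∀ x y : EuclideanSpace ℝ (Fin N), ‖x - y‖ < d →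
      scheme k f h u₀ n x ≤ scheme k f h u₀ n y + ε := by
  have hL := hf.lip_nonneg
  set ω := ε / Real.exp (L * T) with hω
  have hωpos : 0 < ω := by positivity
  obtain ⟨d, hd, hmod⟩ := Metric.uniformContinuous_iff.1 huc ω hωpos
  refine ⟨d, hd, fun h hh n hn x y hxy => ?_⟩
  have h1 := scheme_shift (v := x - y) hk hkN hf hh h0 hb hωpos.le (fun z => by
    have := hmod (a := z + (x - y)) (b := z) (by simpa [dist_eq_norm] using hxy)
    rw [Real.dist_eq] at this
    linarith [(abs_lt.1 this).2]) n y
  rw [add_sub_cancel] at h1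
  refine h1.trans ?_
  have h2 : (1 + h * L) ^ n * ω ≤ Real.exp (L * T) * ω := by
    gcongr; exact one_add_mul_pow_le_exp hh hL hn
  have h3 : Real.exp (L * T) * ω = ε := by rw [hω]; field_simp
  linarith

/-- Equicontinuity of the scheme in time and space, uniformly in the time step. Regularity in time
follows from regularity in space by comparison with paraboloids. -/
theorem exists_scheme_modulus (hk : 1 ≤ k) (hkN : k ≤ N) (hf : IsTameReaction f L M)
    (huc : UniformContinuous u₀) (h0 : ∀ x, 0 ≤ u₀ x) (hb : ∀ x, u₀ x ≤ b) {T : ℝ} (hT : 0 ≤ T)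
    {ε : ℝ} (hε : 0 < ε) :
    ∃ d > 0, ∀ h, 0 ≤ h → ∀ n m : ℕ, n * h ≤ T → m * h ≤ T → |(n * h : ℝ) - m * h| < d →
      ∀ x y : EuclideanSpace ℝ (Fin N), ‖x - y‖ < d →
        |scheme k f h u₀ n x - scheme k f h u₀ m y| ≤ ε := by
  have hM := hf.bound_nonneg
  have hb0 : 0 ≤ b := (h0 0).trans (hb 0)
  obtain ⟨d, hd, hmod⟩ := exists_scheme_space_modulus hk hkN hf huc h0 hb T
    (show 0 < ε / 3 by positivity)
  set C := (b + T * M) / d ^ 2 with hC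
  have hC0 : 0 ≤ C := by positivity
  set e := ε / 3 / (2 * k * C + M + 1) with he
  have he0 : 0 < e := by positivity
  -- the scheme at level `n` lies below paraboloids with vertex almost on its graph
  have hquad : ∀ h, 0 ≤ h → ∀ n : ℕ, n * h ≤ T → ∀ x y : EuclideanSpace ℝ (Fin N),
      scheme k f h u₀ n x ≤ scheme k f h u₀ n y + ε / 3 + C * ‖x - y‖ ^ 2 := by
    intro h hh n hn x y
    rcases lt_or_ge ‖x - y‖ d with hlt | hge
    · have h2 : 0 ≤ C * ‖x - y‖ ^ 2 := by positivity
      linarith [hmod h hh n hn x y hlt]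
    · have h1 := (scheme_bounds hk hkN hf hh h0 hb n x).2
      have h2 := (scheme_bounds hk hkN hf hh h0 hb n y).1
      have h3 : n * h * M ≤ T * M := by gcongr
      have h4 : b + T * M ≤ C * ‖x - y‖ ^ 2 := by
        calc b + T * M = C * d ^ 2 := by rw [hC]; field_simp
          _ ≤ _ := by gcongr
      linarith
  have htime : ∀ h, 0 ≤ h → ∀ n j : ℕ, n * h ≤ T → j * h < e → ∀ x : EuclideanSpace ℝ (Fin N),
      |scheme k f h u₀ (n + j) x - scheme k f h u₀ n x| ≤ 2 * (ε / 3) := by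
    intro h hh n j hn hj x
    have h1 := scheme_le_quadratic hk hkN hf hh (fun y => hquad h hh n hn y x) j x
    have h2 := le_scheme_quadratic (m := scheme k f h u₀ n x - ε / 3) (C := C)
      (x₀ := x) (n := n) hk hkN hf hh h0 hb
      (fun y => by
        have := hquad h hh n hn x y
        rw [norm_sub_rev] at this
        linarith) j x
    rw [sub_self, norm_zero] at h1 h2
    have h3 : j * h * (2 * k * C + M) ≤ ε / 3 := by
      calc j * h * (2 * k * C + M) ≤ e * (2 * k * C + M) := by gcongr
        _ ≤ e * (2 * k * C + M + 1) := mul_le_mul_of_nonneg_left (by linarith) he0.le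
        _ = ε / 3 := by rw [he]; field_simp
    have h4 : j * h * (2 * k * C) ≤ j * h * (2 * k * C + M) := by gcongr; linarith
    rw [abs_le]
    constructor <;> linarith
  refine ⟨min d e, lt_min hd he0, fun h hh n m hn hm hnm x y hxy => ?_⟩
  have hxyd : ‖x - y‖ < d := hxy.trans_le (min_le_left _ _)
  have hspace : ∀ n : ℕ, n * h ≤ T → |scheme k f h u₀ n x - scheme k f h u₀ n y| ≤ ε / 3 := by
    intro n hn
    have h1 := hmod h hh n hn x y hxyd
    have h2 := hmod h hh n hn y x (by rwa [norm_sub_rev])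
    rw [abs_le]; constructor <;> linarith
  have hnme := hnm.trans_le (min_le_right _ _)
  rcases le_total n m with hle | hle
  · obtain ⟨j, rfl⟩ := Nat.exists_eq_add_of_le hle
    have hj : j * h < e := by
      have := (abs_lt.1 hnme).1; push_cast at this; linarith
    have h1 := htime h hh n j hn hj y
    have h2 := hspace n hn
    rw [abs_le] at h1 h2 ⊢
    constructor <;> linarith
  · obtain ⟨j, rfl⟩ := Nat.exists_eq_add_of_le hle
    have hj : j * h < e := by
      have := (abs_lt.1 hnme).2; push_cast at this; linarith
    have h1 := htime h hh m j hm hj x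
    have h2 := hspace m hm
    rw [abs_le] at h1 h2 ⊢
    constructor <;> linarith

theorem continuous_scheme (hk : 1 ≤ k) (hkN : k ≤ N) (hf : IsTameReaction f L M)
    (huc : UniformContinuous u₀) (h0 : ∀ x, 0 ≤ u₀ x) (hb : ∀ x, u₀ x ≤ b) (hh : 0 ≤ h) (n : ℕ) :
    Continuous (scheme k f h u₀ n) := by
  rw [Metric.continuous_iff]
  intro x ε hε
  obtain ⟨d, hd, hmod⟩ := exists_scheme_modulus hk hkN hf huc h0 hb
    (show 0 ≤ n * h by positivity) (half_pos hε)
  refine ⟨d, hd, fun y hy => ?_⟩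
  have := hmod h hh n n le_rfl le_rfl (by simpa using hd) y x (by rwa [dist_eq_norm] at hy)
  rw [Real.dist_eq]
  linarith

end scheme

/-! ### Convergence of the scheme -/

section convergence

variable {N k : ℕ}

/-- The combinatorial half of the convergence proof: if piecewise constant interpolations of `V j`
converge locally uniformly to `v` and a test function `q` touches `v` strictly from above at an
interior point, then near that point `V j - q` has a maximum over all grid points of the present
and the preceding time level. It applies to a discrete solution and to its negative. -/
theorem exists_grid_contact {l : Filter ℕ} {h : ℕ → ℝ} (hpos : ∀ j, 0 < h j)
    (hlim : Tendsto h l (𝓝 0)) {V : ℕ → ℕ → EuclideanSpace ℝ (Fin N) → ℝ}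
    (hV : ∀ j n, Continuous (V j n)) {v : ℝ → EuclideanSpace ℝ (Fin N) → ℝ}
    (hconv : ∀ T R ε : ℝ, 0 < ε → ∀ᶠ j in l, ∀ t, 0 ≤ t → t ≤ T → ∀ x, ‖x‖ ≤ R →
      |V j ⌊t / h j⌋₊ x - v t x| ≤ ε)
    {t₀ : ℝ} (ht₀ : 0 < t₀) {x₀ : EuclideanSpace ℝ (Fin N)}
    (hv : ContinuousAt (Function.uncurry v) (t₀, x₀))
    {q : ℝ × EuclideanSpace ℝ (Fin N) → ℝ} (hq : Continuous q) (hq0 : q (t₀, x₀) = 0)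
    {κ : ℝ} (hκ : 0 < κ)
    (htouch : ∀ᶠ z in 𝓝 (t₀, x₀), v z.1 z.2 ≤ v t₀ x₀ + q z
      - κ * ((z.1 - t₀) ^ 2 + ‖z.2 - x₀‖ ^ 2)) {r : ℝ} (hr : 0 < r) :
    ∃ ρ > 0, ∀ᶠ j in l, ∃ (n : ℕ) (x : EuclideanSpace ℝ (Fin N)), |n * h j - t₀| ≤ r ∧
      |V j n x - v t₀ x₀| ≤ r ∧ ∀ y, ‖y - x‖ ≤ ρ →
        V j n y - q (n * h j, y) ≤ V j (n + 1) x - q (((n + 1 : ℕ) : ℝ) * h j, x) := by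
  have hvr : ∀ᶠ z in 𝓝 (t₀, x₀), |v z.1 z.2 - v t₀ x₀| < r / 2 := by
    have := hv.eventually (Metric.ball_mem_nhds _ (half_pos hr))
    filter_upwards [this] with z hz
    simpa [Real.dist_eq, Function.uncurry] using hz
  obtain ⟨r₁, hr₁, hball⟩ := Metric.eventually_nhds_iff_ball.1 (htouch.and hvr)
  obtain ⟨ρ, hρ, hρr₁, hρt, hρr⟩ : ∃ ρ : ℝ, 0 < ρ ∧ 2 * ρ < r₁ ∧ 2 * ρ < t₀ ∧ 2 * ρ ≤ r := by
    refine ⟨min r₁ (min t₀ r) / 4, by positivity, ?_, ?_, ?_⟩ <;>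
    · have h1 := min_le_left r₁ (min t₀ r)
      have h2 := (min_le_right r₁ (min t₀ r)).trans (min_le_left _ _)
      have h3 := (min_le_right r₁ (min t₀ r)).trans (min_le_right _ _)
      linarith
  have hK : ∀ t x, |t - t₀| ≤ 2 * ρ → ‖x - x₀‖ ≤ 2 * ρ →
      v t x ≤ v t₀ x₀ + q (t, x) - κ * ((t - t₀) ^ 2 + ‖x - x₀‖ ^ 2) ∧
        |v t x - v t₀ x₀| < r / 2 := by
    intro t x ht hx
    refine hball (t, x) ?_
    rw [Metric.mem_ball, Prod.dist_eq, max_lt_iff, Real.dist_eq, dist_eq_norm]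
    exact ⟨ht.trans_lt hρr₁, hx.trans_lt hρr₁⟩
  refine ⟨ρ, hρ, ?_⟩
  set ε := min (r / 2) (κ * ρ ^ 2 / 4) with hε
  have hεpos : 0 < ε := lt_min (by positivity) (by positivity)
  have hεr : ε ≤ r / 2 := min_le_left _ _
  have hεκ : ε ≤ κ * ρ ^ 2 / 4 := min_le_right _ _
  have hqev : ∀ᶠ t in 𝓝 t₀, q (t, x₀) < ε := by
    have : Tendsto (fun t => q (t, x₀)) (𝓝 t₀) (𝓝 (q (t₀, x₀))) :=
      (hq.comp (Continuous.prodMk_left x₀)).tendsto t₀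
    rw [hq0] at this
    exact this.eventually (gt_mem_nhds hεpos)
  obtain ⟨η, hη, hηball⟩ := Metric.eventually_nhds_iff.1 hqev
  have hsmall : ∀ᶠ j in l, h j < min η ρ := hlim.eventually (gt_mem_nhds (lt_min hη hρ))
  filter_upwards [hsmall, hconv (t₀ + 2 * ρ) (‖x₀‖ + 2 * ρ) ε hεpos] with j hj hcj
  have hj0 := hpos j
  have hjη := hj.trans_le (min_le_left _ _)
  have hjρ := hj.trans_le (min_le_right _ _)
  have hgrid : ∀ n : ℕ, ∀ x, |n * h j - t₀| ≤ 2 * ρ → ‖x - x₀‖ ≤ 2 * ρ →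
      |V j n x - v (n * h j) x| ≤ ε := by
    intro n x hn hx
    have h1 := hcj (n * h j) (by positivity) (by linarith [(abs_le.1 hn).2]) x
      (by linarith [norm_le_norm_add_norm_sub' x x₀])
    rwa [mul_div_cancel_right₀ _ hj0.ne', Nat.floor_natCast] at h1
  set I : Set ℕ := {n | |(n : ℝ) * h j - t₀| ≤ 2 * ρ} with hI
  have hIfin : I.Finite := by
    refine (Set.finite_Iic ⌊(t₀ + 2 * ρ) / h j⌋₊).subset fun n hn => ?_
    refine Nat.le_floor ?_
    rw [le_div_iff₀ hj0]
    linarith [(abs_le.1 (show |(n : ℝ) * h j - t₀| ≤ 2 * ρ from hn)).2]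
  set D : Set (ℕ × EuclideanSpace ℝ (Fin N)) := I ×ˢ Metric.closedBall x₀ (2 * ρ) with hD
  have hDc : IsCompact D := hIfin.isCompact.prod (isCompact_closedBall _ _)
  set G : ℕ × EuclideanSpace ℝ (Fin N) → ℝ := fun z => V j z.1 z.2 - q (z.1 * h j, z.2) with hG
  have hGc : Continuous G := by
    rw [continuous_prod_of_discrete_left]
    intro n
    exact (hV j n).sub (hq.comp (by fun_prop))
  set n₀ := ⌊t₀ / h j⌋₊ with hn₀
  have hn₀le : n₀ * h j ≤ t₀ := by
    rw [← le_div_iff₀ hj0]; exact Nat.floor_le (by positivity)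
  have hn₀lt : t₀ < n₀ * h j + h j := by
    have := Nat.lt_floor_add_one (t₀ / h j)
    rw [div_lt_iff₀ hj0] at this
    linarith
  have hn₀abs : |n₀ * h j - t₀| < h j := by rw [abs_lt]; constructor <;> linarith
  have hmem : (n₀, x₀) ∈ D := by
    refine ⟨?_, by simp [hρ.le]⟩
    show |n₀ * h j - t₀| ≤ 2 * ρ
    linarith
  obtain ⟨⟨m, x⟩, hmx, hmax⟩ := hDc.exists_isMaxOn ⟨_, hmem⟩ hGc.continuousOn
  have hm : |m * h j - t₀| ≤ 2 * ρ := hmx.1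
  have hx : ‖x - x₀‖ ≤ 2 * ρ := by simpa [dist_eq_norm] using hmx.2
  have hlow : v t₀ x₀ - 2 * ε < G (m, x) := by
    refine lt_of_lt_of_le ?_ (hmax hmem)
    have h1 := hcj t₀ ht₀.le (by linarith) x₀ (by linarith)
    have h2 : q (n₀ * h j, x₀) < ε := hηball (by rw [Real.dist_eq]; linarith)
    have h3 := (abs_le.1 h1).1
    simp only [hG]
    linarith
  have hup : G (m, x) ≤ v t₀ x₀ + ε - κ * ((m * h j - t₀) ^ 2 + ‖x - x₀‖ ^ 2) := by
    have h1 := (abs_le.1 (hgrid m x hm hx)).2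
    have h2 := (hK _ _ hm hx).1
    simp only [hG]
    linarith
  have hsq : (m * h j - t₀) ^ 2 + ‖x - x₀‖ ^ 2 < ρ ^ 2 := by
    have : κ * ((m * h j - t₀) ^ 2 + ‖x - x₀‖ ^ 2) < κ * ρ ^ 2 := by
      have := mul_pos hκ (sq_pos_of_pos hρ)
      linarith
    exact lt_of_mul_lt_mul_left this hκ.le
  have hmρ : |m * h j - t₀| < ρ := by
    refine abs_lt_of_sq_lt_sq ?_ hρ.le
    linarith [sq_nonneg ‖x - x₀‖]
  have hxρ : ‖x - x₀‖ < ρ := by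
    refine lt_of_pow_lt_pow_left₀ 2 hρ.le ?_
    linarith [sq_nonneg (m * h j - t₀)]
  obtain ⟨n, rfl⟩ : ∃ n, m = n + 1 := by
    refine Nat.exists_eq_succ_of_ne_zero ?_
    rintro rfl
    have := (abs_lt.1 hmρ).1
    simp at this
    linarith
  have hnI : |n * h j - t₀| ≤ 2 * ρ := by
    have := abs_lt.1 hmρ
    push_cast at this
    rw [abs_le]
    constructor <;> linarith
  refine ⟨n, x, hnI.trans hρr, ?_, fun y hy => ?_⟩
  · have h1 := hgrid n x hnI hx
    have h2 := (hK _ _ hnI hx).2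
    rw [abs_le] at h1 ⊢
    rw [abs_lt] at h2
    constructor <;> linarith
  · have hyD : (n, y) ∈ D := by
      refine ⟨hnI, ?_⟩
      rw [Metric.mem_closedBall, dist_eq_norm]
      have : ‖y - x₀‖ ≤ ‖y - x‖ + ‖x - x₀‖ := norm_sub_le_norm_sub_add_norm_sub _ _ _
      linarith
    exact hmax hyD

variable {f : ℝ → ℝ} {L M b : ℝ} {u₀ : EuclideanSpace ℝ (Fin N) → ℝ}

/-- A lower bound for the difference quotient in time of the quadratic test function. -/
theorem parabolicQuad_step (a C : ℝ) (ℓ : EuclideanSpace ℝ (Fin N) →L[ℝ] ℝ)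
    (B : EuclideanSpace ℝ (Fin N) →L[ℝ] EuclideanSpace ℝ (Fin N) →L[ℝ] ℝ) {s h r : ℝ}
    (hs : |s| ≤ r) (hh : 0 < h) (hhr : h ≤ r) (y : EuclideanSpace ℝ (Fin N)) :
    h * (a - 3 * |C| * r) ≤ parabolicQuad a C ℓ B (s + h) y - parabolicQuad a C ℓ B s y := by
  have h1 : parabolicQuad a C ℓ B (s + h) y - parabolicQuad a C ℓ B s y
      = h * (a + C * (2 * s + h)) := by
    unfold parabolicQuad; ring
  rw [h1]
  refine mul_le_mul_of_nonneg_left ?_ hh.le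
  have h2 : |2 * s + h| ≤ 3 * r := by
    rw [abs_le] at hs ⊢
    constructor <;> linarith
  have h3 : |C * (2 * s + h)| ≤ |C| * (3 * r) := by
    rw [abs_mul]; gcongr
  linarith [(abs_le.1 h3).1]

/-- Global solvability for tame reaction terms. The solution is a limit, along an ultrafilter, of
the monotone schemes with time step `1 / (j + 1)`; equicontinuity makes it uniformly continuous and
monotonicity with consistency makes it a viscosity solution. -/
theorem exists_tame_solution (hk : 1 ≤ k) (hkN : k ≤ N) (hf : IsTameReaction f L M)
    (huc : UniformContinuous u₀) (h0 : ∀ x, 0 ≤ u₀ x) (hb : ∀ x, u₀ x ≤ b) :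
    ∃ u : ℝ → EuclideanSpace ℝ (Fin N) → ℝ, u 0 = u₀ ∧
      (∀ t, 0 ≤ t → ∀ x, 0 ≤ u t x ∧ u t x ≤ b + t * M) ∧
      (∀ T, UniformContinuousOn (Function.uncurry u) (Icc 0 T ×ˢ univ)) ∧
      ∀ t, 0 < t → ∀ x, IsSubsolutionAt (subOp k f) u t x ∧
        IsSubsolutionAt (superOp k f) (fun t x => -u t x) t x := by
  have hM := hf.bound_nonneg
  have hL := hf.lip_nonneg
  have hb0 : 0 ≤ b := (h0 0).trans (hb 0)
  set h : ℕ → ℝ := fun j => 1 / ((j : ℝ) + 1) with hh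
  have hpos : ∀ j, 0 < h j := fun j => by positivity
  set l : Ultrafilter ℕ := hyperfilter ℕ with hl
  have hlim : Tendsto h l (𝓝 0) :=
    tendsto_one_div_add_atTop_nhds_zero_nat.mono_left Nat.hyperfilter_le_atTop
  set W : ℕ → ℝ → EuclideanSpace ℝ (Fin N) → ℝ := fun j t x => scheme k f (h j) u₀ ⌊t / h j⌋₊ x
    with hW
  have hfloor : ∀ t, 0 ≤ t → ∀ j, ⌊t / h j⌋₊ * h j ≤ t := fun t ht j => by
    rw [← le_div_iff₀ (hpos j)]; exact Nat.floor_le (div_nonneg ht (hpos j).le)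
  have hfloor' : ∀ t j, t < ⌊t / h j⌋₊ * h j + h j := fun t j => by
    have := Nat.lt_floor_add_one (t / h j)
    rw [div_lt_iff₀ (hpos j)] at this
    linarith
  have hWb : ∀ t, 0 ≤ t → ∀ x j, W j t x ∈ Icc 0 (b + t * M) := fun t ht x j => by
    have h1 := scheme_bounds hk hkN hf (hpos j).le h0 hb ⌊t / h j⌋₊ x
    have h2 := mul_le_mul_of_nonneg_right (hfloor t ht j) hM
    exact ⟨h1.1, by linarith [h1.2]⟩
  have hex : ∀ t x, ∃ c : ℝ, 0 ≤ t →
      c ∈ Icc 0 (b + t * M) ∧ Tendsto (fun j => W j t x) l (𝓝 c) := by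
    intro t x
    by_cases ht : 0 ≤ t
    · obtain ⟨c, hc, hle⟩ := isCompact_Icc.ultrafilter_le_nhds (l.map fun j => W j t x)
        (le_principal_iff.2 (mem_map.2 (Eventually.of_forall (hWb t ht x))))
      exact ⟨c, fun _ => ⟨hc, hle⟩⟩
    · exact ⟨0, fun h => absurd h ht⟩
  choose u hu using hex
  have hutend : ∀ t, 0 ≤ t → ∀ x, Tendsto (fun j => W j t x) l (𝓝 (u t x)) :=
    fun t ht x => (hu t x ht).2
  -- equicontinuity of the interpolated schemes, up to the time step
  have hequi : ∀ T, 0 ≤ T → ∀ ε, 0 < ε → ∃ d > 0, ∀ j, h j < d → ∀ t s, 0 ≤ t → t ≤ T → 0 ≤ s →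
      s ≤ T → |t - s| < d → ∀ x y : EuclideanSpace ℝ (Fin N), ‖x - y‖ < d →
        |W j t x - W j s y| ≤ ε := by
    intro T hT ε hε
    obtain ⟨d, hd, hmod⟩ := exists_scheme_modulus hk hkN hf huc h0 hb hT hε
    refine ⟨d / 2, by positivity, fun j hj t s ht htT hs hsT hts x y hxy => ?_⟩
    refine hmod (h j) (hpos j).le _ _ ((hfloor t ht j).trans htT) ((hfloor s hs j).trans hsT) ?_ x y
      (hxy.trans (by linarith))
    have h1 := hfloor t ht j
    have h2 := hfloor s hs j
    have h3 := hfloor' t j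
    have h4 := hfloor' s j
    rw [abs_lt] at hts ⊢
    constructor <;> linarith
  have humod : ∀ T, 0 ≤ T → ∀ ε, 0 < ε → ∃ d > 0, ∀ t s, 0 ≤ t → t ≤ T → 0 ≤ s →
      s ≤ T → |t - s| < d → ∀ x y : EuclideanSpace ℝ (Fin N), ‖x - y‖ < d →
        |u t x - u s y| ≤ ε := by
    intro T hT ε hε
    obtain ⟨d, hd, hmod⟩ := hequi T hT ε hε
    refine ⟨d, hd, fun t s ht htT hs hsT hts x y hxy => ?_⟩
    refine le_of_tendsto ((hutend t ht x).sub (hutend s hs y)).abs ?_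
    filter_upwards [hlim.eventually (gt_mem_nhds hd)] with j hj
    exact hmod j hj t s ht htT hs hsT hts x y hxy
  have hucu : ∀ T, UniformContinuousOn (Function.uncurry u) (Icc 0 T ×ˢ univ) := by
    intro T
    rw [Metric.uniformContinuousOn_iff]
    intro ε hε
    rcases lt_or_ge T 0 with hT | hT
    · exact ⟨1, one_pos, fun z hz => absurd (hz.1.1.trans hz.1.2) (not_le.2 hT)⟩
    obtain ⟨d, hd, hmod⟩ := humod T hT (ε / 2) (half_pos hε)
    refine ⟨d, hd, fun z hz w hw hzw => ?_⟩
    rw [Prod.dist_eq, max_lt_iff, Real.dist_eq, dist_eq_norm] at hzw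
    have := hmod z.1 w.1 hz.1.1 hz.1.2 hw.1.1 hw.1.2 hzw.1 z.2 w.2 hzw.2
    rw [Real.dist_eq]
    exact lt_of_le_of_lt this (half_lt_self hε)
  have hucont : ∀ t, 0 < t → ∀ x, ContinuousAt (Function.uncurry u) (t, x) := by
    intro t ht x
    refine ((hucu (t + 1)).continuousOn).continuousAt ?_
    exact prod_mem_nhds (Icc_mem_nhds ht (by linarith)) univ_mem
  -- pointwise convergence and equicontinuity give locally uniform convergence
  have hconv : ∀ T R ε : ℝ, 0 < ε → ∀ᶠ j in (l : Filter ℕ), ∀ t, 0 ≤ t → t ≤ T → ∀ x, ‖x‖ ≤ R →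
      |W j t x - u t x| ≤ ε := by
    intro T R ε hε
    rcases lt_or_ge T 0 with hT | hT
    · exact Eventually.of_forall fun j t ht htT => absurd (ht.trans htT) (not_le.2 hT)
    have hε3 : 0 < ε / 3 := by positivity
    obtain ⟨d₁, hd₁, hm₁⟩ := hequi T hT (ε / 3) hε3
    obtain ⟨d₂, hd₂, hm₂⟩ := humod T hT (ε / 3) hε3
    have hK : IsCompact (Icc 0 T ×ˢ Metric.closedBall (0 : EuclideanSpace ℝ (Fin N)) R) :=
      isCompact_Icc.prod (isCompact_closedBall _ _)
    obtain ⟨S, hSK, hSfin, hScov⟩ := hK.finite_cover_balls (lt_min hd₁ hd₂)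
    have hS : ∀ᶠ j in (l : Filter ℕ), ∀ c ∈ S, |W j c.1 c.2 - u c.1 c.2| < ε / 3 := by
      rw [eventually_all_finite hSfin]
      intro c hc
      have := (hutend c.1 (hSK hc).1.1 c.2).eventually (Metric.ball_mem_nhds _ hε3)
      simpa [Real.dist_eq] using this
    filter_upwards [hS, hlim.eventually (gt_mem_nhds hd₁)] with j hjS hj t ht htT x hx
    obtain ⟨c, hc, hcz⟩ :=
      mem_iUnion₂.1 (hScov (show (t, x) ∈ _ from ⟨⟨ht, htT⟩, by simpa using hx⟩))
    rw [Metric.mem_ball, Prod.dist_eq, max_lt_iff, Real.dist_eq, dist_eq_norm, lt_min_iff,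
      lt_min_iff] at hcz
    have h1 := hm₁ j hj t c.1 ht htT (hSK hc).1.1 (hSK hc).1.2 hcz.1.1 x c.2 hcz.2.1
    have h2 := hm₂ t c.1 ht htT (hSK hc).1.1 (hSK hc).1.2 hcz.1.2 x c.2 hcz.2.2
    have h3 := (hjS c hc).le
    rw [abs_le] at h1 h2 h3 ⊢
    constructor <;> linarith
  have hcs : ∀ j n, Continuous (scheme k f (h j) u₀ n) := fun j n =>
    continuous_scheme hk hkN hf huc h0 hb (hpos j).le n
  have hsqrt : ∀ ρ > 0, ∀ᶠ j in (l : Filter ℕ), √(2 * k * h j) ≤ ρ := by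
    intro ρ hρ
    have : Tendsto (fun j => √(2 * k * h j)) l (𝓝 (√(2 * k * 0))) :=
      (Real.continuous_sqrt.tendsto _).comp (hlim.const_mul _)
    rw [mul_zero, Real.sqrt_zero] at this
    exact (this.eventually (gt_mem_nhds hρ)).mono fun j hj => hj.le
  have hstep : ∀ (j n : ℕ) (t : ℝ), (((n + 1 : ℕ) : ℝ) * h j) - t = (n * h j - t) + h j := by
    intro j n t; push_cast; ring
  have hnorm : ∀ (δ ρ : ℝ), 0 ≤ δ → δ ≤ ρ → ∀ (ξ : Fin k → EuclideanSpace ℝ (Fin N)),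
      Orthonormal ℝ ξ → ∀ x i, ‖x + δ • ξ i - x‖ ≤ ρ ∧ ‖x - δ • ξ i - x‖ ≤ ρ := by
    intro δ ρ hδ hδρ ξ hξ x i
    have e1 : x + δ • ξ i - x = δ • ξ i := by abel
    have e2 : x - δ • ξ i - x = -(δ • ξ i) := by abel
    rw [e1, e2, norm_neg, norm_smul, hξ.1, Real.norm_of_nonneg hδ]
    simp [hδρ]
  refine ⟨u, ?_, fun t ht x => (hu t x ht).1, hucu, fun t ht x => ⟨?_, ?_⟩⟩
  · funext x
    refine tendsto_nhds_unique (hutend 0 le_rfl x) ?_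
    have : (fun j => W j 0 x) = fun _ => u₀ x := by
      funext j; simp [hW, scheme]
    rw [this]
    exact tendsto_const_nhds
  · refine isSubsolutionAt_of_quadratic (isAdmissible_subOp hkN hf.continuous) ?_
    intro a C κ ℓ B hκ htouch
    set c := L + 3 * |C| with hc
    have hc0 : 0 ≤ c := by positivity
    -- at a grid contact, monotonicity allows replacing the scheme by the quadratic
    have hmain : ∀ r > 0, a ≤ subOp k f (u t x) B + c * r := by
      intro r hr
      obtain ⟨ρ, hρ, hev⟩ := exists_grid_contact hpos hlim hcs hconv ht (hucont t ht x)
        (continuous_parabolicQuad (t₀ := t) (x₀ := x) a C ℓ B) (by simp [parabolicQuad])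
        hκ htouch hr
      obtain ⟨j, ⟨n, y, hn, hval, hmax⟩, hsq, hhr⟩ :=
        (hev.and ((hsqrt ρ hρ).and (hlim.eventually (gt_mem_nhds hr)))).exists
      simp only [hstep] at hmax
      set m := scheme k f (h j) u₀ (n + 1) y - parabolicQuad a C ℓ B (n * h j - t + h j) (y - x)
        with hm
      have h1 : scheme k f (h j) u₀ (n + 1) y
          ≤ (parabolicQuad a C ℓ B (n * h j - t) (y - x) + h j * topTrace k B + m)
            + h j * f (scheme k f (h j) u₀ n y) := by
        refine schemeStep_le hkN fun ξ hξ => ?_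
        have h2 := frameAvg_mono (g₁ := scheme k f (h j) u₀ n) (x₁ := y) (x₂ := y) (c := m) (ξ := ξ)
          (a := √(2 * k * h j)) (g₂ := fun z => parabolicQuad a C ℓ B (n * h j - t) (z - x)) hk
          (fun i => by
            linarith [hmax _ (hnorm _ ρ (Real.sqrt_nonneg _) hsq ξ hξ y i).1])
          (fun i => by
            linarith [hmax _ (hnorm _ ρ (Real.sqrt_nonneg _) hsq ξ hξ y i).2])
        rw [frameAvg_parabolicQuad hk (hpos j).le] at h2
        have h3 := mul_le_mul_of_nonneg_left (le_topTrace B hξ) (hpos j).le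
        linarith
      have h2 := parabolicQuad_step a C ℓ B hn (hpos j) hhr.le (y - x)
      have h3 : h j * (a - 3 * |C| * r)
          ≤ h j * (topTrace k B + f (scheme k f (h j) u₀ n y)) := by linarith
      have h4 := le_of_mul_le_mul_left h3 (hpos j)
      have h5 := (abs_le.1 ((hf.lip (scheme k f (h j) u₀ n y) (u t x)).trans
        (mul_le_mul_of_nonneg_left hval hL))).2
      simp only [subOp, hc]
      linarith
    refine le_of_forall_pos_le_add fun ε hε => (hmain (ε / (c + 1)) (by positivity)).trans ?_
    have : c * (ε / (c + 1)) ≤ ε := by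
      rw [mul_div_assoc', div_le_iff₀ (by positivity)]; nlinarith
    linarith
  · refine isSubsolutionAt_of_quadratic (isAdmissible_superOp hkN hf.continuous) ?_
    intro a C κ ℓ B hκ htouch
    set c := L + 3 * |C| with hc
    have hc0 : 0 ≤ c := by positivity
    have hmain : ∀ r > 0, a ≤ superOp k f (-u t x) B + c * r := by
      intro r hr
      obtain ⟨ρ, hρ, hev⟩ := exists_grid_contact (V := fun j n x => -scheme k f (h j) u₀ n x)
        (v := fun t x => -u t x) hpos hlim (fun j n => (hcs j n).neg)
        (fun T R ε hε => (hconv T R ε hε).mono fun j hj t ht htT x hx => by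
          have := hj t ht htT x hx
          rwa [neg_sub_neg, abs_sub_comm]) ht (hucont t ht x).neg
        (continuous_parabolicQuad (t₀ := t) (x₀ := x) a C ℓ B) (by simp [parabolicQuad])
        hκ htouch hr
      obtain ⟨j, ⟨n, y, hn, hval, hmax⟩, hsq, hhr⟩ :=
        (hev.and ((hsqrt ρ hρ).and (hlim.eventually (gt_mem_nhds hr)))).exists
      simp only [hstep] at hmax
      set m := scheme k f (h j) u₀ (n + 1) y + parabolicQuad a C ℓ B (n * h j - t + h j) (y - x)
        with hm
      have h2 := parabolicQuad_step a C ℓ B hn (hpos j) hhr.le (y - x)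
      have h1 : topTrace k (-B) ≤ -(a - 3 * |C| * r) - f (scheme k f (h j) u₀ n y) := by
        refine topTrace_le _ hkN fun ξ hξ => ?_
        have h3 := le_schemeStep (f := f) (h := h j) hk
          ⟨_, fun x => (scheme_bounds hk hkN hf (hpos j).le h0 hb n x).2⟩ y hξ
        have h4 := frameAvg_mono (g₂ := scheme k f (h j) u₀ n) (x₁ := y) (x₂ := y) (c := -m)
          (ξ := ξ) (a := √(2 * k * h j))
          (g₁ := fun z => parabolicQuad (-a) (-C) (-ℓ) (-B) (n * h j - t) (z - x)) hk
          (fun i => by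
            have := hmax _ (hnorm _ ρ (Real.sqrt_nonneg _) hsq ξ hξ y i).1
            simp only [parabolicQuad, neg_apply] at this hm ⊢
            linarith)
          (fun i => by
            have := hmax _ (hnorm _ ρ (Real.sqrt_nonneg _) hsq ξ hξ y i).2
            simp only [parabolicQuad, neg_apply] at this hm ⊢
            linarith)
        rw [frameAvg_parabolicQuad hk (hpos j).le] at h4
        have h5 : parabolicQuad (-a) (-C) (-ℓ) (-B) (n * h j - t) (y - x)
            = -parabolicQuad a C ℓ B (n * h j - t) (y - x) := by
          simp only [parabolicQuad, neg_apply]; ring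
        have h6 : schemeStep k f (h j) (scheme k f (h j) u₀ n) y
            = scheme k f (h j) u₀ (n + 1) y := rfl
        rw [h5] at h4
        rw [h6] at h3
        have h7 : h j * ∑ i, (-B) (ξ i) (ξ i)
            ≤ h j * (-(a - 3 * |C| * r) - f (scheme k f (h j) u₀ n y)) := by linarith
        exact le_of_mul_le_mul_left h7 (hpos j)
      rw [neg_sub_neg, abs_sub_comm] at hval
      have h5 := (abs_le.1 ((hf.lip (scheme k f (h j) u₀ n y) (u t x)).trans
        (mul_le_mul_of_nonneg_left hval hL))).1
      simp only [superOp, hc, neg_neg]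
      linarith
    refine le_of_forall_pos_le_add fun ε hε => (hmain (ε / (c + 1)) (by positivity)).trans ?_
    have : c * (ε / (c + 1)) ≤ ε := by
      rw [mul_div_assoc', div_le_iff₀ (by positivity)]; nlinarith
    linarith

end convergence

/-! ### Local existence, gluing and continuation -/

/-- The nonlinearity `s^(1+p)`, made constant outside `[0, M]`. -/
noncomputable def truncPow (p M s : ℝ) : ℝ := max 0 (min s M) ^ (1 + p)

theorem truncPow_of_mem {p M s : ℝ} (h0 : 0 ≤ s) (hM : s ≤ M) : truncPow p M s = s ^ (1 + p) := by
  rw [truncPow, min_eq_left hM, max_eq_right h0]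

theorem exists_isTameReaction_truncPow {p M : ℝ} (hp : 0 < p) (hM : 0 ≤ M) :
    ∃ L, IsTameReaction (truncPow p M) L (M ^ (1 + p)) := by
  have hc0 : ∀ s : ℝ, 0 ≤ max 0 (min s M) := fun s => le_max_left _ _
  have hcM : ∀ s : ℝ, max 0 (min s M) ≤ M := fun s => max_le hM (min_le_right _ _)
  refine ⟨(1 + p) * M ^ p, ⟨fun a b hab => ?_, fun a b => ?_, fun a => ?_, fun a => ?_⟩⟩
  · refine Real.rpow_le_rpow (hc0 a) ?_ (by linarith)
    exact max_le_max le_rfl (min_le_min hab le_rfl)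
  · have hder : ∀ x ∈ Icc 0 M, HasDerivWithinAt (fun x : ℝ => x ^ (1 + p)) ((1 + p) * x ^ p)
        (Icc 0 M) x := by
      intro x _
      have := (Real.hasDerivAt_rpow_const (x := x) (p := 1 + p) (Or.inr (by linarith)))
      rw [add_sub_cancel_left] at this
      exact this.hasDerivWithinAt
    have h1 := (convex_Icc (0 : ℝ) M).norm_image_sub_le_of_norm_hasDerivWithin_le
      (C := (1 + p) * M ^ p) hder (fun x hx => by
        have hx0 : 0 ≤ x := hx.1
        rw [Real.norm_of_nonneg (by positivity)]
        have := Real.rpow_le_rpow hx0 hx.2 hp.le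
        gcongr) ⟨hc0 b, hcM b⟩ ⟨hc0 a, hcM a⟩
    have h2 : |max 0 (min a M) - max 0 (min b M)| ≤ |a - b| := by
      refine (abs_max_sub_max_le_max 0 (min a M) 0 (min b M)).trans ?_
      have := abs_min_sub_min_le_max a M b M
      simpa using this
    rw [Real.norm_eq_abs, Real.norm_eq_abs] at h1
    exact h1.trans (mul_le_mul_of_nonneg_left h2 (by positivity))
  · exact Real.rpow_nonneg (hc0 a) _
  · exact Real.rpow_le_rpow (hc0 a) (hcM a) (by linarith)

section localization

variable {N : ℕ} {F : ℝ → (EuclideanSpace ℝ (Fin N) →L[ℝ] EuclideanSpace ℝ (Fin N) →L[ℝ] ℝ) → ℝ}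
  {u v w : ℝ → EuclideanSpace ℝ (Fin N) → ℝ} {t : ℝ} {x : EuclideanSpace ℝ (Fin N)}

theorem IsSubsolutionAt.congr (hu : IsSubsolutionAt F u t x)
    (h : ∀ᶠ s in 𝓝 t, v s = u s) : IsSubsolutionAt F v t x := by
  intro φ hφ hmax
  have h1 : ∀ᶠ z in 𝓝 (t, x), v z.1 = u z.1 := (continuous_fst.tendsto (t, x)).eventually h
  rw [h.self_of_nhds]
  refine hu φ hφ (hmax.congr ?_)
  filter_upwards [h1] with z hz
  rw [hz]

theorem IsSubsolutionAt.time_shift {t₁ : ℝ} (hw : IsSubsolutionAt F w (t - t₁) x) :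
    IsSubsolutionAt F (fun s y => w (s - t₁) y) t x := by
  intro φ hφ hmax
  have ht : t - t₁ + t₁ = t := sub_add_cancel t t₁
  have hmap : Tendsto (fun z : ℝ × EuclideanSpace ℝ (Fin N) => (z.1 + t₁, z.2))
      (𝓝 (t - t₁, x)) (𝓝 (t, x)) := by
    have : Continuous fun z : ℝ × EuclideanSpace ℝ (Fin N) => (z.1 + t₁, z.2) := by fun_prop
    simpa using this.tendsto (t - t₁, x)
  have h1 := hw (fun z => φ (z.1 + t₁, z.2)) (by
    refine ContDiffAt.comp (t - t₁, x) (g := φ) (f := fun z => (z.1 + t₁, z.2)) ?_ (by fun_prop)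
    simpa using hφ) (by
    filter_upwards [hmap.eventually hmax] with z hz
    simpa using hz)
  simp only [ht] at h1
  rwa [deriv_comp_add_const (f := fun s => φ (s, x)), ht] at h1

/-- The function that follows `u` up to time `t₁` and `w`, started at `t₁`, afterwards. -/
noncomputable def glueAt (t₁ : ℝ) (u w : ℝ → EuclideanSpace ℝ (Fin N) → ℝ) (t : ℝ)
    (x : EuclideanSpace ℝ (Fin N)) : ℝ :=
  if t ≤ t₁ then u t x else w (t - t₁) x

theorem glueAt_of_le {t₁ : ℝ} (ht : t ≤ t₁) : glueAt t₁ u w t = u t := by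
  funext x; simp [glueAt, ht]

theorem glueAt_of_lt {t₁ : ℝ} (ht : t₁ < t) : glueAt t₁ u w t = w (t - t₁) := by
  funext x; simp [glueAt, not_le.2 ht]

theorem neg_glueAt {t₁ : ℝ} : (fun t x => -glueAt t₁ u w t x)
    = glueAt t₁ (fun t x => -u t x) (fun t x => -w t x) := by
  funext t x; unfold glueAt; split_ifs <;> rfl

/-- At the gluing time, the viscosity inequality is inherited from the past. -/
theorem isSubsolutionAt_glueAt (hF : IsAdmissible F) {t₁ δ : ℝ} (ht₁ : 0 < t₁)
    (hc : ContinuousOn (Function.uncurry u) (Icc 0 t₁ ×ˢ univ))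
    (hu : ∀ t ∈ Ioo 0 t₁, ∀ x, IsSubsolutionAt F u t x)
    (hw : ∀ t ∈ Ioo 0 δ, ∀ x, IsSubsolutionAt F w t x) (ht : t ∈ Ioo 0 (t₁ + δ))
    (x : EuclideanSpace ℝ (Fin N)) : IsSubsolutionAt F (glueAt t₁ u w) t x := by
  rcases lt_trichotomy t t₁ with h | h | h
  · refine (hu t ⟨ht.1, h⟩ x).congr ?_
    filter_upwards [gt_mem_nhds h] with s hs using glueAt_of_le (le_of_lt hs)
  · subst h
    intro φ hφ hmax
    rw [glueAt_of_le le_rfl]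
    refine deriv_le_of_isLocalMaxOn_past hF (eventually_continuousWithinAt_past ht.1 x hc) ?_ hφ ?_
    · have hpos : ∀ᶠ z in 𝓝[{z : ℝ × EuclideanSpace ℝ (Fin N) | z.1 ≤ t}] (t, x), 0 < z.1 :=
        nhdsWithin_le_nhds ((isOpen_lt continuous_const continuous_fst).mem_nhds ht.1)
      filter_upwards [hpos] with z hz1 hz2 using hu z.1 ⟨hz1, hz2⟩ z.2
    · filter_upwards [nhdsWithin_le_nhds hmax, self_mem_nhdsWithin] with z hz1 hz2
      rwa [glueAt_of_le (show z.1 ≤ t from hz2), glueAt_of_le le_rfl] at hz1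
  · refine (hw (t - t₁) ⟨by linarith, by linarith [ht.2]⟩ x).time_shift.congr ?_
    filter_upwards [lt_mem_nhds h] with s hs using glueAt_of_lt hs

end localization

section solutions

variable {N k : ℕ} {p : ℝ} {u₀ : EuclideanSpace ℝ (Fin N) → ℝ} {T : EReal}
  {u v w : ℝ → EuclideanSpace ℝ (Fin N) → ℝ}

theorem continuous_rpow_one_add (hp : 0 < p) : Continuous fun r : ℝ => r ^ (1 + p) :=
  Real.continuous_rpow_const (by linarith)

theorem IsViscositySolution.isSubsolutionAt (hkN : k ≤ N) (hu : IsViscositySolution k p u₀ T u)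
    {t : ℝ} (ht : 0 < t) (htT : (t : EReal) < T) (x : EuclideanSpace ℝ (Fin N)) :
    IsSubsolutionAt (subOp k fun r => r ^ (1 + p)) u t x :=
  (isSubsolutionAt_subOp_iff hkN).2 (hu.subsolution t x ht htT)

theorem IsViscositySolution.isSubsolutionAt_neg (hkN : k ≤ N) (hu : IsViscositySolution k p u₀ T u)
    {t : ℝ} (ht : 0 < t) (htT : (t : EReal) < T) (x : EuclideanSpace ℝ (Fin N)) :
    IsSubsolutionAt (superOp k fun r => r ^ (1 + p)) (fun t x => -u t x) t x :=
  (isSubsolutionAt_superOp_iff hkN).2 (hu.supersolution t x ht htT)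

/-- The definition of a solution in terms of the one-point notion `IsSubsolutionAt`; continuity is a
consequence of the uniform continuity on `[0, T']` for `T' < T`. -/
theorem isUCSolution_of_isSubsolutionAt (hkN : k ≤ N) (hT : 0 < T)
    (hnn : ∀ t : ℝ, 0 ≤ t → (t : EReal) < T → ∀ x, 0 ≤ u t x) (h0 : u 0 = u₀)
    (huc : ∀ T' : ℝ, (T' : EReal) < T →
      UniformContinuousOn (Function.uncurry u) (Icc 0 T' ×ˢ univ))
    (hsub : ∀ t : ℝ, 0 < t → (t : EReal) < T → ∀ x,
      IsSubsolutionAt (subOp k fun r => r ^ (1 + p)) u t x)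
    (hsup : ∀ t : ℝ, 0 < t → (t : EReal) < T → ∀ x,
      IsSubsolutionAt (superOp k fun r => r ^ (1 + p)) (fun t x => -u t x) t x) :
    IsUCSolution k p u₀ T u where
  pos := hT
  continuousOn := by
    rintro ⟨t, x⟩ ⟨⟨ht, htT⟩, -⟩
    obtain ⟨T', h1, h2⟩ := EReal.lt_iff_exists_real_btwn.1 htT
    refine ((huc T' h2).continuousOn (t, x)
      ⟨⟨ht, (EReal.coe_lt_coe_iff.1 h1).le⟩, mem_univ _⟩).mono_of_mem_nhdsWithin ?_
    have hopen : IsOpen {z : ℝ × EuclideanSpace ℝ (Fin N) | z.1 < T'} :=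
      isOpen_lt continuous_fst continuous_const
    filter_upwards [nhdsWithin_le_nhds (hopen.mem_nhds (EReal.coe_lt_coe_iff.1 h1)),
      self_mem_nhdsWithin] with z hz1 hz2
    exact ⟨⟨hz2.1.1, le_of_lt hz1⟩, mem_univ _⟩
  nonneg := hnn
  initial x := congrFun h0 x
  subsolution t x ht htT := (isSubsolutionAt_subOp_iff hkN).1 (hsub t ht htT x)
  supersolution t x ht htT := (isSubsolutionAt_superOp_iff hkN).1 (hsup t ht htT x)
  uniformContinuousOn := huc

theorem IsUCSolution.mono_time {T' : EReal} (hu : IsUCSolution k p u₀ T u) (hT' : 0 < T')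
    (hle : T' ≤ T) : IsUCSolution k p u₀ T' u where
  pos := hT'
  continuousOn := hu.continuousOn.mono
    (prod_mono (fun _ ht => ⟨ht.1, ht.2.trans_le hle⟩) le_rfl)
  nonneg t ht htT := hu.nonneg t ht (htT.trans_le hle)
  initial := hu.initial
  subsolution t x ht htT := hu.subsolution t x ht (htT.trans_le hle)
  supersolution t x ht htT := hu.supersolution t x ht (htT.trans_le hle)
  uniformContinuousOn T' h := hu.uniformContinuousOn T' (h.trans_le hle)

/-- A solution of the truncated equation solves the original one as long as it stays below the
level of truncation. -/
theorem isUCSolution_of_truncPow (hkN : k ≤ N) {M : ℝ} (hT : 0 < T) (h0 : u 0 = u₀)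
    (hnn : ∀ t, 0 ≤ t → ∀ x, 0 ≤ u t x)
    (huc : ∀ T', UniformContinuousOn (Function.uncurry u) (Icc 0 T' ×ˢ univ))
    (hvisc : ∀ t, 0 < t → ∀ x, IsSubsolutionAt (subOp k (truncPow p M)) u t x ∧
      IsSubsolutionAt (superOp k (truncPow p M)) (fun t x => -u t x) t x)
    (hM : ∀ t : ℝ, 0 ≤ t → (t : EReal) < T → ∀ x, u t x ≤ M) : IsUCSolution k p u₀ T u := by
  refine isUCSolution_of_isSubsolutionAt hkN hT (fun t ht _ x => hnn t ht x) h0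
    (fun T' _ => huc T') (fun t ht htT x φ hφ hmax => ?_) (fun t ht htT x φ hφ hmax => ?_)
  · have := (hvisc t ht x).1 φ hφ hmax
    rwa [subOp, truncPow_of_mem (hnn t ht.le x) (hM t ht.le htT x)] at this
  · have := (hvisc t ht x).2 φ hφ hmax
    rwa [superOp, neg_neg (u t x), truncPow_of_mem (hnn t ht.le x) (hM t ht.le htT x),
      ← neg_neg (u t x)] at this

/-- Local existence, for a time that depends on the bound of the datum only. -/
theorem exists_local_solution (hk : 1 ≤ k) (hkN : k ≤ N) (hp : 0 < p) {b : ℝ} (hb : 0 ≤ b) :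
    ∃ δ : ℝ, 0 < δ ∧ ∀ u₀ : EuclideanSpace ℝ (Fin N) → ℝ, UniformContinuous u₀ →
      (∀ x, 0 ≤ u₀ x) → (∀ x, u₀ x ≤ b) →
        ∃ u : ℝ → EuclideanSpace ℝ (Fin N) → ℝ, IsUCSolution k p u₀ (δ : EReal) u := by
  obtain ⟨L, hf⟩ := exists_isTameReaction_truncPow hp (show 0 ≤ b + 1 by linarith)
  have hF : 0 < (b + 1) ^ (1 + p) := by positivity
  -- until this time the truncated equation raises the bound `b` by at most `1`
  refine ⟨1 / (b + 1) ^ (1 + p), by positivity, fun u₀ huc h0 hub => ?_⟩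
  obtain ⟨u, hu0, hub, huuc, hvisc⟩ := exists_tame_solution hk hkN hf huc h0 hub
  refine ⟨u, isUCSolution_of_truncPow hkN (EReal.coe_pos.2 (by positivity)) hu0
    (fun t ht x => (hub t ht x).1) huuc hvisc fun t ht htT x => ?_⟩
  have h1 := EReal.coe_lt_coe_iff.1 htT
  rw [lt_div_iff₀ hF] at h1
  linarith [(hub t ht x).2]

/-- A solution can be continued by a solution that starts from one of its time slices. -/
theorem IsUCSolution.glue (hkN : k ≤ N) (hp : 0 < p) (hu : IsUCSolution k p u₀ T u) {t₁ δ : ℝ}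
    (ht₁ : 0 < t₁) (ht₁T : (t₁ : EReal) < T) (hw : IsUCSolution k p (u t₁) (δ : EReal) w) :
    IsUCSolution k p u₀ ((t₁ + δ : ℝ) : EReal) (glueAt t₁ u w) := by
  have hδ : 0 < δ := EReal.coe_pos.1 hw.pos
  have hltT : ∀ t ≤ t₁, (t : EReal) < T := fun t ht => (EReal.coe_le_coe_iff.2 ht).trans_lt ht₁T
  have hw0 : w 0 = u t₁ := funext hw.initial
  have hcont := (hu.uniformContinuousOn t₁ ht₁T).continuousOn
  refine isUCSolution_of_isSubsolutionAt hkN (EReal.coe_pos.2 (by linarith)) ?_ ?_ ?_ ?_ ?_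
  · intro t ht htT x
    have htT := EReal.coe_lt_coe_iff.1 htT
    rcases le_or_gt t t₁ with h | h
    · rw [glueAt_of_le h]; exact hu.nonneg t ht (hltT t h) x
    · rw [glueAt_of_lt h]
      exact hw.nonneg _ (by linarith) (EReal.coe_lt_coe_iff.2 (by linarith)) x
  · rw [glueAt_of_le ht₁.le]; exact funext hu.initial
  · intro T' hT'
    have hT' := EReal.coe_lt_coe_iff.1 hT'
    rw [Metric.uniformContinuousOn_iff]
    intro ε hε
    obtain ⟨d₁, hd₁, h₁⟩ := Metric.uniformContinuousOn_iff.1 (hu.uniformContinuousOn t₁ ht₁T)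
      (ε / 2) (half_pos hε)
    obtain ⟨d₂, hd₂, h₂⟩ := Metric.uniformContinuousOn_iff.1
      (hw.uniformContinuousOn (T' - t₁) (EReal.coe_lt_coe_iff.2 (by linarith)))
      (ε / 2) (half_pos hε)
    have hmixed : ∀ t s : ℝ, ∀ x y : EuclideanSpace ℝ (Fin N), 0 ≤ t → t ≤ t₁ → t₁ < s → s ≤ T' →
        |t - s| < min d₁ d₂ → dist x y < min d₁ d₂ → dist (u t x) (w (s - t₁) y) < ε := by
      intro t s x y ht htt hts hs hd hxy
      have h3 := h₁ (t, x) ⟨⟨ht, htt⟩, mem_univ _⟩ (t₁, x) ⟨⟨ht₁.le, le_rfl⟩, mem_univ _⟩ (by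
        rw [Prod.dist_eq, max_lt_iff, dist_self, Real.dist_eq, abs_sub_comm,
          abs_of_nonneg (by linarith)]
        have := (abs_lt.1 (hd.trans_le (min_le_left _ _))).1
        exact ⟨by linarith, hd₁⟩)
      have h4 := h₂ (0, x) ⟨⟨le_rfl, by linarith⟩, mem_univ _⟩ (s - t₁, y)
        ⟨⟨by linarith, by linarith⟩, mem_univ _⟩ (by
        rw [Prod.dist_eq, max_lt_iff, Real.dist_eq, abs_sub_comm, sub_zero,
          abs_of_nonneg (by linarith)]
        have := (abs_lt.1 (hd.trans_le (min_le_right _ _))).1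
        exact ⟨by linarith, hxy.trans_le (min_le_right _ _)⟩)
      simp only [Function.uncurry, hw0] at h3 h4
      linarith [dist_triangle (u t x) (u t₁ x) (w (s - t₁) y)]
    refine ⟨min d₁ d₂, lt_min hd₁ hd₂, ?_⟩
    rintro ⟨t, x⟩ ⟨⟨ht, htT⟩, -⟩ ⟨s, y⟩ ⟨⟨hs, hsT⟩, -⟩ hd
    rw [Prod.dist_eq, max_lt_iff, Real.dist_eq] at hd
    dsimp only at ht htT hs hsT hd
    simp only [Function.uncurry]
    rcases le_or_gt t t₁ with h | h <;> rcases le_or_gt s t₁ with h' | h'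
    · rw [glueAt_of_le h, glueAt_of_le h']
      refine (h₁ (t, x) ⟨⟨ht, h⟩, mem_univ _⟩ (s, y) ⟨⟨hs, h'⟩, mem_univ _⟩ ?_).trans
        (half_lt_self hε)
      rw [Prod.dist_eq, max_lt_iff, Real.dist_eq]
      exact ⟨hd.1.trans_le (min_le_left _ _), hd.2.trans_le (min_le_left _ _)⟩
    · rw [glueAt_of_le h, glueAt_of_lt h']
      exact hmixed t s x y ht h h' hsT hd.1 hd.2
    · rw [glueAt_of_lt h, glueAt_of_le h', dist_comm]
      exact hmixed s t y x hs h' h htT (by rw [abs_sub_comm]; exact hd.1)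
        (by rw [dist_comm]; exact hd.2)
    · rw [glueAt_of_lt h, glueAt_of_lt h']
      refine (h₂ (t - t₁, x) ⟨⟨by linarith, by linarith⟩, mem_univ _⟩ (s - t₁, y)
        ⟨⟨by linarith, by linarith⟩, mem_univ _⟩ ?_).trans (half_lt_self hε)
      rw [Prod.dist_eq, max_lt_iff, Real.dist_eq, sub_sub_sub_cancel_right]
      exact ⟨hd.1.trans_le (min_le_right _ _), hd.2.trans_le (min_le_right _ _)⟩
  · intro t ht htT x
    exact isSubsolutionAt_glueAt (isAdmissible_subOp hkN (continuous_rpow_one_add hp)) ht₁ hcont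
      (fun s hs y => hu.isSubsolutionAt hkN hs.1 (hltT s hs.2.le) y)
      (fun s hs y => hw.isSubsolutionAt hkN hs.1 (EReal.coe_lt_coe_iff.2 hs.2) y)
      ⟨ht, EReal.coe_lt_coe_iff.1 htT⟩ x
  · intro t ht htT x
    rw [neg_glueAt]
    exact isSubsolutionAt_glueAt (u := fun t x => -u t x) (w := fun t x => -w t x)
      (isAdmissible_superOp hkN (continuous_rpow_one_add hp)) ht₁ hcont.neg
      (fun s hs y => hu.isSubsolutionAt_neg hkN hs.1 (hltT s hs.2.le) y)
      (fun s hs y => hw.isSubsolutionAt_neg hkN hs.1 (EReal.coe_lt_coe_iff.2 hs.2) y)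
      ⟨ht, EReal.coe_lt_coe_iff.1 htT⟩ x

/-- A solution whose sup norm does not tend to infinity can be continued, from any earlier time,
beyond its existence time by a fixed amount. -/
theorem exists_extension (hk : 1 ≤ k) (hkN : k ≤ N) (hp : 0 < p) {τ : ℝ}
    (hu : IsUCSolution k p u₀ (τ : EReal) u) (hnb : ¬SupNormBlowsUpAt u τ) :
    ∃ δ : ℝ, 0 < δ ∧ ∀ t₁ < τ, ∃ v : ℝ → EuclideanSpace ℝ (Fin N) → ℝ,
      IsUCSolution k p u₀ ((τ + δ : ℝ) : EReal) v ∧ ∀ t ≤ t₁, v t = u t := by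
  rw [SupNormBlowsUpAt, ENNReal.tendsto_nhds_top_iff_nnreal] at hnb
  push Not at hnb
  obtain ⟨M, hM⟩ := hnb
  obtain ⟨δ, hδ, hloc⟩ := exists_local_solution (N := N) hk hkN hp M.coe_nonneg
  have hτ : 0 < τ := EReal.coe_pos.1 hu.pos
  refine ⟨δ / 2, by positivity, fun t₁ ht₁ => ?_⟩
  have hev : ∀ᶠ t in 𝓝[<] τ, max (max t₁ 0) (τ - δ / 2) < t ∧ t < τ := by
    have : max (max t₁ 0) (τ - δ / 2) < τ := max_lt (max_lt ht₁ hτ) (by linarith)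
    filter_upwards [Ioo_mem_nhdsLT this] with t ht using ht
  -- restart less than `δ / 2` before `τ`, at a time when the sup norm is at most `M`
  obtain ⟨s, hsM, hs, hsτ⟩ := (hM.and_eventually hev).exists
  rw [max_lt_iff, max_lt_iff] at hs
  have hsT : (s : EReal) < τ := EReal.coe_lt_coe_iff.2 hsτ
  have hus : UniformContinuous (u s) := by
    have h := hu.uniformContinuousOn s hsT
    rw [Metric.uniformContinuousOn_iff] at h
    rw [Metric.uniformContinuous_iff]
    intro ε hε
    obtain ⟨d, hd, h⟩ := h ε hε
    refine ⟨d, hd, fun {x y} hxy => ?_⟩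
    refine h (s, x) ⟨⟨hs.1.2.le, le_rfl⟩, mem_univ _⟩ (s, y) ⟨⟨hs.1.2.le, le_rfl⟩, mem_univ _⟩ ?_
    rw [Prod.dist_eq, dist_self]
    exact max_lt hd hxy
  obtain ⟨w, hw⟩ := hloc (u s) hus (hu.nonneg s hs.1.2.le hsT) (fun x => by
    have h1 : ‖u s x‖ₑ ≤ M := (le_iSup (fun x => ‖u s x‖ₑ) x).trans hsM
    rw [enorm_le_coe] at h1
    exact (le_abs_self _).trans (by exact_mod_cast h1))
  refine ⟨glueAt s u w, (hu.glue hkN hp hs.1.2 hsT hw).mono_time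
    (EReal.coe_pos.2 (by linarith)) (EReal.coe_le_coe_iff.2 (by linarith)),
    fun t ht => glueAt_of_le (ht.trans hs.1.1.le)⟩

/-- A function that coincides with solutions up to every time before `τ` is a solution. -/
theorem isUCSolution_of_forall_lt (hkN : k ≤ N) {τ : ℝ} (hτ : 0 < τ)
    (h : ∀ T' < τ, ∃ (T : EReal) (u : ℝ → EuclideanSpace ℝ (Fin N) → ℝ), (T' : EReal) < T ∧
      IsUCSolution k p u₀ T u ∧ ∀ t ≤ T', v t = u t) : IsUCSolution k p u₀ (τ : EReal) v := by
  refine isUCSolution_of_isSubsolutionAt hkN (EReal.coe_pos.2 hτ) ?_ ?_ ?_ ?_ ?_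
  · intro t ht htτ x
    obtain ⟨T, u, hT, hu, heq⟩ := h t (EReal.coe_lt_coe_iff.1 htτ)
    rw [heq t le_rfl]
    exact hu.nonneg t ht hT x
  · obtain ⟨T, u, hT, hu, heq⟩ := h 0 hτ
    rw [heq 0 le_rfl]
    exact funext hu.initial
  · intro T' hT'
    obtain ⟨T, u, hT, hu, heq⟩ := h T' (EReal.coe_lt_coe_iff.1 hT')
    refine (hu.uniformContinuousOn T' hT).congr fun z hz => ?_
    simp only [Function.uncurry]
    rw [heq z.1 hz.1.2]
  · intro t ht htτ x
    obtain ⟨T', h1, h2⟩ := exists_between (EReal.coe_lt_coe_iff.1 htτ)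
    obtain ⟨T, u, hT, hu, heq⟩ := h T' h2
    refine (hu.isSubsolutionAt hkN ht ((EReal.coe_lt_coe_iff.2 h1).trans hT) x).congr ?_
    filter_upwards [gt_mem_nhds h1] with s hs using heq s (le_of_lt hs)
  · intro t ht htτ x
    obtain ⟨T', h1, h2⟩ := exists_between (EReal.coe_lt_coe_iff.1 htτ)
    obtain ⟨T, u, hT, hu, heq⟩ := h T' h2
    refine (hu.isSubsolutionAt_neg hkN ht ((EReal.coe_lt_coe_iff.2 h1).trans hT) x).congr ?_
    filter_upwards [gt_mem_nhds h1] with s hs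
    rw [heq s (le_of_lt hs)]

/-- For bounded data some solution has its sup norm tending to infinity, provided that lifespans are
bounded. It is obtained by extending a local solution repeatedly, each time at least halfway to the
supremum of the times that extensions can reach; if the limit could be continued, it would have been
continued at an earlier stage. -/
theorem exists_supNormBlowsUpAt (hk : 1 ≤ k) (hkN : k ≤ N) (hp : 0 < p) (huc : UniformContinuous u₀)
    (hnn : ∀ x, 0 ≤ u₀ x) (hbdd : BddAbove (range u₀)) {T₀ : ℝ}
    (hT₀ : ∀ (T : EReal) (u : ℝ → EuclideanSpace ℝ (Fin N) → ℝ),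
      IsViscositySolution k p u₀ T u → T ≤ (T₀ : EReal)) :
    ∃ (τ : ℝ) (u : ℝ → EuclideanSpace ℝ (Fin N) → ℝ),
      IsUCSolution k p u₀ (τ : EReal) u ∧ SupNormBlowsUpAt u τ := by
  by_contra! hno
  obtain ⟨b, hb⟩ := hbdd
  have hb' : ∀ x, u₀ x ≤ b := fun x => hb ⟨x, rfl⟩
  obtain ⟨δ₀, hδ₀, hloc⟩ := exists_local_solution (N := N) hk hkN hp ((hnn 0).trans (hb' 0))
  obtain ⟨u₁, hu₁⟩ := hloc u₀ huc hnn hb'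
  -- a stage of the construction is a time and a solution that lives beyond this time
  let S := {s : ℝ × (ℝ → EuclideanSpace ℝ (Fin N) → ℝ) //
    0 ≤ s.1 ∧ ∃ T : EReal, (s.1 : EReal) < T ∧ IsUCSolution k p u₀ T s.2}
  let reach : S → Set ℝ := fun s =>
    {t | ∃ s' : S, s'.1.1 = t ∧ ∀ r ≤ s.1.1, s'.1.2 r = s.1.2 r}
  have hbd : ∀ s, BddAbove (reach s) := by
    refine fun s => ⟨T₀, ?_⟩
    rintro _ ⟨s', rfl, -⟩
    obtain ⟨-, T, h1, h2⟩ := s'.2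
    exact EReal.coe_le_coe_iff.1 (h1.le.trans (hT₀ T _ h2.toIsViscositySolution))
  have hlt : ∀ s : S, s.1.1 < sSup (reach s) := by
    intro s
    obtain ⟨h0, T, h1, h2⟩ := s.2
    obtain ⟨t, h3, h4⟩ := EReal.lt_iff_exists_real_btwn.1 h1
    have h3' := EReal.coe_lt_coe_iff.1 h3
    exact h3'.trans_le (le_csSup (hbd s)
      ⟨⟨(t, s.1.2), h0.trans h3'.le, T, h4, h2⟩, rfl, fun r _ => rfl⟩)
  have hnext : ∀ s : S, ∃ s' : S, (s.1.1 + sSup (reach s)) / 2 < s'.1.1 ∧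
      ∀ r ≤ s.1.1, s'.1.2 r = s.1.2 r := by
    intro s
    have h1 := hlt s
    obtain ⟨_, ⟨s', rfl, hs'⟩, h2⟩ := exists_lt_of_lt_csSup
      (show (reach s).Nonempty from ⟨_, s, rfl, fun r _ => rfl⟩)
      (show (s.1.1 + sSup (reach s)) / 2 < sSup (reach s) by linarith)
    exact ⟨s', h2, hs'⟩
  choose next hnext1 hnext2 using hnext
  let s₀ : S := ⟨(0, u₁), le_rfl, δ₀, EReal.coe_pos.2 hδ₀, hu₁⟩
  let σ : ℕ → S := fun n => next^[n] s₀
  have hσ : ∀ n, σ (n + 1) = next (σ n) := fun n => Function.iterate_succ_apply' _ _ _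
  let t : ℕ → ℝ := fun n => (σ n).1.1
  have htlt : ∀ n, t n < t (n + 1) := by
    intro n
    have h1 := hlt (σ n)
    have h2 := hnext1 (σ n)
    rw [← hσ] at h2
    simp only [t]
    linarith
  have htmono : StrictMono t := strictMono_nat_of_lt_succ htlt
  have htbdd : BddAbove (range t) := by
    refine ⟨T₀, ?_⟩
    rintro _ ⟨n, rfl⟩
    obtain ⟨-, T, h1, h2⟩ := (σ n).2
    exact EReal.coe_le_coe_iff.1 (h1.le.trans (hT₀ T _ h2.toIsViscositySolution))
  set τ := ⨆ n, t n with hτ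
  have htτ : ∀ n, t n < τ := fun n => (htlt n).trans_le (le_ciSup htbdd (n + 1))
  have hτpos : 0 < τ := (σ 0).2.1.trans_lt (htτ 0)
  have hagree : ∀ n m, n ≤ m → ∀ r ≤ t n, (σ m).1.2 r = (σ n).1.2 r := by
    intro n m hnm
    induction m, hnm using Nat.le_induction with
    | base => intro r _; rfl
    | succ m hnm ih =>
      intro r hr
      rw [hσ, hnext2 _ r (hr.trans (htmono.monotone hnm)), ih r hr]
  have hex : ∀ r : ℝ, ∃ n, r < τ → r ≤ t n := by
    intro r
    by_cases hr : r < τ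
    · obtain ⟨n, hn⟩ := exists_lt_of_lt_ciSup hr
      exact ⟨n, fun _ => hn.le⟩
    · exact ⟨0, fun h => absurd h hr⟩
  choose idx hidx using hex
  let v : ℝ → EuclideanSpace ℝ (Fin N) → ℝ := fun r => (σ (idx r)).1.2 r
  have hv : ∀ n, ∀ r ≤ t n, v r = (σ n).1.2 r := by
    intro n r hr
    have h1 := hidx r (hr.trans_lt (htτ n))
    rcases le_total n (idx r) with h | h
    · exact hagree n (idx r) h r hr
    · exact (hagree (idx r) n h r h1).symm
  have hvsol : IsUCSolution k p u₀ (τ : EReal) v := by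
    refine isUCSolution_of_forall_lt hkN hτpos fun T' hT' => ?_
    obtain ⟨n, hn⟩ := exists_lt_of_lt_ciSup hT'
    obtain ⟨-, T, h1, h2⟩ := (σ n).2
    exact ⟨T, (σ n).1.2, (EReal.coe_lt_coe_iff.2 hn).trans h1, h2,
      fun r hr => hv n r (hr.trans hn.le)⟩
  obtain ⟨δ, hδ, hext⟩ := exists_extension hk hkN hp hvsol (hno τ v hvsol)
  -- a late stage could have reached `τ + δ / 2`, so the next stage would be later than `τ`
  obtain ⟨n, hn⟩ := exists_lt_of_lt_ciSup (show τ - δ / 2 < ⨆ n, t n by rw [← hτ]; linarith)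
  obtain ⟨w, hw, hwv⟩ := hext (t n) (htτ n)
  have hreach : τ + δ / 2 ∈ reach (σ n) :=
    ⟨⟨(τ + δ / 2, w), by dsimp only; linarith, _, EReal.coe_lt_coe_iff.2 (by dsimp only; linarith),
      hw⟩, rfl, fun r hr => (hwv r hr).trans (hv n r hr)⟩
  have h1 := le_csSup (hbd (σ n)) hreach
  have h2 := hnext1 (σ n)
  rw [← hσ] at h2
  have h3 := htτ (n + 1)
  simp only [t] at h3 hn
  linarith

theorem blowsUpInFiniteTime (hk : 1 ≤ k) (hkN : k ≤ N) (hp : 0 < p) (hpk : p < 2 / (k : ℝ))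
    (huc : UniformContinuous u₀) (hnn : ∀ x, 0 ≤ u₀ x) (hne : ∃ x, u₀ x ≠ 0) :
    BlowsUpInFiniteTime k p u₀ := by
  obtain ⟨T₀, hT₀⟩ := exists_lifespan_bound hk hkN hp hpk huc.continuous hnn hne
  refine ⟨⟨T₀, hT₀⟩, fun T u hu => ?_, fun hbdd =>
    exists_supNormBlowsUpAt hk hkN hp huc hnn hbdd hT₀⟩
  have hTtop : T ≠ ⊤ := ne_top_of_le_ne_top (EReal.coe_ne_top T₀)
    (hT₀ T u hu.toIsViscositySolution)
  have hTbot : T ≠ ⊥ := (bot_lt_of_lt hu.pos).ne'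
  obtain ⟨τ, rfl⟩ : ∃ τ : ℝ, T = τ := ⟨T.toReal, (EReal.coe_toReal hTtop hTbot).symm⟩
  refine ⟨τ, rfl, ?_⟩
  by_contra hnb
  obtain ⟨δ, hδ, hext⟩ := exists_extension hk hkN hp hu.toIsUCSolution hnb
  obtain ⟨v, hv, -⟩ := hext (τ - 1) (by linarith)
  have := EReal.coe_le_coe_iff.1 (hu.maximal _ v hv)
  linarith

end solutions

/-! ### Global solutions above the exponent `2 / k` -/

section global

variable {N k : ℕ} {p : ℝ}

/-- The reaction at the Gaussian `ε s^{-1/p} exp(-q / (4 s))` is bounded by `κ / s` times the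
Gaussian. For `p > 2 / k` this Gaussian decays more slowly than the heat kernel in dimension `k`,
and with `κ = k / 2 - 1 / p` the difference of the decay rates compensates for the reaction. -/
theorem gaussProfile_rpow_le (hp : 0 < p) {ε κ s q : ℝ} (hε : 0 < ε) (hεκ : ε ^ p = κ) (hs : 0 < s)
    (hq : 0 ≤ q) : (ε * gaussProfile (1 / p) s q) ^ (1 + p)
      ≤ ε * gaussProfile (1 / p) s q * (κ / s) := by
  have hg := gaussProfile_pos (γ := 1 / p) hs q
  have hU : 0 < ε * gaussProfile (1 / p) s q := mul_pos hε hg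
  rw [Real.rpow_add hU, Real.rpow_one]
  refine mul_le_mul_of_nonneg_left ?_ hU.le
  have h1 : gaussProfile (1 / p) s q ≤ s ^ (-(1 / p)) := by
    unfold gaussProfile
    refine mul_le_of_le_one_right (by positivity) (Real.exp_le_one_iff.2 ?_)
    exact div_nonpos_of_nonpos_of_nonneg (neg_nonpos.2 hq) (by positivity)
  have h2 : (s ^ (-(1 / p))) ^ p = s⁻¹ := by
    rw [← Real.rpow_mul hs.le]
    have : -(1 / p) * p = -1 := by field_simp
    rw [this, Real.rpow_neg_one]
  rw [Real.mul_rpow hε.le hg.le, hεκ, div_eq_mul_inv κ s, ← h2]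
  have hκ : 0 ≤ κ := hεκ ▸ (by positivity)
  gcongr

/-- Comparison with the global Gaussian supersolution, for solutions of the truncated equation. The
paraboloid `η e^{Ct} (1 + |x|²)` forces contact to take place in a bounded set. -/
theorem le_gaussProfile_of_tame (hk : 1 ≤ k) (hkN : k ≤ N) (hp : 0 < p) {ε L F b : ℝ} (hε : 0 < ε)
    (hεκ : ε ^ p = k / 2 - 1 / p) (hf : IsTameReaction (truncPow p ε) L F)
    {u : ℝ → EuclideanSpace ℝ (Fin N) → ℝ}
    (h0 : ∀ x, u 0 x ≤ ε * gaussProfile (1 / p) 1 (‖x - 0‖ ^ 2))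
    (hub : ∀ t, 0 ≤ t → ∀ x, u t x ≤ b + t * F)
    (huc : ∀ T, UniformContinuousOn (Function.uncurry u) (Icc 0 T ×ˢ univ))
    (hvisc : ∀ t, 0 < t → ∀ x, IsSubsolutionAt (subOp k (truncPow p ε)) u t x)
    {t : ℝ} (ht : 0 ≤ t) (x : EuclideanSpace ℝ (Fin N)) :
    u t x ≤ ε * gaussProfile (1 / p) (t + 1) (‖x - 0‖ ^ 2) := by
  have hL := hf.lip_nonneg
  have hF := hf.bound_nonneg
  -- `L` accounts for the reaction, `2 k` for the Hessian of the paraboloid, `1` for strictness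
  set C := L + 2 * k + 1 with hC
  have hC0 : 0 ≤ C := by positivity
  have hmain : ∀ η > 0, u t x < ε * gaussProfile (1 / p) (t + 1) (‖x - 0‖ ^ 2)
      + η * Real.exp (C * t) * ‖x - 0‖ ^ 2 + η * Real.exp (C * t) := by
    intro η hη
    set φ : ℝ × EuclideanSpace ℝ (Fin N) → ℝ := fun z =>
      ε * gaussProfile (1 / p) (z.1 + 1) (‖z.2 - 0‖ ^ 2)
        + η * Real.exp (C * z.1) * ‖z.2 - 0‖ ^ 2 + η * Real.exp (C * z.1) with hφ
    have hφ2 : ∀ s, 0 ≤ s → ∀ y, ContDiffAt ℝ 2 φ (s, y) := by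
      intro s hs y
      have h1 : ContDiffAt ℝ 2 (fun z : ℝ × EuclideanSpace ℝ (Fin N) => ‖z.2 - 0‖ ^ 2) (s, y) :=
        ContDiffAt.norm_sq ℝ (by fun_prop)
      have h2 : ContDiffAt ℝ 2 (fun z : ℝ × EuclideanSpace ℝ (Fin N) => η * Real.exp (C * z.1))
          (s, y) := by fun_prop
      exact ((contDiffAt_const.mul (contDiffAt_gaussProfile _ 0 (by linarith) y)).add
        (h2.mul h1)).add h2
    refine lt_of_strict_supersolution (isAdmissible_subOp hkN hf.continuous) (a := 0) (b := t)
      (φ := φ) (huc t).continuousOn (fun s hs y => hvisc s hs.1 y)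
      (fun z hz => (hφ2 z.1 hz.1.1 z.2).continuousAt.continuousWithinAt)
      (fun s hs y => hφ2 s hs.1.le y) ?_ ?_ ?_ t ⟨ht, le_rfl⟩ x
    · intro y
      have h1 : 0 ≤ η * Real.exp (C * 0) * ‖y - 0‖ ^ 2 := by positivity
      have h2 : 0 < η * Real.exp (C * 0) := by positivity
      have := h0 y
      simp only [hφ, zero_add]
      linarith
    · refine ⟨(b + t * F) / η, fun s hs y hy => ?_⟩
      have h1 := hub s hs.1 y
      have h2 : s * F ≤ t * F := mul_le_mul_of_nonneg_right hs.2 hF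
      have h3 := mul_pos hε (gaussProfile_pos (γ := 1 / p) (show 0 < s + 1 by linarith [hs.1])
        (‖y - 0‖ ^ 2))
      have h4 : 1 ≤ Real.exp (C * s) := Real.one_le_exp (mul_nonneg hC0 hs.1)
      have h5 : η ≤ η * Real.exp (C * s) := le_mul_of_one_le_right hη.le h4
      have h6 : η * ‖y‖ ^ 2 ≤ η * Real.exp (C * s) * ‖y - 0‖ ^ 2 := by
        rw [sub_zero]; gcongr
      have h7 : ‖y‖ ≤ 1 + ‖y‖ ^ 2 := by nlinarith [sq_nonneg (‖y‖ - 1)]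
      simp only [hφ] at hy
      rw [le_div_iff₀ hη]
      have h8 := mul_le_mul_of_nonneg_left h7 hη.le
      linarith
    · intro s hs y hy
      have hs1 : 0 < s + 1 := by linarith [hs.1]
      set q := ‖y - 0‖ ^ 2 with hq
      have hq0 : 0 ≤ q := by positivity
      set U := ε * gaussProfile (1 / p) (s + 1) q with hU
      have hUpos : 0 < U := mul_pos hε (gaussProfile_pos hs1 q)
      have hUε : U ≤ ε := by
        refine mul_le_of_le_one_right hε.le ?_
        have e1 : (s + 1) ^ (-(1 / p)) ≤ 1 :=
          Real.rpow_le_one_of_one_le_of_nonpos (by linarith [hs.1])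
            (neg_nonpos.2 (by positivity))
        have e2 : Real.exp (-q / (4 * (s + 1))) ≤ 1 := Real.exp_le_one_iff.2
          (div_nonpos_of_nonpos_of_nonneg (neg_nonpos.2 hq0) (by positivity))
        exact mul_le_one₀ e1 (Real.exp_pos _).le e2
      set η' := η * Real.exp (C * s) with hη'
      have hη'pos : 0 < η' := by positivity
      have hD : topTrace k (secondDeriv (fun z => φ (s, z)) y)
          = U * (-(k / 2 : ℝ) / (s + 1) + q / (4 * (s + 1) ^ 2)) + 2 * k * η' :=
        topTrace_secondDeriv_gauss hk hkN (γ := 1 / p) (M := ε) (η := η') (d := η') hs1 hε.le 0 y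
      have hdt : deriv (fun r => φ (r, y)) s
          = U * (-(1 / p) / (s + 1) + q / (4 * (s + 1) ^ 2)) + C * η' * q + C * η' := by
        have h1 := (hasDerivAt_gaussProfile_time (1 / p) q hs1).comp_add_const s 1
        have h2 : HasDerivAt (fun r => η * Real.exp (C * r)) (C * η') s := by
          refine ((((hasDerivAt_id s).const_mul C).exp).const_mul η).congr_deriv ?_
          simp [hη']; ring
        have h3 : deriv (fun r => φ (r, y)) s = _ :=
          (((h1.const_mul ε).add (h2.mul_const q)).add h2).deriv
        rw [h3, hU]
        ring
      have hreact : truncPow p ε (u s y) ≤ U * ((k / 2 - 1 / p) / (s + 1)) + L * (η' * q + η') := by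
        have h1 := (abs_le.1 (hf.lip (φ (s, y)) U)).2
        have h2 : φ (s, y) - U = η' * q + η' := by simp only [hφ, hU, hη', hq]; ring
        have h3 : truncPow p ε U ≤ U * ((k / 2 - 1 / p) / (s + 1)) := by
          rw [truncPow_of_mem hUpos.le hUε]
          exact gaussProfile_rpow_le hp hε hεκ hs1 hq0
        rw [h2, abs_of_nonneg (by positivity)] at h1
        rw [← hy]
        linarith
      have h4 : U * ((k / 2 - 1 / p) / (s + 1))
          = U * (-(1 / p) / (s + 1)) - U * (-(k / 2 : ℝ) / (s + 1)) := by ring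
      have h5 : 0 ≤ k * η' * q := by positivity
      have h6 : 0 ≤ η' * q := by positivity
      rw [subOp, hD, hdt, hC]
      linarith
  refine le_of_forall_pos_le_add fun ε' hε' => ?_
  have hpos : 0 < Real.exp (C * t) * (‖x - 0‖ ^ 2 + 1) := by positivity
  have := hmain (ε' / (Real.exp (C * t) * (‖x - 0‖ ^ 2 + 1))) (by positivity)
  refine this.le.trans (le_of_eq ?_)
  field_simp
  ring

/-- Above the exponent `2 / k`, a small datum has a global solution that stays below a Gaussian. It
is the solution of the equation truncated at the supremum of this Gaussian. -/
theorem exists_bounded_global_solution (hk : 1 ≤ k) (hkN : k ≤ N) (hp : 0 < p)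
    (hpk : 2 / (k : ℝ) < p) :
    ∃ u₀ : EuclideanSpace ℝ (Fin N) → ℝ, UniformContinuous u₀ ∧ (∀ x, 0 ≤ u₀ x) ∧
      (∃ x, u₀ x ≠ 0) ∧ ∃ u : ℝ → EuclideanSpace ℝ (Fin N) → ℝ,
        IsUCSolution k p u₀ ⊤ u ∧ ∃ M : ℝ, ∀ t : ℝ, 0 ≤ t → ∀ x, u t x ≤ M := by
  have hk0 : (0 : ℝ) < k := by exact_mod_cast hk
  have hκ : 0 < (k / 2 - 1 / p : ℝ) := by
    rw [div_lt_iff₀ hk0] at hpk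
    have : 1 / p < (k / 2 : ℝ) := by rw [div_lt_iff₀ hp]; linarith
    linarith
  set ε := (k / 2 - 1 / p : ℝ) ^ (1 / p) with hε
  have hεpos : 0 < ε := by positivity
  have hεκ : ε ^ p = k / 2 - 1 / p := by
    rw [hε, ← Real.rpow_mul hκ.le, one_div_mul_cancel hp.ne', Real.rpow_one]
  set c := ε * Real.exp (-(1 / 4)) with hc
  have hcpos : 0 < c := by positivity
  have hcε : c ≤ ε := mul_le_of_le_one_right hεpos.le (Real.exp_le_one_iff.2 (by norm_num))
  -- a tent that lies below the Gaussian with `s = 1`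
  set u₀ : EuclideanSpace ℝ (Fin N) → ℝ := fun x => c * max 0 (1 - ‖x‖) with hu₀
  have huc : UniformContinuous u₀ := by
    have h1 : LipschitzWith 1 fun x : EuclideanSpace ℝ (Fin N) => max 0 (1 - ‖x‖) := by
      refine LipschitzWith.of_dist_le_mul fun x y => ?_
      rw [Real.dist_eq, dist_eq_norm, NNReal.coe_one, one_mul]
      refine (abs_max_sub_max_le_max 0 (1 - ‖x‖) 0 (1 - ‖y‖)).trans ?_
      rw [sub_self, abs_zero, sub_sub_sub_cancel_left, abs_sub_comm]
      exact max_le (norm_nonneg _) (abs_norm_sub_norm_le x y)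
    exact (uniformContinuous_const_smul c).comp h1.uniformContinuous
  have hnn : ∀ x, 0 ≤ u₀ x := fun x => mul_nonneg hcpos.le (le_max_left _ _)
  have hle : ∀ x, u₀ x ≤ ε := fun x => by
    have : max 0 (1 - ‖x‖) ≤ 1 := max_le zero_le_one (by linarith [norm_nonneg x])
    exact (mul_le_of_le_one_right hcpos.le this).trans hcε
  obtain ⟨L, hf⟩ := exists_isTameReaction_truncPow hp hεpos.le
  obtain ⟨u, hu0, hub, huuc, hvisc⟩ := exists_tame_solution hk hkN hf huc hnn hle
  have hinit : ∀ x, u 0 x ≤ ε * gaussProfile (1 / p) 1 (‖x - 0‖ ^ 2) := by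
    intro x
    rw [hu0, gaussProfile, Real.one_rpow, one_mul, sub_zero, mul_one]
    rcases le_or_gt ‖x‖ 1 with h | h
    · have h1 : max 0 (1 - ‖x‖) ≤ 1 := max_le zero_le_one (by linarith [norm_nonneg x])
      refine (mul_le_of_le_one_right hcpos.le h1).trans ?_
      refine mul_le_mul_of_nonneg_left (Real.exp_le_exp.2 ?_) hεpos.le
      nlinarith [norm_nonneg x]
    · have h1 : max 0 (1 - ‖x‖) = 0 := max_eq_left (by linarith)
      simp only [hu₀, h1, mul_zero]
      positivity
  have hbound : ∀ t : ℝ, 0 ≤ t → ∀ x, u t x ≤ ε := by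
    intro t ht x
    refine (le_gaussProfile_of_tame hk hkN hp hεpos hεκ hf hinit (fun t ht x => (hub t ht x).2) huuc
      (fun t ht x => (hvisc t ht x).1) ht x).trans (mul_le_of_le_one_right hεpos.le ?_)
    have e1 : (t + 1) ^ (-(1 / p)) ≤ 1 :=
      Real.rpow_le_one_of_one_le_of_nonpos (by linarith) (neg_nonpos.2 (by positivity))
    have e2 : Real.exp (-‖x - 0‖ ^ 2 / (4 * (t + 1))) ≤ 1 := Real.exp_le_one_iff.2
      (div_nonpos_of_nonpos_of_nonneg (neg_nonpos.2 (by positivity)) (by positivity))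
    exact mul_le_one₀ e1 (Real.exp_pos _).le e2
  refine ⟨u₀, huc, hnn, ⟨0, ?_⟩, u, isUCSolution_of_truncPow hkN EReal.zero_lt_top hu0
    (fun t ht x => (hub t ht x).1) huuc hvisc (fun t ht _ x => hbound t ht x), ε, hbound⟩
  simp [hu₀, hcpos.ne']

end global

theorem mainTheorem1 (N k : ℕ) (hk : 1 ≤ k) (hkN : k < N) :
    (∀ p : ℝ, 0 < p → p < 2 / (k : ℝ) →
      ∀ u₀ : EuclideanSpace ℝ (Fin N) → ℝ,
        UniformContinuous u₀ → (∀ x, 0 ≤ u₀ x) → (∃ x, u₀ x ≠ 0) →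
          BlowsUpInFiniteTime k p u₀) ∧
    IsFujitaExponent N k (2 / (k : ℝ)) := by
  have hblow : ∀ p : ℝ, 0 < p → p < 2 / (k : ℝ) →
      ∀ u₀ : EuclideanSpace ℝ (Fin N) → ℝ,
        UniformContinuous u₀ → (∀ x, 0 ≤ u₀ x) → (∃ x, u₀ x ≠ 0) →
          BlowsUpInFiniteTime k p u₀ :=
    fun p hp hpk u₀ huc hnn hne => blowsUpInFiniteTime hk hkN.le hp hpk huc hnn hne
  exact ⟨hblow, hblow, fun p hp hpk => exists_bounded_global_solution hk hkN.le hp hpk⟩
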